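/- Let $n\ge 1$, write $y=(y',y_n)\in\mathbb R^n$, and let $\mathbb B^+_{1/2}=\{y\in\mathbb R^n : |y|<1/2,\ y_n>0\}$ with boundary $\partial\mathbb B^+_{1/2}$ (the flat part $\{|y'|\le 1/2,\ y_n=0\}$ together with the spherical cap $\{|y|=1/2,\ y_n\ge 0\}$), equipped with surface measure. For $s>0$ put $$\psi(y)=e^{s h(y)},\qquad h(y)=-\frac{|y'|^2}{4}+\frac{y_n^2}{2}-y_n .$$ Let $\theta,M>0$. There is $s_0>0$, depending only on $n,\theta,M$, such that for every $s\ge s_0$ and all $K,\delta>0$ there are constants $C_s>0$ and $C_0>0$, depending only on $n,\theta,M,K,\delta,s$, with the following property. Let $\alpha,\lambda\in\mathbb R$ with $|\alpha|\ge\delta$ or $|\lambda|\ge\delta$. Let $a_{ij}\in C^1(\mathbb B^+_{1/2})$ satisfy $|a_{ij}|\le M$, $|D_k a_{ij}|\le M$ and $\sum_{i,j}a_{ij}(y)\xi_i\xi_j\ge\theta|\xi|^2$ for all $y\in\mathbb B^+_{1/2}$, $\xi\in\mathbb R^n$, and let $b=(b_1,\dots,b_n)$ and $c$ satisfy $$\|b_i\|_{W^{1,\infty}(\mathbb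 B^+_{1/2})}\le K(|\alpha|+1)\quad(1\le i\le n),\qquad \|c\|_{W^{1,\infty}(\mathbb B^+_{1/2})}\le K(\alpha^2+|\lambda|),$$ where $\|f\|_{W^{1,\infty}}$ is the largest of the $L^\infty$ norms of $f$ and of its first weak derivatives. Then for every real-valued $v\in C^\infty(\overline{\mathbb B^+_{1/2}})$ and every $$\tau> C_s\big(|\alpha|+\sqrt{|\lambda|}\big)$$ one has \begin{align*} \Big\|e^{\tau\psi}\Big(-\sum_{i,j}a_{ij}D_{ij}v+\sum_i b_iD_iv+cv\Big)\Big\|_{L^2(\mathbb B^+_{1/2})} &+\tau^{3/2}s^2\big\|\psi^{3/2}e^{\tau\psi}v\big\|_{L^2(\partial\mathbb B^+_{1/2})} +\tau^{1/2}s\,\big\|\psi^{1/2}e^{\tau\psi}\nabla v\big\|_{L^2(\partial\mathbb B^+_{1/2})}\\ &\ge C_0\tau^{3/2}s^2\big\|\psi^{3/2}e^{\tau\psi}v\big\|_{L^2(\mathbb B^+_{1/2})} +C_0\tau^{1/2}s\,\big\|\psi^{1/2}e^{\tau\psi}\nabla v\big\|_{L^2(\mathbb B^+_{1/2})}. \end{align*}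 -/

import Mathlib

open MeasureTheory
open scoped ENNReal ContDiff

noncomputable section

namespace HalfBallCarleman

/-- The space `ℝⁿ` with `n = d + 1`; a point is `y = (y', yₙ)`, where `yₙ` is the last coordinate. -/
abbrev E (d : ℕ) : Type := EuclideanSpace ℝ (Fin (d + 1))

/-- The open half ball `{|y| < 1/2, yₙ > 0}`. -/
def halfBall (d : ℕ) : Set (E d) := {y | ‖y‖ < 1 / 2 ∧ 0 < y (Fin.last d)}

/-- The closed half ball `{|y| ≤ 1/2, yₙ ≥ 0}`. -/
def closedHalfBall (d : ℕ) : Set (E d) := {y | ‖y‖ ≤ 1 / 2 ∧ 0 ≤ y (Fin.last d)}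

/-- The inclusion `y' ↦ (y', 0)` of `ℝⁿ⁻¹` into `ℝⁿ`. -/
def flatEmbed (d : ℕ) (z : EuclideanSpace ℝ (Fin d)) : E d :=
  WithLp.toLp 2 (Fin.snoc (α := fun _ => ℝ) (fun i => z i) 0)

/-- The surface measure of the boundary of the half ball: `(n-1)`-dimensional Lebesgue measure on
the flat part `{|y'| < 1/2, yₙ = 0}`, plus the surface measure of the sphere of radius `1/2` (the
image of the one of the unit sphere under `p ↦ p / 2`, with factor `(1/2)ⁿ⁻¹`) on the part of it
with `yₙ > 0`. The edge where the two pieces meet is a null set. -/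
def boundaryMeasure (d : ℕ) : Measure (E d) :=
  Measure.map (flatEmbed d) (volume.restrict (Metric.ball 0 (1 / 2))) +
    ENNReal.ofReal ((1 / 2 : ℝ) ^ d) •
      Measure.map (fun (p : Metric.sphere (0 : E d) 1) => (1 / 2 : ℝ) • (p : E d))
        ((volume : Measure (E d)).toSphere.restrict {p | 0 < (p : E d) (Fin.last d)})

/-- The partial derivative `D_i f` relative to a set `S`; at interior points of `S` it is the usual
one, and on the boundary of the closed half ball it is the one-sided (continuous) extension if `f`
is smooth up to the boundary. -/
def partialWithin {d : ℕ} (S : Set (E d)) (i : Fin (d + 1)) (f : E d → ℝ) (y : E d) : ℝ :=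
  fderivWithin ℝ f S y (EuclideanSpace.single i 1)

/-- The function `h(y) = -|y'|²/4 + yₙ²/2 - yₙ`. -/
def h {d : ℕ} (y : E d) : ℝ :=
  -(∑ i : Fin d, y (Fin.castSucc i) ^ 2) / 4 + y (Fin.last d) ^ 2 / 2 - y (Fin.last d)

/-- The weight `ψ = e^{s h}`. -/
def psi {d : ℕ} (s : ℝ) (y : E d) : ℝ := Real.exp (s * h y)

/-- The operator `-a_{ij} D_{ij} v + b_i D_i v + c v` applied to a function `v` on the closed
half ball. -/
def ellipticOp {d : ℕ} (a : Fin (d + 1) → Fin (d + 1) → E d → ℝ) (b : Fin (d + 1) → E d → ℝ)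
    (c : E d → ℝ) (v : E d → ℝ) (y : E d) : ℝ :=
  -(∑ i, ∑ j, a i j y *
      partialWithin (closedHalfBall d) i (partialWithin (closedHalfBall d) j v) y) +
    ∑ i, b i y * partialWithin (closedHalfBall d) i v y + c y * v y

/-- `a_{ij} ∈ C¹(S)` with `C¹` norm (largest of the sup norms of the entries and of their first
derivatives) at most `M`. -/
def C1NormLE {d : ℕ} (S : Set (E d)) (a : Fin (d + 1) → Fin (d + 1) → E d → ℝ) (M : ℝ) : Prop :=
  ∀ i j, ContDiffOn ℝ 1 (a i j) S ∧
    ∀ y ∈ S, |a i j y| ≤ M ∧ ∀ k, |partialWithin S k (a i j) y| ≤ M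

/-- Uniform ellipticity on `S` with constant `θ`. -/
def UniformlyElliptic {d : ℕ} (S : Set (E d)) (a : Fin (d + 1) → Fin (d + 1) → E d → ℝ)
    (θ : ℝ) : Prop :=
  ∀ y ∈ S, ∀ ξ : E d, θ * ‖ξ‖ ^ 2 ≤ ∑ i, ∑ j, a i j y * ξ i * ξ j

/-- `g` is the weak derivative `D_i f` on the open set `U`. -/
def IsWeakPartial {d : ℕ} (U : Set (E d)) (i : Fin (d + 1)) (f g : E d → ℝ) : Prop :=
  ∀ φ : E d → ℝ, ContDiff ℝ ∞ φ → HasCompactSupport φ → tsupport φ ⊆ U →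
    ∫ y in U, f y * fderiv ℝ φ y (EuclideanSpace.single i 1) = -∫ y in U, g y * φ y

/-- `f ∈ W^{1,∞}(U)` with norm (largest of the `L^∞` norms of `f` and of its weak first
derivatives) at most `K`. -/
def W1InftyNormLE {d : ℕ} (U : Set (E d)) (f : E d → ℝ) (K : ℝ) : Prop :=
  AEStronglyMeasurable f (volume.restrict U) ∧
  eLpNorm f ∞ (volume.restrict U) ≤ ENNReal.ofReal K ∧
  ∀ i, ∃ g : E d → ℝ, AEStronglyMeasurable g (volume.restrict U) ∧
    eLpNorm g ∞ (volume.restrict U) ≤ ENNReal.ofReal K ∧ IsWeakPartial U i f g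

end HalfBallCarleman

end

noncomputable section

namespace HalfBallCarleman

/-! ### Pointwise algebra of the conjugated operator: commutator form, remainder, flux. -/

section Algebraic

section Algebra

variable {ι : Type*} [Fintype ι]

/-! The mechanism is Carleman's: conjugate with the weight and exploit positivity of a commutator.
Put w = e^{τψ}v, σ = τsψ, Q = a∇h·∇h. For symmetric a, the weighted operator equals S + T + R, with
S = -div(a∇w) - Vw, V = σ²Q plus lower order, T = (2σ a∇h + b)·∇w + 2σsQ w, and R of order |∇w| +
σ|w| (`conjugated_operator_eq`). Since (S+T+R)² ≥ 2ST - R², only the product ST matters, and ST is a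
divergence plus a quadratic form J in (w, ∇w) (`sum_flux_deriv_eq`). Differentiating σ gives ∇σ =
sσ∇h, so the leading part of J is 2σs(a∇h·∇w)² + σsQ a∇w·∇w + σ³sQ²w². Because ∇h does not vanish on
the half ball, Q ≥ θ/4 and this dominates sD up to a constant, where D = σ|∇w|² + σ³w². The factor 2
in the last term of T is a choice. Half the divergence of the field would contribute only σsQ w at
leading order and leave no control of the full gradient; the larger coefficient moves one unit of
positivity from w² to the energy, and its cost is absorbed in R.

The errors are of two kinds. Derivatives of a and of ∇h give a multiple of D independent of s, which
large s beats. Everything else carries a factor ε, where σε ≥ 1 and b, c and their derivatives are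
small relative to σ and σ²; ε is chosen after s and then τ is taken large
(`commutator_form_lower_bound`, `remainder_sq_le`, `exists_admissible`). The result is the pointwise
inequality `carleman_pointwise`, with a flux bounded by D.

The divergence is integrated without a trace or divergence theorem on the half ball. The inequality
is multiplied by a cutoff that vanishes near the boundary, and the derivative falls on the cutoff.
Its gradient has size C/r on two layers of width comparable to r, so the flux term is bounded in the
limit r → 0 by a constant times the boundary integral of the density (`flat_layer_le`,
`cap_layer_le`, `carleman_lintegral_estimate`). No sign of the flux is needed, because the boundary
norms of v and ∇v over the whole boundary are allowed in the estimate.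

Two reductions complete the argument. The matrix a may be replaced by its symmetric part, since the
Hessian of v is symmetric. The coefficients b and c are only W^{1,∞}, so the cutoff inequality is
proved for mollifications with the same bounds and passed to the limit (`cutoff_estimate`): the
derivatives of b and c enter only through their bounds. -/

theorem abs_mul_le_mul_of_abs_le {x y X Y : ℝ} (hx : |x| ≤ X) (hy : |y| ≤ Y) :
    |x * y| ≤ X * Y := by
  rw [abs_mul]
  exact mul_le_mul hx hy (abs_nonneg _) ((abs_nonneg _).trans hx)

theorem abs_sum_le_card_mul {f : ι → ℝ} {C : ℝ} (hf : ∀ i, |f i| ≤ C) :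
    |∑ i, f i| ≤ Fintype.card ι * C := by
  calc |∑ i, f i| ≤ ∑ i, |f i| := Finset.abs_sum_le_sum_abs _ _
    _ ≤ ∑ _i : ι, C := Finset.sum_le_sum fun i _ => hf i
    _ = Fintype.card ι * C := by simp

/-- The constant of the errors that do not grow with `s`. -/
def coeffError (N L : ℝ) : ℝ := 2 * N ^ 2 * L ^ 2 + 2 * N * L ^ 2

/-- The constant of the errors that are small when the lower order coefficients are small
and the large parameter is large. -/
def smallError (N L s : ℝ) : ℝ :=
  N ^ 2 * L + N * L + N * L * (s * (s * L ^ 2 + L)) +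
    ((s * L + N * L + N / 2) + N * L / 2 + N * L + N * (2 * s * L ^ 2 + L + 1) / 2 + 2 * s * L)

theorem coeffError_nonneg {N L : ℝ} (hN : 0 ≤ N) : 0 ≤ coeffError N L := by
  unfold coeffError; positivity

set_option maxHeartbeats 1000000 in
/-- Lower bound for the quadratic form that the commutator of the symmetric and the antisymmetric
part of the conjugated operator leaves after integration by parts. -/
theorem commutator_form_lower_bound {N L κ θ s σ ε w W Q e V₁ : ℝ}
    {p u q η z dQ b dV₁ : ι → ℝ} {dq db : ι → ι → ℝ}
    (hN : N = Fintype.card ι) (hL : 0 ≤ L) (hκ : 0 ≤ κ) (hs : 0 ≤ s) (hσ : 0 ≤ σ)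
    (hε : 0 ≤ ε) (hε1 : ε ≤ 1) (hσε : 1 ≤ σ * ε) (hθ : 0 ≤ θ)
    (hu : ∀ i, |u i| ≤ W) (hp : ∀ i, |p i| ≤ L * W) (hq : ∀ i, |q i| ≤ L) (hη : ∀ i, |η i| ≤ L)
    (hz : ∀ i, |z i| ≤ L * W ^ 2) (hdQ : ∀ i, |dQ i| ≤ L) (hdq : ∀ i j, |dq i j| ≤ L)
    (hb : ∀ i, |b i| ≤ ε * σ) (hdb : ∀ i j, |db i j| ≤ ε * σ)
    (hV : |V₁| ≤ ε * σ ^ 2) (hdV : ∀ i, |dV₁ i| ≤ ε * σ ^ 2) (hQL : |Q| ≤ L)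
    (heL : |e| ≤ L * W ^ 2) (hQ : κ ≤ Q) (he : θ * W ^ 2 ≤ e)
    (hpq : ∑ k, p k * η k = ∑ l, q l * u l) (hqη : ∑ k, q k * η k = Q) :
    s * κ * (θ * (σ * W ^ 2) + κ * (σ ^ 3 * w ^ 2)) -
        (coeffError N L + smallError N L s * ε) * (σ * W ^ 2 + σ ^ 3 * w ^ 2) ≤
      ∑ k, ∑ l, p k * (2 * σ * (s * η k * q l + dq k l) + db k l) * u l +
        w * ∑ k, p k * (2 * σ * s * (s * η k * Q + dQ k)) + 2 * σ * s * Q * e -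
        1 / 2 * (∑ k, (2 * σ * (s * η k * q k + dq k k) + db k k)) * e -
        1 / 2 * ∑ l, (2 * σ * q l + b l) * z l +
        w ^ 2 * (1 / 2 * (σ ^ 2 * Q + V₁) *
            (∑ k, (2 * σ * (s * η k * q k + dq k k) + db k k)) +
          1 / 2 * ∑ k, (2 * σ * q k + b k) * (σ ^ 2 * (2 * s * η k * Q + dQ k) + dV₁ k) -
          (σ ^ 2 * Q + V₁) * (2 * σ * s * Q)) := by
  have hN0 : 0 ≤ N := by rw [hN]; positivity
  set m := ∑ l, q l * u l with hm
  set S₁ := ∑ k, ∑ l, p k * dq k l * u l with hS₁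
  set S₂ := ∑ k, ∑ l, p k * db k l * u l with hS₂
  set S₃ := ∑ k, p k * (s * η k * Q + dQ k) with hS₃
  set S₄ := ∑ k, dq k k with hS₄
  set S₅ := ∑ k, db k k with hS₅
  set S₆ := ∑ l, q l * z l with hS₆
  set S₇ := ∑ l, b l * z l with hS₇
  set S₈ := ∑ l, q l * dQ l with hS₈
  set S₉ := ∑ l, q l * dV₁ l with hS₉
  set S₁₀ := ∑ l, b l * (σ ^ 2 * (2 * s * η l * Q + dQ l) + dV₁ l) with hS₁₀
  have e₁ : ∑ k, ∑ l, p k * (2 * σ * (s * η k * q l + dq k l) + db k l) * u l =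
      2 * σ * s * m ^ 2 + 2 * σ * S₁ + S₂ := by
    have h1 : ∑ k, ∑ l, (p k * η k) * (q l * u l) = m ^ 2 := by
      rw [← Finset.sum_mul_sum, hpq, sq]
    rw [← h1, hS₁, hS₂]
    simp only [Finset.mul_sum, ← Finset.sum_add_distrib]
    refine Finset.sum_congr rfl fun k _ => Finset.sum_congr rfl fun l _ => ?_
    ring
  have e₂ : ∑ k, p k * (2 * σ * s * (s * η k * Q + dQ k)) = 2 * σ * s * S₃ := by
    rw [hS₃, Finset.mul_sum]
    exact Finset.sum_congr rfl fun k _ => by ring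
  have e₃ : ∑ k, (2 * σ * (s * η k * q k + dq k k) + db k k) =
      2 * σ * (s * Q + S₄) + S₅ := by
    rw [hS₄, hS₅, ← hqη]
    simp only [Finset.mul_sum, ← Finset.sum_add_distrib]
    exact Finset.sum_congr rfl fun k _ => by ring
  have e₄ : ∑ l, (2 * σ * q l + b l) * z l = 2 * σ * S₆ + S₇ := by
    rw [hS₆, hS₇]
    simp only [Finset.mul_sum, ← Finset.sum_add_distrib]
    exact Finset.sum_congr rfl fun k _ => by ring
  have e₅ : ∑ k, (2 * σ * q k + b k) * (σ ^ 2 * (2 * s * η k * Q + dQ k) + dV₁ k) =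
      4 * σ ^ 3 * s * Q ^ 2 + 2 * σ ^ 3 * S₈ + 2 * σ * S₉ + S₁₀ := by
    have h1 : 4 * σ ^ 3 * s * Q ^ 2 = ∑ k, 4 * σ ^ 3 * s * Q * (q k * η k) := by
      rw [← Finset.mul_sum, hqη]; ring
    rw [h1, hS₈, hS₉, hS₁₀]
    simp only [Finset.mul_sum, ← Finset.sum_add_distrib]
    exact Finset.sum_congr rfl fun k _ => by ring
  rw [e₁, e₂, e₃, e₄, e₅]
  have hηQ : ∀ k, |s * η k * Q + dQ k| ≤ s * L ^ 2 + L := fun k => by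
    refine (abs_add_le _ _).trans (add_le_add ?_ (hdQ k))
    have := abs_mul_le_mul_of_abs_le (abs_mul_le_mul_of_abs_le (abs_of_nonneg hs).le (hη k)) hQL
    linarith
  have b₁ : |S₁| ≤ N ^ 2 * L ^ 2 * W ^ 2 := by
    have := abs_sum_le_card_mul fun k => abs_sum_le_card_mul fun l =>
      abs_mul_le_mul_of_abs_le (abs_mul_le_mul_of_abs_le (hp k) (hdq k l)) (hu l)
    rw [← hN] at this
    linarith
  have b₂ : |S₂| ≤ N ^ 2 * L * W ^ 2 * (ε * σ) := by
    have := abs_sum_le_card_mul fun k => abs_sum_le_card_mul fun l =>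
      abs_mul_le_mul_of_abs_le (abs_mul_le_mul_of_abs_le (hp k) (hdb k l)) (hu l)
    rw [← hN] at this
    linarith
  have b₃ : |S₃| ≤ N * L * W * (s * L ^ 2 + L) := by
    have := abs_sum_le_card_mul fun k => abs_mul_le_mul_of_abs_le (hp k) (hηQ k)
    rw [← hN] at this
    linarith
  have b₄ : |S₄| ≤ N * L := by rw [hN]; exact abs_sum_le_card_mul fun k => hdq k k
  have b₅ : |S₅| ≤ N * (ε * σ) := by rw [hN]; exact abs_sum_le_card_mul fun k => hdb k k
  have b₆ : |S₆| ≤ N * (L * (L * W ^ 2)) := by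
    rw [hN]; exact abs_sum_le_card_mul fun k => abs_mul_le_mul_of_abs_le (hq k) (hz k)
  have b₇ : |S₇| ≤ N * ((ε * σ) * (L * W ^ 2)) := by
    rw [hN]; exact abs_sum_le_card_mul fun k => abs_mul_le_mul_of_abs_le (hb k) (hz k)
  have b₈ : |S₈| ≤ N * (L * L) := by
    rw [hN]; exact abs_sum_le_card_mul fun k => abs_mul_le_mul_of_abs_le (hq k) (hdQ k)
  have b₉ : |S₉| ≤ N * (L * (ε * σ ^ 2)) := by
    rw [hN]; exact abs_sum_le_card_mul fun k => abs_mul_le_mul_of_abs_le (hq k) (hdV k)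
  have b₁₀ : |S₁₀| ≤ N * ((ε * σ) * (σ ^ 2 * (2 * s * L ^ 2 + L + 1))) := by
    rw [hN]
    refine abs_sum_le_card_mul fun k => abs_mul_le_mul_of_abs_le (hb k) ?_
    have h1 := abs_mul_le_mul_of_abs_le (abs_mul_le_mul_of_abs_le (abs_of_nonneg hs).le (hη k)) hQL
    have h2 : |2 * s * η k * Q + dQ k| ≤ 2 * s * L ^ 2 + L := by
      rw [abs_le] at h1 ⊢
      have := abs_le.1 (hdQ k)
      constructor <;> linarith
    have h3 := abs_mul_le_mul_of_abs_le (abs_of_nonneg (sq_nonneg σ)).le h2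
    refine (abs_add_le _ _).trans ?_
    have h4 : ε * σ ^ 2 ≤ 1 * σ ^ 2 := by gcongr
    linarith [hdV k]
  have c₁ : |2 * σ * S₁| ≤ 2 * σ * (N ^ 2 * L ^ 2 * W ^ 2) :=
    abs_mul_le_mul_of_abs_le (abs_of_nonneg (by positivity)).le b₁
  have c₃ : |w * (2 * σ * s * S₃)| ≤
      N * L * (s * (s * L ^ 2 + L)) * ε * (σ * W ^ 2 + σ ^ 3 * w ^ 2) := by
    have h1 : |w * (2 * σ * s * S₃)| ≤ |w| * (2 * σ * s * (N * L * W * (s * L ^ 2 + L))) :=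
      abs_mul_le_mul_of_abs_le le_rfl
        (abs_mul_le_mul_of_abs_le (abs_of_nonneg (by positivity)).le b₃)
    have h2 : 2 * (σ * |w| * W) ≤ σ ^ 2 * w ^ 2 + W ^ 2 := by
      nlinarith [sq_nonneg (σ * |w| - W), sq_abs w]
    -- The cross term σ|w|W is one power of σ below the target density; the hypothesis 1 ≤ σε trades
    -- that power for a factor ε.
    have h3 : σ ^ 2 * w ^ 2 + W ^ 2 ≤ (σ * ε) * (σ ^ 2 * w ^ 2 + W ^ 2) :=
      le_mul_of_one_le_left (by positivity) hσε
    calc _ ≤ N * L * (s * (s * L ^ 2 + L)) * (2 * (σ * |w| * W)) := by linarith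
      _ ≤ N * L * (s * (s * L ^ 2 + L)) * ((σ * ε) * (σ ^ 2 * w ^ 2 + W ^ 2)) := by
        exact mul_le_mul_of_nonneg_left (h2.trans h3) (by positivity)
      _ = _ := by ring
  have c₄ : |σ * S₄ * e| ≤ σ * (N * L) * (L * W ^ 2) :=
    abs_mul_le_mul_of_abs_le (abs_mul_le_mul_of_abs_le (abs_of_nonneg hσ).le b₄) heL
  have c₅ : |S₅ * e| ≤ N * (ε * σ) * (L * W ^ 2) := abs_mul_le_mul_of_abs_le b₅ heL
  have c₆ : |σ * S₆| ≤ σ * (N * (L * (L * W ^ 2))) :=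
    abs_mul_le_mul_of_abs_le (abs_of_nonneg hσ).le b₆
  have hmain : s * κ * (θ * (σ * W ^ 2)) ≤ σ * s * Q * e := by
    have : κ * (θ * W ^ 2) ≤ Q * e := mul_le_mul hQ he (by positivity) (hκ.trans hQ)
    have := mul_le_mul_of_nonneg_left this (mul_nonneg hσ hs)
    linarith
  have hmain' : s * κ * (κ * (σ ^ 3 * w ^ 2)) ≤ σ ^ 3 * s * Q ^ 2 * w ^ 2 := by
    have : κ * κ ≤ Q * Q := mul_le_mul hQ hQ hκ (hκ.trans hQ)
    have h0 : 0 ≤ σ ^ 3 * s * w ^ 2 := by positivity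
    have := mul_le_mul_of_nonneg_left this h0
    linarith
  -- The rank-one part of the derivative of the drift gives a square with the good sign, which is
  -- simply dropped.
  have hm0 : 0 ≤ 2 * σ * s * m ^ 2 := by positivity
  have d₁ : |σ ^ 3 * (Q * S₄)| ≤ σ ^ 3 * (L * (N * L)) :=
    abs_mul_le_mul_of_abs_le (abs_of_nonneg (by positivity)).le (abs_mul_le_mul_of_abs_le hQL b₄)
  have d₂ : |σ ^ 3 * S₈| ≤ σ ^ 3 * (N * (L * L)) :=
    abs_mul_le_mul_of_abs_le (abs_of_nonneg (by positivity)).le b₈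
  have d₃ : |V₁ * (σ * (s * Q + S₄) + S₅ / 2)| ≤
      ε * σ ^ 2 * (σ * (s * L + N * L + N / 2)) := by
    refine abs_mul_le_mul_of_abs_le hV ?_
    have h1 := abs_mul_le_mul_of_abs_le (abs_of_nonneg hσ).le
      ((abs_add_le _ _).trans (add_le_add (abs_mul_le_mul_of_abs_le (abs_of_nonneg hs).le hQL) b₄))
    refine (abs_add_le _ _).trans ?_
    rw [abs_div, abs_two]
    have h2 : N * (ε * σ) ≤ N * (1 * σ) := by gcongr
    linarith
  have d₄ : |σ ^ 2 * (Q * S₅)| ≤ σ ^ 2 * (L * (N * (ε * σ))) :=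
    abs_mul_le_mul_of_abs_le (abs_of_nonneg (by positivity)).le (abs_mul_le_mul_of_abs_le hQL b₅)
  have d₅ : |σ * S₉| ≤ σ * (N * (L * (ε * σ ^ 2))) :=
    abs_mul_le_mul_of_abs_le (abs_of_nonneg hσ).le b₉
  have d₆ : |V₁ * (2 * σ * s * Q)| ≤ ε * σ ^ 2 * (2 * σ * s * L) :=
    abs_mul_le_mul_of_abs_le hV
      (abs_mul_le_mul_of_abs_le (abs_of_nonneg (by positivity)).le hQL)
  set A₀ := σ ^ 3 * (Q * S₄) + σ ^ 3 * S₈ + V₁ * (σ * (s * Q + S₄) + S₅ / 2) +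
    1 / 2 * (σ ^ 2 * (Q * S₅)) + σ * S₉ + 1 / 2 * S₁₀ - V₁ * (2 * σ * s * Q) with hA₀
  have hA : -(σ ^ 3 * (2 * N * L ^ 2 + ((s * L + N * L + N / 2) + N * L / 2 + N * L +
      N * (2 * s * L ^ 2 + L + 1) / 2 + 2 * s * L) * ε)) ≤ A₀ := by
    rw [abs_le] at d₁ d₂ d₃ d₄ d₅ d₆ b₁₀
    linarith
  have hAw := mul_le_mul_of_nonneg_left hA (sq_nonneg w)
  -- Leading coefficients, in units of σsQ: the energy receives 2 - 1 = 1. For w², in units of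
  -- σ³sQ², half the divergence of the drift gives 1, the derivative of the potential gives 2, and
  -- the zeroth order term of the antisymmetric part gives -2, so 1 remains.
  have hsplit : 2 * σ * s * m ^ 2 + 2 * σ * S₁ + S₂ + w * (2 * σ * s * S₃) + 2 * σ * s * Q * e -
        1 / 2 * (2 * σ * (s * Q + S₄) + S₅) * e - 1 / 2 * (2 * σ * S₆ + S₇) +
        w ^ 2 * (1 / 2 * (σ ^ 2 * Q + V₁) * (2 * σ * (s * Q + S₄) + S₅) +
          1 / 2 * (4 * σ ^ 3 * s * Q ^ 2 + 2 * σ ^ 3 * S₈ + 2 * σ * S₉ + S₁₀) -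
          (σ ^ 2 * Q + V₁) * (2 * σ * s * Q)) =
      2 * σ * s * m ^ 2 + σ * s * Q * e + σ ^ 3 * s * Q ^ 2 * w ^ 2 + 2 * σ * S₁ + S₂ +
        w * (2 * σ * s * S₃) - σ * S₄ * e - 1 / 2 * (S₅ * e) - σ * S₆ - 1 / 2 * S₇ +
        w ^ 2 * A₀ := by
    rw [hA₀]; ring
  rw [hsplit]
  have f₁ : 0 ≤ σ * W ^ 2 := by positivity
  have f₂ : 0 ≤ σ ^ 3 * w ^ 2 := by positivity
  have f₃ : 0 ≤ 2 * N ^ 2 * L ^ 2 * (σ ^ 3 * w ^ 2) := by positivity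
  have f₄ : 0 ≤ (N ^ 2 * L + N * L) * ε * (σ ^ 3 * w ^ 2) := by positivity
  have f₅ : 0 ≤ ((s * L + N * L + N / 2) + N * L / 2 + N * L +
      N * (2 * s * L ^ 2 + L + 1) / 2 + 2 * s * L) * ε * (σ * W ^ 2) := by positivity
  rw [abs_le] at c₁ b₂ c₃ c₄ c₅ c₆ b₇
  unfold coeffError smallError
  linarith

/-- The constant in the bound of the first order remainder. -/
def remainderConst (N L s : ℝ) : ℝ := N ^ 2 * L + (2 * s * L + N ^ 2 * L * (L + s * L ^ 2))

/-- The remainder is of order W + σ|w|, so its square lacks one power of σ compared with σW² + σ³w²;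
the factor ε comes from 1 ≤ σε. The constant grows with s, which is harmless because ε is chosen
after s. -/
theorem remainder_sq_le {N L s σ ε w W Q : ℝ} {u η : ι → ℝ} {A H : ι → ι → ℝ}
    {dA : ι → ι → ι → ℝ} (hN : N = Fintype.card ι) (hL : 0 ≤ L) (hs : 0 ≤ s) (hσ : 0 ≤ σ)
    (hσε : 1 ≤ σ * ε) (hW : 0 ≤ W) (hu : ∀ i, |u i| ≤ W) (hη : ∀ i, |η i| ≤ L)
    (hA : ∀ i j, |A i j| ≤ L) (hdA : ∀ k i j, |dA k i j| ≤ L) (hH : ∀ i j, |H i j| ≤ L)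
    (hQL : |Q| ≤ L) :
    (-(2 * σ * s * Q * w) + ∑ i, ∑ j, dA i i j * u j +
        (∑ i, ∑ j, A i j * (σ * (s * η i * η j + H i j))) * w) ^ 2 ≤
      2 * remainderConst N L s ^ 2 * ε * (σ * W ^ 2 + σ ^ 3 * w ^ 2) := by
  have hN0 : 0 ≤ N := by rw [hN]; positivity
  have hC : 0 ≤ remainderConst N L s := by unfold remainderConst; positivity
  have b₁ : |2 * σ * s * Q * w| ≤ 2 * σ * s * L * |w| :=
    abs_mul_le_mul_of_abs_le
      (abs_mul_le_mul_of_abs_le (abs_of_nonneg (by positivity)).le hQL) le_rfl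
  have b₂ : |∑ i, ∑ j, dA i i j * u j| ≤ N * (N * (L * W)) := by
    rw [hN]
    exact abs_sum_le_card_mul fun i => abs_sum_le_card_mul fun j =>
      abs_mul_le_mul_of_abs_le (hdA i i j) (hu j)
  have b₃ : |(∑ i, ∑ j, A i j * (σ * (s * η i * η j + H i j))) * w| ≤
      N * (N * (L * (σ * (s * L * L + L)))) * |w| := by
    rw [hN]
    refine abs_mul_le_mul_of_abs_le (abs_sum_le_card_mul fun i => abs_sum_le_card_mul fun j =>
      abs_mul_le_mul_of_abs_le (hA i j) (abs_mul_le_mul_of_abs_le (abs_of_nonneg hσ).le ?_)) le_rfl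
    exact (abs_add_le _ _).trans (add_le_add (abs_mul_le_mul_of_abs_le
      (abs_mul_le_mul_of_abs_le (abs_of_nonneg hs).le (hη i)) (hη j)) (hH i j))
  set R := -(2 * σ * s * Q * w) + ∑ i, ∑ j, dA i i j * u j +
        (∑ i, ∑ j, A i j * (σ * (s * η i * η j + H i j))) * w with hR
  have hRle : |R| ≤ remainderConst N L s * (W + σ * |w|) := by
    have h0 : |R| ≤ 2 * σ * s * L * |w| + N * (N * (L * W)) +
        N * (N * (L * (σ * (s * L * L + L)))) * |w| := by
      refine (abs_add_le _ _).trans (add_le_add ((abs_add_le _ _).trans (add_le_add ?_ b₂)) b₃)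
      rwa [abs_neg]
    refine h0.trans ?_
    unfold remainderConst
    have f₁ : 0 ≤ N ^ 2 * L * (σ * |w|) := by positivity
    have f₂ : 0 ≤ (2 * s * L + N ^ 2 * L * (L + s * L ^ 2)) * W := by positivity
    linarith
  have h1 : R ^ 2 ≤ (remainderConst N L s * (W + σ * |w|)) ^ 2 := by
    rw [← sq_abs R]; gcongr
  have h2 : (W + σ * |w|) ^ 2 ≤ 2 * (W ^ 2 + σ ^ 2 * w ^ 2) := by
    have h4 : (σ * |w|) ^ 2 = σ ^ 2 * w ^ 2 := by rw [mul_pow, sq_abs]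
    linarith [sq_nonneg (W - σ * |w|), add_sq W (σ * |w|), sub_sq W (σ * |w|)]
  have h3 : W ^ 2 + σ ^ 2 * w ^ 2 ≤ (σ * ε) * (W ^ 2 + σ ^ 2 * w ^ 2) :=
    le_mul_of_one_le_left (by positivity) hσε
  calc R ^ 2 ≤ (remainderConst N L s * (W + σ * |w|)) ^ 2 := h1
    _ = remainderConst N L s ^ 2 * (W + σ * |w|) ^ 2 := by ring
    _ ≤ remainderConst N L s ^ 2 * (2 * ((σ * ε) * (W ^ 2 + σ ^ 2 * w ^ 2))) :=
      mul_le_mul_of_nonneg_left (h2.trans (by linarith)) (sq_nonneg _)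
    _ = _ := by ring

/-- The constant in the bound of the flux. -/
def fluxConst (N L s : ℝ) : ℝ :=
  N * L * (2 * L + 1) + s * L ^ 2 + (2 * L + 1) * L + (2 * L + 1) * (L + 1)

/-- Each product in the flux has at most the homogeneity of σW² + σ³w²; the mixed term σ|w|W is
split by Young's inequality and uses σ ≥ 1. -/
theorem abs_flux_le {N L s σ ε w W Q e V₁ pk Bk : ℝ} {u B : ι → ℝ}
    (hN : N = Fintype.card ι) (hL : 0 ≤ L) (hs : 0 ≤ s) (hσ : 1 ≤ σ) (hε1 : ε ≤ 1)
    (hu : ∀ i, |u i| ≤ W) (hp : |pk| ≤ L * W)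
    (hB : ∀ i, |B i| ≤ σ * (2 * L + 1)) (hBk : |Bk| ≤ σ * (2 * L + 1))
    (hV : |V₁| ≤ ε * σ ^ 2) (hQL : |Q| ≤ L) (heL : |e| ≤ L * W ^ 2) :
    |-pk * (∑ l, B l * u l + 2 * σ * s * Q * w) +
        1 / 2 * (Bk * (e - (σ ^ 2 * Q + V₁) * w ^ 2))| ≤
      fluxConst N L s * (σ * W ^ 2 + σ ^ 3 * w ^ 2) := by
  have hN0 : 0 ≤ N := by rw [hN]; positivity
  have hσ0 : 0 ≤ σ := zero_le_one.trans hσ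
  have b₁ : |∑ l, B l * u l| ≤ N * (σ * (2 * L + 1) * W) := by
    rw [hN]; exact abs_sum_le_card_mul fun l => abs_mul_le_mul_of_abs_le (hB l) (hu l)
  have b₂ : |2 * σ * s * Q * w| ≤ 2 * σ * s * L * |w| :=
    abs_mul_le_mul_of_abs_le
      (abs_mul_le_mul_of_abs_le (abs_of_nonneg (by positivity)).le hQL) le_rfl
  have b₃ := abs_mul_le_mul_of_abs_le ((abs_neg pk).le.trans hp)
    ((abs_add_le _ _).trans (add_le_add b₁ b₂))
  have b₄ : |σ ^ 2 * Q + V₁| ≤ σ ^ 2 * (L + 1) := by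
    have h1 := abs_mul_le_mul_of_abs_le (abs_of_nonneg (sq_nonneg σ)).le hQL
    have h2 : ε * σ ^ 2 ≤ 1 * σ ^ 2 := by gcongr
    refine (abs_add_le _ _).trans ?_
    linarith
  have b₅ : |e - (σ ^ 2 * Q + V₁) * w ^ 2| ≤ L * W ^ 2 + σ ^ 2 * (L + 1) * w ^ 2 :=
    (abs_sub _ _).trans (add_le_add heL
      (abs_mul_le_mul_of_abs_le b₄ (abs_of_nonneg (sq_nonneg w)).le))
  have b₆ := abs_mul_le_mul_of_abs_le hBk b₅
  refine (abs_add_le _ _).trans ?_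
  have b₇ : |1 / 2 * (Bk * (e - (σ ^ 2 * Q + V₁) * w ^ 2))| ≤
      1 / 2 * (σ * (2 * L + 1) * (L * W ^ 2 + σ ^ 2 * (L + 1) * w ^ 2)) :=
    abs_mul_le_mul_of_abs_le (abs_of_nonneg (by norm_num)).le b₆
  have h2 : 2 * (|w| * W) ≤ w ^ 2 + W ^ 2 := by
    linarith [sq_nonneg (|w| - W), sq_abs w, sub_sq |w| W]
  have h3 : σ * w ^ 2 ≤ σ ^ 3 * w ^ 2 := by
    gcongr; exact le_self_pow₀ hσ (by norm_num)
  have h4 : σ * s * L ^ 2 * (2 * (|w| * W)) ≤ s * L ^ 2 * (σ * W ^ 2 + σ ^ 3 * w ^ 2) := by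
    calc _ ≤ σ * s * L ^ 2 * (w ^ 2 + W ^ 2) := mul_le_mul_of_nonneg_left h2 (by positivity)
      _ = s * L ^ 2 * (σ * W ^ 2 + σ * w ^ 2) := by ring
      _ ≤ _ := mul_le_mul_of_nonneg_left (by linarith) (by positivity)
  have f₁ : 0 ≤ (2 * L + 1) * L * (σ * W ^ 2) := by positivity
  have f₂ : 0 ≤ (2 * L + 1) * (L + 1) * (σ ^ 3 * w ^ 2) := by positivity
  have f₃ : 0 ≤ N * L * (2 * L + 1) * (σ ^ 3 * w ^ 2) := by positivity
  have f₄ : 0 ≤ (2 * L + 1) * L * (σ ^ 3 * w ^ 2) := by positivity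
  have f₅ : 0 ≤ (2 * L + 1) * (L + 1) * (σ * W ^ 2) := by positivity
  unfold fluxConst
  linarith

/-- Since ∇w = e^{τψ}∇v + σw∇h, this bound with t = σw and with t = -σw compares the densities
written in terms of w and of v in both directions. -/
theorem sum_sq_add_mul_le {N L t : ℝ} {x η : ι → ℝ} (hN : N = Fintype.card ι)
    (hη : ∀ i, |η i| ≤ L) :
    ∑ i, (x i + t * η i) ^ 2 ≤ 2 * ∑ i, x i ^ 2 + 2 * (N * L ^ 2) * t ^ 2 := by
  have h1 : ∑ i, η i ^ 2 ≤ N * L ^ 2 := by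
    rw [hN]
    refine (le_abs_self _).trans (abs_sum_le_card_mul fun i => ?_)
    rw [abs_pow]
    exact pow_le_pow_left₀ (abs_nonneg _) (hη i) 2
  calc ∑ i, (x i + t * η i) ^ 2 ≤ ∑ i, (2 * x i ^ 2 + 2 * t ^ 2 * η i ^ 2) :=
        Finset.sum_le_sum fun i _ => by
          linarith [sq_nonneg (x i - t * η i), sub_sq (x i) (t * η i), add_sq (x i) (t * η i),
            mul_pow t (η i) 2]
    _ = 2 * ∑ i, x i ^ 2 + 2 * t ^ 2 * ∑ i, η i ^ 2 := by
        simp only [Finset.mul_sum, Finset.sum_add_distrib]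
    _ ≤ _ := by
        have := mul_le_mul_of_nonneg_left h1 (show 0 ≤ 2 * t ^ 2 by positivity)
        linarith

/-- The divergence of the flux equals the product of the symmetric and the antisymmetric part of
the conjugated operator, up to the commutator form. -/
theorem sum_flux_deriv_eq {w V g T e : ℝ} {u p B dV dg de dT : ι → ℝ} {A U dB dp : ι → ι → ℝ}
    {dA : ι → ι → ι → ℝ} (hA : ∀ i j, A i j = A j i) (hU : ∀ i j, U i j = U j i)
    (hp : ∀ k, p k = ∑ j, A k j * u j)
    (hdp : ∀ k i, dp k i = ∑ j, (dA k i j * u j + A i j * U k j))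
    (he : e = ∑ i, p i * u i) (hde : ∀ k, de k = ∑ i, (dp k i * u i + p i * U k i))
    (hT : T = ∑ l, B l * u l + g * w)
    (hdT : ∀ k, dT k = ∑ l, (dB k l * u l + B l * U k l) + (dg k * w + g * u k)) :
    ∑ k, (-dp k k * T - p k * dT k + 1 / 2 * (dB k k * (e - V * w ^ 2) +
        B k * (de k - (dV k * w ^ 2 + V * (2 * w * u k))))) =
      (-(∑ k, dp k k) - V * w) * T -
      (∑ k, ∑ l, p k * dB k l * u l + w * ∑ k, p k * dg k + g * e -
        1 / 2 * (∑ k, dB k k) * e - 1 / 2 * ∑ l, B l * (∑ i, ∑ j, dA l i j * u i * u j) +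
        w ^ 2 * (1 / 2 * V * (∑ k, dB k k) + 1 / 2 * ∑ k, B k * dV k - V * g)) := by
  have hde' : ∀ k, de k = (∑ i, ∑ j, dA k i j * u i * u j) + 2 * ∑ i, p i * U k i := by
    intro k
    have h1 : ∑ i, (∑ j, A i j * U k j) * u i = ∑ i, p i * U k i := by
      simp only [hp, Finset.sum_mul]
      rw [Finset.sum_comm]
      refine Finset.sum_congr rfl fun j _ => Finset.sum_congr rfl fun i _ => ?_
      rw [hA i j]; ring
    rw [hde, Finset.sum_add_distrib, two_mul, ← add_assoc]
    congr 1
    rw [← h1, ← Finset.sum_add_distrib]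
    refine Finset.sum_congr rfl fun i _ => ?_
    rw [hdp, Finset.sum_add_distrib, add_mul, Finset.sum_mul]
    congr 1
    exact Finset.sum_congr rfl fun j _ => by ring
  -- Symmetry of the Hessian U brings the second order term to the form ∑ B p U. It enters the
  -- divergence with coefficient -1 here and 1/2 · 2 from the energy, so all second derivatives
  -- outside the product of the two parts cancel.
  have hpT : ∑ k, p k * dT k = ∑ k, ∑ l, p k * dB k l * u l + ∑ k, B k * ∑ i, p i * U k i +
      w * ∑ k, p k * dg k + g * e := by
    have h1 : ∑ k, B k * ∑ i, p i * U k i = ∑ k, ∑ l, p k * (B l * U k l) := by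
      simp only [Finset.mul_sum]
      rw [Finset.sum_comm]
      refine Finset.sum_congr rfl fun j _ => Finset.sum_congr rfl fun i _ => ?_
      rw [hU i j]; ring
    rw [h1, he, Finset.mul_sum, Finset.mul_sum, ← Finset.sum_add_distrib,
      ← Finset.sum_add_distrib, ← Finset.sum_add_distrib]
    refine Finset.sum_congr rfl fun k _ => ?_
    rw [hdT, Finset.sum_add_distrib, mul_add, mul_add, Finset.mul_sum, Finset.mul_sum]
    have h2 : ∑ i, p k * (dB k i * u i) = ∑ l, p k * dB k l * u l :=
      Finset.sum_congr rfl fun l _ => by ring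
    rw [h2]; ring
  have hBe : ∑ k, B k * de k = ∑ l, B l * (∑ i, ∑ j, dA l i j * u i * u j) +
      2 * ∑ k, B k * ∑ i, p i * U k i := by
    rw [Finset.mul_sum, ← Finset.sum_add_distrib]
    exact Finset.sum_congr rfl fun k _ => by rw [hde']; ring
  have hexp : ∑ k, (-dp k k * T - p k * dT k + 1 / 2 * (dB k k * (e - V * w ^ 2) +
        B k * (de k - (dV k * w ^ 2 + V * (2 * w * u k))))) =
      -(∑ k, dp k k) * T - ∑ k, p k * dT k + 1 / 2 * ((∑ k, dB k k) * (e - V * w ^ 2)) +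
        1 / 2 * ∑ k, B k * de k - 1 / 2 * (w ^ 2 * ∑ k, B k * dV k) - V * w * ∑ k, B k * u k := by
    simp only [Finset.mul_sum, Finset.sum_mul, ← Finset.sum_neg_distrib, ← Finset.sum_add_distrib,
      ← Finset.sum_sub_distrib]
    exact Finset.sum_congr rfl fun k _ => by ring
  -- Rewriting the first order part through T lets the potential term of the symmetric part multiply
  -- all of T; the correction is the summand -Vg in the coefficient of w².
  have hBu : ∑ l, B l * u l = T - g * w := by rw [hT]; ring
  rw [hexp, hpT, hBe, hBu]
  ring

end Algebra

end Algebraic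

/-! ### Partial derivatives of the weight and of the conjugated quantities. -/

section Calculus

variable {d : ℕ}

/-- The partial derivative of a function on `ℝⁿ`. -/
def pd (k : Fin (d + 1)) (f : E d → ℝ) (y : E d) : ℝ := fderiv ℝ f y (EuclideanSpace.single k 1)

/-- `f` has the `k`-th partial derivative `f'` at `y`. -/
def HasPD (k : Fin (d + 1)) (f : E d → ℝ) (f' : ℝ) (y : E d) : Prop :=
  HasLineDerivAt ℝ f f' y (EuclideanSpace.single k 1)

namespace HasPD

variable {ι : Type*} {k : Fin (d + 1)} {f g : E d → ℝ} {f' g' : ℝ} {y : E d}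

theorem mul (hf : HasPD k f f' y) (hg : HasPD k g g' y) :
    HasPD k (fun z => f z * g z) (f' * g y + f y * g') y := by
  have := HasDerivAt.fun_mul hf hg
  simp only [zero_smul, add_zero] at this
  exact this

theorem add (hf : HasPD k f f' y) (hg : HasPD k g g' y) :
    HasPD k (fun z => f z + g z) (f' + g') y :=
  HasDerivAt.fun_add hf hg

theorem sub (hf : HasPD k f f' y) (hg : HasPD k g g' y) :
    HasPD k (fun z => f z - g z) (f' - g') y :=
  HasDerivAt.fun_sub hf hg

theorem neg (hf : HasPD k f f' y) : HasPD k (fun z => -f z) (-f') y :=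
  HasDerivAt.fun_neg hf

theorem sum [Fintype ι] {f : ι → E d → ℝ} {f' : ι → ℝ} (hf : ∀ i, HasPD k (f i) (f' i) y) :
    HasPD k (fun z => ∑ i, f i z) (∑ i, f' i) y :=
  HasDerivAt.fun_sum fun i _ => hf i

theorem const_mul (c : ℝ) (hf : HasPD k f f' y) : HasPD k (fun z => c * f z) (c * f') y :=
  HasDerivAt.const_mul c hf

theorem exp (hf : HasPD k f f' y) :
    HasPD k (fun z => Real.exp (f z)) (Real.exp (f y) * f') y := by
  have := HasDerivAt.exp hf
  simp only [zero_smul, add_zero] at this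
  exact this

theorem congr_deriv (hf : HasPD k f f' y) (h : f' = g') : HasPD k f g' y := h ▸ hf

theorem of_differentiableAt (hf : DifferentiableAt ℝ f y) (k : Fin (d + 1)) :
    HasPD k f (pd k f y) y :=
  hf.hasFDerivAt.hasLineDerivAt _

/-- Derivative formulas are computed along lines by the one-variable rules; differentiability, known
separately, turns them into values of `pd`. -/
theorem pd_eq (h : HasPD k f f' y) (hf : DifferentiableAt ℝ f y) : pd k f y = f' :=
  HasLineDerivAt.unique (of_differentiableAt hf k) h

end HasPD

/-- The (constant) diagonal entries of the Hessian of `h`. -/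
def hessDiag (i : Fin (d + 1)) : ℝ := if i = Fin.last d then 1 else -1 / 2

/-- The partial derivatives of `h`. -/
def gradH (i : Fin (d + 1)) (y : E d) : ℝ :=
  hessDiag i * y i - if i = Fin.last d then 1 else 0

/-- The Hessian of `h`. -/
def hessH (i k : Fin (d + 1)) : ℝ := if i = k then hessDiag i else 0

theorem hessH_comm (i k : Fin (d + 1)) : hessH i k = hessH k i := by
  unfold hessH
  by_cases hik : i = k
  · subst hik; rfl
  · rw [if_neg hik, if_neg (Ne.symm hik)]

/-- A uniform diagonal form, so that no later differentiation has to single out the last coordinate.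
-/
theorem h_eq_sum (y : E d) :
    h y = ∑ i, (hessDiag i / 2 * (y i * y i) - (if i = Fin.last d then 1 else 0) * y i) := by
  rw [Fin.sum_univ_castSucc]
  have : ∀ i : Fin d, Fin.castSucc i ≠ Fin.last d := fun i => (Fin.castSucc_lt_last i).ne
  simp only [hessDiag, this, if_false, if_true, h]
  rw [neg_div, Finset.sum_div, ← Finset.sum_neg_distrib]
  have h1 : ∀ i : Fin d, -(y (Fin.castSucc i) ^ 2 / 4) =
      -1 / 2 / 2 * (y (Fin.castSucc i) * y (Fin.castSucc i)) - 0 * y (Fin.castSucc i) :=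
    fun i => by ring
  simp only [h1]
  ring

theorem hasPD_coord (i k : Fin (d + 1)) (y : E d) :
    HasPD k (fun z : E d => z i) (if i = k then 1 else 0) y := by
  have := (EuclideanSpace.proj (𝕜 := ℝ) i : E d →L[ℝ] ℝ).hasFDerivAt (x := y)
  have : HasPD k (fun z : E d => z i) _ y := this.hasLineDerivAt (EuclideanSpace.single k (1 : ℝ))
  exact this.congr_deriv (by simp)

theorem hasPD_const (c : ℝ) (k : Fin (d + 1)) (y : E d) : HasPD k (fun _ => c) 0 y :=
  hasDerivAt_const (0 : ℝ) c

theorem hasPD_gradH (i k : Fin (d + 1)) (y : E d) : HasPD k (gradH i) (hessH i k) y := by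
  have : HasPD k (gradH i) _ y := ((hasPD_coord i k y).const_mul (hessDiag i)).sub
    (hasPD_const (if i = Fin.last d then (1 : ℝ) else 0) k y)
  exact this.congr_deriv (by simp [hessH])

theorem hasPD_h (k : Fin (d + 1)) (y : E d) : HasPD k h (gradH k y) y := by
  have h1 : (h : E d → ℝ) = fun y => _ := funext h_eq_sum
  rw [h1]
  have := HasPD.sum fun i : Fin (d + 1) =>
    ((((hasPD_coord i k y).mul (hasPD_coord i k y)).const_mul
      (hessDiag i / 2)).sub ((hasPD_coord i k y).const_mul
        (if i = Fin.last d then (1 : ℝ) else 0)))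
  convert this using 1
  rw [Finset.sum_eq_single k]
  · simp [gradH]; ring
  · intro i _ hi
    simp [hi]
  · simp

theorem contDiff_h : ContDiff ℝ ∞ (h : E d → ℝ) := by
  unfold h; fun_prop

theorem contDiff_gradH (i : Fin (d + 1)) : ContDiff ℝ ∞ (gradH i : E d → ℝ) := by
  unfold gradH; fun_prop

theorem contDiff_psi (s : ℝ) : ContDiff ℝ ∞ (psi s : E d → ℝ) :=
  (contDiff_const.mul contDiff_h).exp

/-- The large parameter `σ = τ s ψ`. -/
def sig (τ s : ℝ) (y : E d) : ℝ := τ * s * psi s y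

/-- The exponential weight `e^{τψ}`. -/
def wt (τ s : ℝ) (y : E d) : ℝ := Real.exp (τ * psi s y)

theorem contDiff_sig (τ s : ℝ) : ContDiff ℝ ∞ (sig τ s : E d → ℝ) :=
  contDiff_const.mul (contDiff_psi s)

theorem contDiff_wt (τ s : ℝ) : ContDiff ℝ ∞ (wt τ s : E d → ℝ) :=
  (contDiff_const.mul (contDiff_psi s)).exp

theorem wt_pos (τ s : ℝ) (y : E d) : 0 < wt τ s y := Real.exp_pos _

theorem hasPD_psi (s : ℝ) (k : Fin (d + 1)) (y : E d) :
    HasPD k (psi s) (psi s y * (s * gradH k y)) y :=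
  ((hasPD_h k y).const_mul s).exp

theorem hasPD_sig (τ s : ℝ) (k : Fin (d + 1)) (y : E d) :
    HasPD k (sig τ s) (sig τ s y * (s * gradH k y)) y := by
  have : HasPD k (sig τ s) _ y := (hasPD_psi s k y).const_mul (τ * s)
  exact this.congr_deriv (by unfold sig; ring)

theorem hasPD_wt (τ s : ℝ) (k : Fin (d + 1)) (y : E d) :
    HasPD k (wt τ s) (wt τ s y * (sig τ s y * gradH k y)) y := by
  have : HasPD k (wt τ s) _ y := ((hasPD_psi s k y).const_mul τ).exp
  exact this.congr_deriv (by unfold wt sig; ring)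

section Conjugated

variable (τ s : ℝ) (a : Fin (d + 1) → Fin (d + 1) → E d → ℝ) (b : Fin (d + 1) → E d → ℝ)
  (c v : E d → ℝ)

/-- The conjugated function `w = e^{τψ} v`. -/
def conj (y : E d) : ℝ := wt τ s y * v y

/-- The gradient of the conjugated function. -/
def conjGrad (i : Fin (d + 1)) (y : E d) : ℝ :=
  wt τ s y * (pd i v y + sig τ s y * gradH i y * v y)

/-- The Hessian of the conjugated function. -/
def conjHess (k i : Fin (d + 1)) (y : E d) : ℝ :=
  wt τ s y * (pd k (pd i v) y + sig τ s y * (gradH k y * pd i v y + gradH i y * pd k v y) +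
    sig τ s y ^ 2 * gradH k y * gradH i y * v y +
    sig τ s y * (s * gradH k y * gradH i y + hessH i k) * v y)

/-- The vector field `a ∇h`. -/
def coGrad (l : Fin (d + 1)) (y : E d) : ℝ := ∑ m, a l m y * gradH m y

/-- The derivatives of `a ∇h`. -/
def coGradDeriv (k l : Fin (d + 1)) (y : E d) : ℝ :=
  ∑ m, (pd k (a l m) y * gradH m y + a l m y * hessH m k)

/-- The quadratic form `a ∇h · ∇h`. -/
def symb (y : E d) : ℝ := ∑ l, coGrad a l y * gradH l y

/-- The derivatives of `a ∇h · ∇h`. -/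
def symbDeriv (k : Fin (d + 1)) (y : E d) : ℝ :=
  ∑ l, (coGradDeriv a k l y * gradH l y + coGrad a l y * hessH l k)

/-- The vector field `2 τ a ∇ψ + b`. -/
def drift (l : Fin (d + 1)) (y : E d) : ℝ := 2 * sig τ s y * coGrad a l y + b l y

/-- The contribution of the lower order terms to the potential of the conjugated operator. -/
def lowPot (y : E d) : ℝ := -c y + sig τ s y * ∑ l, b l y * gradH l y

/-- The derivatives of the lower order potential. -/
def lowPotDeriv (k : Fin (d + 1)) (y : E d) : ℝ :=
  -pd k c y + sig τ s y * (s * gradH k y * ∑ l, b l y * gradH l y +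
    ∑ l, (pd k (b l) y * gradH l y + b l y * hessH l k))

/-- The vector field `a ∇w`. -/
def coConjGrad (k : Fin (d + 1)) (y : E d) : ℝ := ∑ j, a k j y * conjGrad τ s v j y

/-- The antisymmetric part of the conjugated operator, up to lower order terms. -/
def antiPart (y : E d) : ℝ :=
  ∑ l, drift τ s a b l y * conjGrad τ s v l y + 2 * sig τ s y * s * symb a y * conj τ s v y

/-- The quadratic form `a ∇w · ∇w`. -/
def energy (y : E d) : ℝ := ∑ i, coConjGrad τ s a v i y * conjGrad τ s v i y

/-- The flux of the product of the symmetric and the antisymmetric part. -/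
def flux (k : Fin (d + 1)) (y : E d) : ℝ :=
  -coConjGrad τ s a v k y * antiPart τ s a b v y +
    1 / 2 * (drift τ s a b k y * (energy τ s a v y -
      (sig τ s y ^ 2 * symb a y + lowPot τ s b c y) * conj τ s v y ^ 2))

variable {τ s a b c v} {y : E d} {U : Set (E d)}

theorem conjHess_comm (hv : ∀ i k, pd k (pd i v) y = pd i (pd k v) y) (i k : Fin (d + 1)) :
    conjHess τ s v k i y = conjHess τ s v i k y := by
  unfold conjHess
  rw [hv i k, hessH_comm i k]
  ring

theorem contDiffOn_pd {n m : ℕ∞} (hU : IsOpen U) {f : E d → ℝ} (hf : ContDiffOn ℝ n f U)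
    (hmn : m + 1 ≤ n) (k : Fin (d + 1)) : ContDiffOn ℝ m (pd k f) U :=
  (hf.fderiv_of_isOpen hU (by exact_mod_cast hmn)).clm_apply contDiffOn_const

/-- The flux contains v only up to first order, so C² regularity of v suffices. It contains b and c
undifferentiated, so they must be C¹ here; this is why rough coefficients are mollified. -/
theorem contDiffOn_flux (hU : IsOpen U) (ha : ∀ i j, ContDiffOn ℝ 1 (a i j) U)
    (hb : ∀ i, ContDiffOn ℝ 1 (b i) U) (hc : ContDiffOn ℝ 1 c U) (hv : ContDiffOn ℝ 2 v U)
    (k : Fin (d + 1)) : ContDiffOn ℝ 1 (flux τ s a b c v k) U := by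
  have hσ : ContDiffOn ℝ 1 (sig τ s : E d → ℝ) U :=
    ((contDiff_sig τ s).of_le (by exact_mod_cast le_top)).contDiffOn
  have hwt : ContDiffOn ℝ 1 (wt τ s : E d → ℝ) U :=
    ((contDiff_wt τ s).of_le (by exact_mod_cast le_top)).contDiffOn
  have hη : ∀ i, ContDiffOn ℝ 1 (gradH i : E d → ℝ) U := fun i =>
    ((contDiff_gradH i).of_le (by exact_mod_cast le_top)).contDiffOn
  have hv1 : ContDiffOn ℝ 1 v U := hv.of_le (by norm_num)
  have hdv : ∀ i, ContDiffOn ℝ 1 (pd i v) U := fun i =>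
    contDiffOn_pd (n := 2) (m := 1) hU hv (by norm_num) i
  have hw : ContDiffOn ℝ 1 (conj τ s v) U := hwt.mul hv1
  have hu : ∀ i, ContDiffOn ℝ 1 (conjGrad τ s v i) U := fun i =>
    hwt.mul ((hdv i).add ((hσ.mul (hη i)).mul hv1))
  have hq : ∀ l, ContDiffOn ℝ 1 (coGrad a l) U := fun l =>
    ContDiffOn.sum fun m _ => (ha l m).mul (hη m)
  have hQ : ContDiffOn ℝ 1 (symb a) U := ContDiffOn.sum fun l _ => (hq l).mul (hη l)
  have hB : ∀ l, ContDiffOn ℝ 1 (drift τ s a b l) U := fun l =>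
    ((contDiffOn_const.mul hσ).mul (hq l)).add (hb l)
  have hV : ContDiffOn ℝ 1 (lowPot τ s b c) U :=
    hc.neg.add (hσ.mul (ContDiffOn.sum fun l _ => (hb l).mul (hη l)))
  have hp : ∀ i, ContDiffOn ℝ 1 (coConjGrad τ s a v i) U := fun i =>
    ContDiffOn.sum fun j _ => (ha i j).mul (hu j)
  have hT : ContDiffOn ℝ 1 (antiPart τ s a b v) U :=
    (ContDiffOn.sum fun l _ => (hB l).mul (hu l)).add
      ((((contDiffOn_const.mul hσ).mul contDiffOn_const).mul hQ).mul hw)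
  have he : ContDiffOn ℝ 1 (energy τ s a v) U := ContDiffOn.sum fun i _ => (hp i).mul (hu i)
  exact ((hp k).neg.mul hT).add (contDiffOn_const.mul ((hB k).mul (he.sub
    ((((hσ.pow 2).mul hQ).add hV).mul (hw.pow 2)))))

/-- The derivative is arranged as a summand of the left side of `sum_flux_deriv_eq`, so that the two
combine without further rewriting. -/
theorem hasPD_flux (ha : ∀ i j, DifferentiableAt ℝ (a i j) y)
    (hb : ∀ i, DifferentiableAt ℝ (b i) y) (hc : DifferentiableAt ℝ c y)
    (hv : DifferentiableAt ℝ v y) (hdv : ∀ i, DifferentiableAt ℝ (pd i v) y)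
    (k : Fin (d + 1)) :
    let u := fun i => conjGrad τ s v i y
    let W := fun k i => conjHess τ s v k i y
    let p := fun i => coConjGrad τ s a v i y
    let dp := fun k i => ∑ j, (pd k (a i j) y * u j + a i j y * W k j)
    let dB := fun k l => 2 * sig τ s y * (s * gradH k y * coGrad a l y + coGradDeriv a k l y) +
      pd k (b l) y
    let dg := fun k => 2 * sig τ s y * s * (s * gradH k y * symb a y + symbDeriv a k y)
    let dV := fun k => sig τ s y ^ 2 * (2 * s * gradH k y * symb a y + symbDeriv a k y) +
      lowPotDeriv τ s b c k y
    HasPD k (flux τ s a b c v k)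
      (-dp k k * antiPart τ s a b v y -
        p k * (∑ l, (dB k l * u l + drift τ s a b l y * W k l) +
          (dg k * conj τ s v y + 2 * sig τ s y * s * symb a y * u k)) +
        1 / 2 * (dB k k * (energy τ s a v y -
            (sig τ s y ^ 2 * symb a y + lowPot τ s b c y) * conj τ s v y ^ 2) +
          drift τ s a b k y * (∑ i, (dp k i * u i + p i * W k i) -
            (dV k * conj τ s v y ^ 2 + (sig τ s y ^ 2 * symb a y + lowPot τ s b c y) *
              (2 * conj τ s v y * u k))))) y := by
  intro u W p dp dB dg dV
  have hσ := hasPD_sig τ s k y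
  have hη := fun i => hasPD_gradH i k y
  have hv' := HasPD.of_differentiableAt hv k
  have hw : HasPD k (conj τ s v) (u k) y :=
    ((hasPD_wt τ s k y).mul hv').congr_deriv (by simp only [u, conjGrad]; ring)
  have hu : ∀ i, HasPD k (conjGrad τ s v i) (W k i) y := fun i =>
    ((hasPD_wt τ s k y).mul ((HasPD.of_differentiableAt (hdv i) k).add
      ((hσ.mul (hη i)).mul hv'))).congr_deriv (by simp only [W, conjHess]; ring)
  have hq : ∀ l, HasPD k (coGrad a l) (coGradDeriv a k l y) y := fun l =>
    HasPD.sum fun m => (HasPD.of_differentiableAt (ha l m) k).mul (hη m)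
  have hQ : HasPD k (symb a) (symbDeriv a k y) y := HasPD.sum fun l => (hq l).mul (hη l)
  have hB : ∀ l, HasPD k (drift τ s a b l) (dB k l) y := fun l =>
    (((hσ.const_mul 2).mul (hq l)).add (HasPD.of_differentiableAt (hb l) k)).congr_deriv
      (by simp only [dB]; ring)
  have hV₁ : HasPD k (lowPot τ s b c) (lowPotDeriv τ s b c k y) y :=
    ((HasPD.of_differentiableAt hc k).neg.add (hσ.mul (HasPD.sum fun l =>
      (HasPD.of_differentiableAt (hb l) k).mul (hη l)))).congr_deriv
      (by simp only [lowPotDeriv]; ring)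
  -- Squares are written as products so that the product rule alone suffices.
  have hV : HasPD k (fun z => sig τ s z * sig τ s z * symb a z + lowPot τ s b c z) (dV k) y :=
    (((hσ.mul hσ).mul hQ).add hV₁).congr_deriv (by simp only [dV]; ring)
  have hp : ∀ i, HasPD k (coConjGrad τ s a v i) (dp k i) y := fun i =>
    HasPD.sum fun j => (HasPD.of_differentiableAt (ha i j) k).mul (hu j)
  have hg : HasPD k (fun z => 2 * s * (sig τ s z * symb a z)) (dg k) y :=
    ((hσ.mul hQ).const_mul (2 * s)).congr_deriv (by simp only [dg]; ring)
  have hT : HasPD k (fun z => ∑ l, drift τ s a b l z * conjGrad τ s v l z +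
      2 * s * (sig τ s z * symb a z) * conj τ s v z) _ y :=
    (HasPD.sum fun l => (hB l).mul (hu l)).add (hg.mul hw)
  have hT' : (fun z => ∑ l, drift τ s a b l z * conjGrad τ s v l z +
      2 * s * (sig τ s z * symb a z) * conj τ s v z) = antiPart τ s a b v := by
    funext z; unfold antiPart; ring
  rw [hT'] at hT
  have he : HasPD k (energy τ s a v) _ y := HasPD.sum fun i => (hp i).mul (hu i)
  have hF := ((hp k).neg.mul hT).add
    (((hB k).mul (he.sub (hV.mul (hw.mul hw)))).const_mul (1 / 2))
  have hF' : (fun z => -coConjGrad τ s a v k z * antiPart τ s a b v z +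
      1 / 2 * (drift τ s a b k z * (energy τ s a v z -
        (sig τ s z * sig τ s z * symb a z + lowPot τ s b c z) *
          (conj τ s v z * conj τ s v z)))) = flux τ s a b c v k := by
    funext z; unfold flux; ring
  rw [hF'] at hF
  refine hF.congr_deriv ?_
  simp only [p, u]
  ring

end Conjugated

end Calculus

/-! ### The pointwise Carleman inequality on the half ball. -/

section PointwiseEstimate

variable {d : ℕ}

theorem abs_coord_le_norm (y : E d) (i : Fin (d + 1)) : |y i| ≤ ‖y‖ := by
  simpa using EuclideanSpace.norm_eq y ▸ PiLp.norm_apply_le y i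

theorem abs_gradH_le {y : E d} (hy : y ∈ halfBall d) (i : Fin (d + 1)) : |gradH i y| ≤ 1 := by
  have h1 := abs_le.1 ((abs_coord_le_norm y i).trans hy.1.le)
  unfold gradH hessDiag
  by_cases hi : i = Fin.last d
  · subst hi
    have := hy.2
    simp only [if_true, abs_le]
    constructor <;> linarith
  · simp only [hi, if_false, abs_le]
    constructor <;> linarith

/-- The last component yₙ - 1 stays below -1/2, so h has no critical point there; with ellipticity
this gives the lower bound θ/4 for `symb`. -/
theorem quarter_le_sum_gradH_sq {y : E d} (hy : y ∈ halfBall d) :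
    1 / 4 ≤ ∑ i, gradH i y ^ 2 := by
  have h1 := abs_le.1 ((abs_coord_le_norm y (Fin.last d)).trans hy.1.le)
  have h2 : gradH (Fin.last d) y ^ 2 ≤ ∑ i, gradH i y ^ 2 :=
    Finset.single_le_sum (f := fun i => gradH i y ^ 2) (fun i _ => sq_nonneg _)
      (Finset.mem_univ (Fin.last d))
  have h3 : gradH (Fin.last d) y = y (Fin.last d) - 1 := by simp [gradH, hessDiag]
  rw [h3] at h2
  nlinarith

theorem abs_hessH_le (i k : Fin (d + 1)) : |hessH i k| ≤ 1 := by
  unfold hessH hessDiag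
  split_ifs <;> norm_num [abs_le]

section Pointwise

variable {τ s : ℝ} {a : Fin (d + 1) → Fin (d + 1) → E d → ℝ} {b : Fin (d + 1) → E d → ℝ}
  {c v : E d → ℝ} {y : E d}

/-- The conjugated operator is the sum of its symmetric part, its antisymmetric part and a
remainder of lower order. -/
theorem conjugated_operator_eq (hsym : ∀ i j, a i j y = a j i y) :
    wt τ s y * (-(∑ i, ∑ j, a i j y * pd i (pd j v) y) + ∑ i, b i y * pd i v y + c y * v y) =
      (-(∑ k, ∑ j, (pd k (a k j) y * conjGrad τ s v j y + a k j y * conjHess τ s v k j y)) -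
          (sig τ s y ^ 2 * symb a y + lowPot τ s b c y) * conj τ s v y) +
        antiPart τ s a b v y +
        (-(2 * sig τ s y * s * symb a y * conj τ s v y) +
          ∑ i, ∑ j, pd i (a i j) y * conjGrad τ s v j y +
          (∑ i, ∑ j, a i j y * (sig τ s y * (s * gradH i y * gradH j y + hessH i j))) *
            conj τ s v y) := by
  -- The two cross terms of the conjugated Hessian give the same first order term; only the second
  -- needs the symmetry of a.
  have hq : ∑ i, ∑ j, a i j y * (gradH j y * pd i v y) = ∑ l, coGrad a l y * pd l v y := by
    simp only [coGrad, Finset.sum_mul]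
    exact Finset.sum_congr rfl fun i _ => Finset.sum_congr rfl fun j _ => by ring
  have hq' : ∑ i, ∑ j, a i j y * (gradH i y * pd j v y) = ∑ l, coGrad a l y * pd l v y := by
    rw [← hq, Finset.sum_comm]
    exact Finset.sum_congr rfl fun i _ => Finset.sum_congr rfl fun j _ => by rw [hsym j i]
  have hQ : ∑ i, ∑ j, a i j y * (gradH i y * gradH j y) = symb a y := by
    simp only [symb, coGrad, Finset.sum_mul]
    exact Finset.sum_congr rfl fun i _ => Finset.sum_congr rfl fun j _ => by ring
  have hW : ∑ k, ∑ j, (pd k (a k j) y * conjGrad τ s v j y + a k j y * conjHess τ s v k j y) =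
      ∑ i, ∑ j, pd i (a i j) y * conjGrad τ s v j y +
        wt τ s y * (∑ i, ∑ j, a i j y * pd i (pd j v) y +
          2 * sig τ s y * ∑ l, coGrad a l y * pd l v y + sig τ s y ^ 2 * symb a y * v y) +
        (∑ i, ∑ j, a i j y * (sig τ s y * (s * gradH i y * gradH j y + hessH i j))) *
            conj τ s v y := by
    rw [two_mul, add_mul]
    nth_rewrite 1 [← hq]
    rw [← hq', ← hQ]
    simp only [Finset.mul_sum, Finset.sum_mul, ← Finset.sum_add_distrib]
    refine Finset.sum_congr rfl fun i _ => Finset.sum_congr rfl fun j _ => ?_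
    unfold conjHess conj
    rw [hessH_comm j i]
    ring
  have hT : antiPart τ s a b v y = wt τ s y * (2 * sig τ s y * ∑ l, coGrad a l y * pd l v y +
      2 * sig τ s y ^ 2 * symb a y * v y + ∑ i, b i y * pd i v y +
      sig τ s y * v y * ∑ l, b l y * gradH l y) +
      2 * sig τ s y * s * symb a y * conj τ s v y := by
    unfold antiPart
    congr 1
    have h1 : 2 * sig τ s y ^ 2 * symb a y * v y =
        ∑ l, 2 * sig τ s y ^ 2 * v y * (coGrad a l y * gradH l y) := by
      rw [← Finset.mul_sum, symb]; ring
    rw [h1]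
    simp only [Finset.mul_sum, ← Finset.sum_add_distrib]
    refine Finset.sum_congr rfl fun i _ => ?_
    unfold drift conjGrad
    ring
  rw [hW, hT]
  unfold lowPot conj
  ring

/-- The weighted density `σ |e^{τψ} ∇v|² + σ³ |e^{τψ} v|²`. -/
def density (τ s : ℝ) (v : E d → ℝ) (y : E d) : ℝ :=
  sig τ s y * ∑ i, (wt τ s y * pd i v y) ^ 2 + sig τ s y ^ 3 * (wt τ s y * v y) ^ 2

/-- A common bound of the coefficients and of the derived quantities. -/
def coeffBound (d : ℕ) (M : ℝ) : ℝ := 3 * ((d + 1 : ℕ) : ℝ) ^ 2 * (M + 1)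

set_option maxHeartbeats 1000000 in
/-- The pointwise Carleman inequality. -/
theorem carleman_pointwise {θ M ν ε : ℝ} (hθ : 0 ≤ θ) (hM : 0 ≤ M) (hs : 0 ≤ s) (hε1 : ε ≤ 1)
    (hy : y ∈ halfBall d) (hσε : 1 ≤ sig τ s y * ε) (hσ0 : 0 ≤ sig τ s y)
    (hν : ν ≤ θ / 4 * θ) (hν' : ν ≤ θ / 4 * (θ / 4))
    (hs₀ : 2 * coeffError ((d + 1 : ℕ) : ℝ) (coeffBound d M) ≤ s * ν)
    (hε₀ : (2 * smallError ((d + 1 : ℕ) : ℝ) (coeffBound d M) s +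
      2 * remainderConst ((d + 1 : ℕ) : ℝ) (coeffBound d M) s ^ 2) * ε ≤ s * ν / 2)
    (hsym : ∀ i j, a i j y = a j i y)
    (ha : ∀ i j, DifferentiableAt ℝ (a i j) y)
    (hb : ∀ i, DifferentiableAt ℝ (b i) y) (hc : DifferentiableAt ℝ c y)
    (hv : DifferentiableAt ℝ v y) (hdv : ∀ i, DifferentiableAt ℝ (pd i v) y)
    (hvsym : ∀ i k, pd k (pd i v) y = pd i (pd k v) y)
    (hA : ∀ i j, |a i j y| ≤ M) (hdA : ∀ k i j, |pd k (a i j) y| ≤ M)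
    (hell : ∀ ξ : E d, θ * ‖ξ‖ ^ 2 ≤ ∑ i, ∑ j, a i j y * ξ i * ξ j)
    (hbε : ∀ i, (1 + (s + 2) * ((d + 1 : ℕ) : ℝ)) * |b i y| ≤ ε * sig τ s y)
    (hdbε : ∀ k i, (1 + (s + 2) * ((d + 1 : ℕ) : ℝ)) * |pd k (b i) y| ≤ ε * sig τ s y)
    (hcε : (1 + (s + 2) * ((d + 1 : ℕ) : ℝ)) * |c y| ≤ ε * sig τ s y ^ 2)
    (hdcε : ∀ k, (1 + (s + 2) * ((d + 1 : ℕ) : ℝ)) * |pd k c y| ≤ ε * sig τ s y ^ 2)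
    (hF : ∀ k, DifferentiableAt ℝ (flux τ s a b c v k) y) :
    s * ν / 2 / (2 * ((d + 1 : ℕ) : ℝ) + 2) * density τ s v y +
        2 * ∑ k, pd k (flux τ s a b c v k) y ≤
      (wt τ s y * (-(∑ i, ∑ j, a i j y * pd i (pd j v) y) + ∑ i, b i y * pd i v y +
        c y * v y)) ^ 2 ∧
    ∀ k, |flux τ s a b c v k y| ≤
      fluxConst ((d + 1 : ℕ) : ℝ) (coeffBound d M) s * (2 * ((d + 1 : ℕ) : ℝ) + 2) *
        density τ s v y := by
  set N : ℝ := ((d + 1 : ℕ) : ℝ) with hNdef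
  have hN : N = Fintype.card (Fin (d + 1)) := by simp [hNdef]
  have hN1 : 1 ≤ N := by rw [hNdef]; exact_mod_cast Nat.le_add_left 1 d
  have hN0 : 0 ≤ N := zero_le_one.trans hN1
  set L := coeffBound d M with hLdef
  have hL : L = 3 * N ^ 2 * (M + 1) := rfl
  have hNN : N ≤ N ^ 2 := le_self_pow₀ hN1 (by norm_num)
  have hNM : N * M ≤ N ^ 2 * M := mul_le_mul_of_nonneg_right hNN hM
  have hMNM : M ≤ N * M := le_mul_of_one_le_left hM hN1
  have hNM0 : 0 ≤ N ^ 2 * M := by positivity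
  have hL0 : 0 ≤ L := by rw [hL]; positivity
  have hML : M ≤ L := by rw [hL]; linarith
  have h1L : 1 ≤ L := by rw [hL]; linarith
  have hNML : N * M ≤ L := by rw [hL]; linarith
  have hη := abs_gradH_le hy
  have hηL : ∀ i, |gradH i y| ≤ L := fun i => (hη i).trans h1L
  have hH := abs_hessH_le (d := d)
  set σ := sig τ s y with hσdef
  have hε0 : 0 ≤ ε := by
    by_contra hneg
    nlinarith
  have hσ1 : 1 ≤ σ := hσε.trans (by nlinarith)
  set u : Fin (d + 1) → ℝ := fun i => conjGrad τ s v i y with hu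
  set w := conj τ s v y with hw
  set W := √(∑ i, u i ^ 2) with hWdef
  have hW2 : W ^ 2 = ∑ i, u i ^ 2 := Real.sq_sqrt (Finset.sum_nonneg fun i _ => sq_nonneg _)
  have hW0 : 0 ≤ W := Real.sqrt_nonneg _
  have huW : ∀ i, |u i| ≤ W := fun i => by
    refine Real.abs_le_sqrt ?_
    exact Finset.single_le_sum (f := fun i => u i ^ 2) (fun i _ => sq_nonneg _) (Finset.mem_univ i)
  have hq : ∀ l, |coGrad a l y| ≤ N * M := fun l => by
    have := abs_sum_le_card_mul fun m => abs_mul_le_mul_of_abs_le (hA l m) (hη m)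
    rw [← hN, mul_one] at this
    exact this
  have hdq : ∀ k l, |coGradDeriv a k l y| ≤ N * (M + M) := fun k l => by
    have := abs_sum_le_card_mul fun m => (abs_add_le _ _).trans (add_le_add
      (abs_mul_le_mul_of_abs_le (hdA k l m) (hη m)) (abs_mul_le_mul_of_abs_le (hA l m) (hH m k)))
    rw [← hN, mul_one] at this
    exact this
  have hQ : |symb a y| ≤ N * (N * M) := by
    have := abs_sum_le_card_mul fun l => abs_mul_le_mul_of_abs_le (hq l) (hη l)
    rw [← hN, mul_one] at this
    exact this
  have hdQ : ∀ k, |symbDeriv a k y| ≤ N * (N * (M + M) + N * M) := fun k => by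
    have := abs_sum_le_card_mul fun l => (abs_add_le _ _).trans (add_le_add
      (abs_mul_le_mul_of_abs_le (hdq k l) (hη l)) (abs_mul_le_mul_of_abs_le (hq l) (hH l k)))
    rw [← hN, mul_one, mul_one] at this
    exact this
  have hp : ∀ k, |coConjGrad τ s a v k y| ≤ N * (M * W) := fun k => by
    rw [hN]; exact abs_sum_le_card_mul fun j => abs_mul_le_mul_of_abs_le (hA k j) (huW j)
  have he : |energy τ s a v y| ≤ N * (N * (M * W) * W) := by
    have := abs_sum_le_card_mul fun j => abs_mul_le_mul_of_abs_le (hp j) (huW j)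
    rw [← hN] at this
    exact this
  have hz : ∀ l, |∑ i, ∑ j, pd l (a i j) y * u i * u j| ≤ N * (N * (M * W * W)) := fun l => by
    rw [hN]
    exact abs_sum_le_card_mul fun i => abs_sum_le_card_mul fun j =>
      abs_mul_le_mul_of_abs_le (abs_mul_le_mul_of_abs_le (hdA l i j) (huW i)) (huW j)
  have hellip : ∀ x : Fin (d + 1) → ℝ, θ * ∑ i, x i ^ 2 ≤ ∑ i, (∑ j, a i j y * x j) * x i := by
    intro x
    have := hell (WithLp.toLp 2 x)
    rw [EuclideanSpace.real_norm_sq_eq] at this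
    refine this.trans_eq (Finset.sum_congr rfl fun i _ => ?_)
    rw [Finset.sum_mul]
    exact Finset.sum_congr rfl fun j _ => by simp only; ring
  have heθ : θ * W ^ 2 ≤ energy τ s a v y := by rw [hW2]; exact hellip u
  have hQθ : θ / 4 ≤ symb a y := by
    have h1 : θ * ∑ i, gradH i y ^ 2 ≤ symb a y := hellip fun i => gradH i y
    have h2 := mul_le_mul_of_nonneg_left (quarter_le_sum_gradH_sq hy) hθ
    linarith
  have hpq : ∑ k, coConjGrad τ s a v k y * gradH k y = ∑ l, coGrad a l y * u l := by
    simp only [coConjGrad, coGrad, Finset.sum_mul]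
    rw [Finset.sum_comm]
    refine Finset.sum_congr rfl fun j _ => Finset.sum_congr rfl fun i _ => ?_
    rw [hsym i j]; simp only [hu]; ring
  have hD : 0 < 1 + (s + 2) * N := by positivity
  have hD1 : 1 ≤ 1 + (s + 2) * N := by linarith [show 0 ≤ (s + 2) * N by positivity]
  have hle : ∀ x : ℝ, |x| ≤ (1 + (s + 2) * N) * |x| := fun x =>
    le_mul_of_one_le_left (abs_nonneg x) hD1
  have hb1 : ∀ i, |b i y| ≤ ε * σ := fun i => (hle _).trans (hbε i)
  have hdb1 : ∀ k i, |pd k (b i) y| ≤ ε * σ := fun k i => (hle _).trans (hdbε k i)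
  -- The divisor is dictated by the gradient of the lower order potential: 1 for the derivative of
  -- c, sN from differentiating σ, and 2N from the derivatives of b and of ∇h.
  set ε₁ := ε / (1 + (s + 2) * N) with hε₁
  have hε₁e : (1 + (s + 2) * N) * ε₁ = ε := by rw [hε₁]; field_simp
  have hε₁0 : 0 ≤ ε₁ := by positivity
  have hdiv : ∀ x t : ℝ, (1 + (s + 2) * N) * |x| ≤ ε * t → |x| ≤ ε₁ * t := fun x t hxt => by
    refine le_of_mul_le_mul_left ?_ hD
    rwa [← mul_assoc, hε₁e]
  have hb2 : ∀ i, |b i y| ≤ ε₁ * σ := fun i => hdiv _ _ (hbε i)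
  have hdb2 : ∀ k i, |pd k (b i) y| ≤ ε₁ * σ := fun k i => hdiv _ _ (hdbε k i)
  have hc2 := hdiv _ _ hcε
  have hdc2 := fun k => hdiv _ _ (hdcε k)
  have hbη : |∑ l, b l y * gradH l y| ≤ N * (ε₁ * σ * 1) := by
    rw [hN]; exact abs_sum_le_card_mul fun l => abs_mul_le_mul_of_abs_le (hb2 l) (hη l)
  have hV : |lowPot τ s b c y| ≤ ε * σ ^ 2 := by
    have h1 := abs_mul_le_mul_of_abs_le (abs_of_nonneg hσ0).le hbη
    have h2 : |lowPot τ s b c y| ≤ ε₁ * σ ^ 2 + σ * (N * (ε₁ * σ * 1)) := by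
      refine (abs_add_le _ _).trans (add_le_add ?_ h1)
      rwa [abs_neg]
    refine h2.trans ?_
    rw [← hε₁e]
    have : 0 ≤ (s + 1) * N * (ε₁ * σ ^ 2) := by positivity
    linarith
  have hdV : ∀ k, |lowPotDeriv τ s b c k y| ≤ ε * σ ^ 2 := fun k => by
    have h1 := abs_mul_le_mul_of_abs_le
      (abs_mul_le_mul_of_abs_le (abs_of_nonneg hs).le (hη k)) hbη
    have h2 := abs_sum_le_card_mul fun l => (abs_add_le _ _).trans (add_le_add
      (abs_mul_le_mul_of_abs_le (hdb2 k l) (hη l)) (abs_mul_le_mul_of_abs_le (hb2 l) (hH l k)))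
    rw [← hN] at h2
    have h3 := abs_mul_le_mul_of_abs_le (abs_of_nonneg hσ0).le
      ((abs_add_le _ _).trans (add_le_add h1 h2))
    have h4 : |lowPotDeriv τ s b c k y| ≤ ε₁ * σ ^ 2 +
        σ * (s * 1 * (N * (ε₁ * σ * 1)) + N * (ε₁ * σ * 1 + ε₁ * σ * 1)) := by
      refine (abs_add_le _ _).trans (add_le_add ?_ h3)
      rw [abs_neg]; exact hdc2 k
    refine h4.trans ?_
    rw [← hε₁e]
    linarith
  have hqL : ∀ l, |coGrad a l y| ≤ L := fun l => (hq l).trans hNML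
  have hdqL : ∀ k l, |coGradDeriv a k l y| ≤ L := fun k l => (hdq k l).trans (by
    rw [hL]; linarith)
  have hQL : |symb a y| ≤ L := hQ.trans (by rw [hL]; linarith)
  have hdQL : ∀ k, |symbDeriv a k y| ≤ L := fun k => (hdQ k).trans (by rw [hL]; linarith)
  have hpL : ∀ k, |coConjGrad τ s a v k y| ≤ L * W := fun k => (hp k).trans (by
    rw [← mul_assoc]; exact mul_le_mul_of_nonneg_right hNML hW0)
  have hN2ML : N * (N * M) * W ^ 2 ≤ L * W ^ 2 :=
    mul_le_mul_of_nonneg_right (by rw [hL]; linarith) (sq_nonneg W)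
  have heL : |energy τ s a v y| ≤ L * W ^ 2 := he.trans (by linarith)
  have hzL : ∀ l, |∑ i, ∑ j, pd l (a i j) y * u i * u j| ≤ L * W ^ 2 := fun l =>
    (hz l).trans (by linarith)
  have hJ := commutator_form_lower_bound (w := w) hN hL0 (by linarith : 0 ≤ θ / 4) hs hσ0 hε0 hε1
    hσε hθ huW hpL hqL hηL hzL hdQL hdqL hb1 hdb1 hV hdV hQL heL hQθ heθ hpq rfl
  have hR := remainder_sq_le (w := w) hN hL0 hs hσ0 hσε hW0 huW hηL
    (fun i j => (hA i j).trans hML) (fun k i j => (hdA k i j).trans hML)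
    (fun i j => (hH i j).trans h1L) hQL
  have hid := sum_flux_deriv_eq (A := fun i j => a i j y) (dA := fun k i j => pd k (a i j) y)
    (U := fun k i => conjHess τ s v k i y) (V := σ ^ 2 * symb a y + lowPot τ s b c y)
    (dB := fun k l => 2 * σ * (s * gradH k y * coGrad a l y + coGradDeriv a k l y) +
      pd k (b l) y) (dg := fun k => 2 * σ * s * (s * gradH k y * symb a y + symbDeriv a k y))
    (dV := fun k => σ ^ 2 * (2 * s * gradH k y * symb a y + symbDeriv a k y) +
      lowPotDeriv τ s b c k y) (w := w) (u := u) (p := fun k => coConjGrad τ s a v k y)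
    (B := fun l => drift τ s a b l y) (g := 2 * σ * s * symb a y) (e := energy τ s a v y)
    (T := antiPart τ s a b v y)
    hsym (fun i j => conjHess_comm hvsym j i) (fun _ => rfl) (fun _ _ => rfl) rfl (fun _ => rfl)
    rfl (fun _ => rfl)
  have hdiv' : ∑ k, pd k (flux τ s a b c v k) y = _ :=
    (Finset.sum_congr rfl fun k _ => (hasPD_flux ha hb hc hv hdv k).pd_eq (hF k)).trans hid
  have hop := conjugated_operator_eq (τ := τ) (s := s) (b := b) (c := c) (v := v) hsym
  have hx1 : σ * W ^ 2 + σ ^ 3 * w ^ 2 ≤ (2 * N + 2) * density τ s v y := by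
    have h1 := sum_sq_add_mul_le (t := σ * w) (x := fun i => wt τ s y * pd i v y) hN hη
    have h2 : W ^ 2 = ∑ i, (wt τ s y * pd i v y + σ * w * gradH i y) ^ 2 := by
      rw [hW2]
      refine Finset.sum_congr rfl fun i _ => ?_
      simp only [hu, hw, conjGrad, conj]; ring
    rw [← h2] at h1
    have h3 := mul_le_mul_of_nonneg_left h1 hσ0
    have h4 : 0 ≤ ∑ i, (wt τ s y * pd i v y) ^ 2 := Finset.sum_nonneg fun i _ => sq_nonneg _
    have h5 : 0 ≤ 2 * N * (σ * ∑ i, (wt τ s y * pd i v y) ^ 2) := by positivity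
    have h6 : 0 ≤ σ ^ 3 * w ^ 2 := by positivity
    have h7 : density τ s v y = σ * ∑ i, (wt τ s y * pd i v y) ^ 2 + σ ^ 3 * w ^ 2 := rfl
    rw [h7]
    linarith
  have hx2 : density τ s v y ≤ (2 * N + 2) * (σ * W ^ 2 + σ ^ 3 * w ^ 2) := by
    have h1 := sum_sq_add_mul_le (t := -(σ * w)) (x := u) hN hη
    have h2 : ∑ i, (wt τ s y * pd i v y) ^ 2 = ∑ i, (u i + -(σ * w) * gradH i y) ^ 2 := by
      refine Finset.sum_congr rfl fun i _ => ?_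
      simp only [hu, hw, conjGrad, conj]; ring
    rw [← h2, ← hW2] at h1
    have h3 := mul_le_mul_of_nonneg_left h1 hσ0
    have h5 : 0 ≤ 2 * N * (σ * W ^ 2) := by positivity
    have h6 : 0 ≤ σ ^ 3 * w ^ 2 := by positivity
    have h7 : density τ s v y = σ * ∑ i, (wt τ s y * pd i v y) ^ 2 + σ ^ 3 * w ^ 2 := rfl
    rw [h7]
    linarith
  set D := σ * W ^ 2 + σ ^ 3 * w ^ 2 with hDdef
  have hD0 : 0 ≤ D := by positivity
  constructor
  · rw [hop, hdiv']
    set J := ∑ k, ∑ l, coConjGrad τ s a v k y *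
        (2 * σ * (s * gradH k y * coGrad a l y + coGradDeriv a k l y) + pd k (b l) y) * u l +
        w * ∑ k, coConjGrad τ s a v k y *
          (2 * σ * s * (s * gradH k y * symb a y + symbDeriv a k y)) +
        2 * σ * s * symb a y * energy τ s a v y -
        1 / 2 * (∑ k, (2 * σ * (s * gradH k y * coGrad a k y + coGradDeriv a k k y) +
          pd k (b k) y)) * energy τ s a v y -
        1 / 2 * ∑ l, drift τ s a b l y * ∑ i, ∑ j, pd l (a i j) y * u i * u j +
        w ^ 2 * (1 / 2 * (σ ^ 2 * symb a y + lowPot τ s b c y) *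
          (∑ k, (2 * σ * (s * gradH k y * coGrad a k y + coGradDeriv a k k y) + pd k (b k) y)) +
          1 / 2 * ∑ k, drift τ s a b k y * (σ ^ 2 * (2 * s * gradH k y * symb a y +
            symbDeriv a k y) + lowPotDeriv τ s b c k y) -
          (σ ^ 2 * symb a y + lowPot τ s b c y) * (2 * σ * s * symb a y)) with hJdef
    have hJ' : s * (θ / 4) * (θ * (σ * W ^ 2) + θ / 4 * (σ ^ 3 * w ^ 2)) -
        (coeffError N L + smallError N L s * ε) * D ≤ J := hJ
    set S := -(∑ k, ∑ j, (pd k (a k j) y * conjGrad τ s v j y +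
      a k j y * conjHess τ s v k j y)) - (σ ^ 2 * symb a y + lowPot τ s b c y) * w with hS
    set R := -(2 * σ * s * symb a y * w) + ∑ i, ∑ j, pd i (a i j) y * conjGrad τ s v j y +
          (∑ i, ∑ j, a i j y * (σ * (s * gradH i y * gradH j y + hessH i j))) * w with hRdef
    have hR' : R ^ 2 ≤ 2 * remainderConst N L s ^ 2 * ε * D := hR
    set T := antiPart τ s a b v y with hT
    have hgoal : s * ν / 2 / (2 * N + 2) * density τ s v y ≤ s * ν / 2 * D := by
      have hsν : 0 ≤ s * ν / 2 := by
        have := coeffError_nonneg (N := N) (L := L) hN0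
        linarith
      rw [div_mul_eq_mul_div, div_le_iff₀ (by positivity)]
      have := mul_le_mul_of_nonneg_left hx2 hsν
      linarith
    have hpos : s * ν * D ≤ s * (θ / 4) * (θ * (σ * W ^ 2) + θ / 4 * (σ ^ 3 * w ^ 2)) := by
      have h1 := mul_le_mul_of_nonneg_left hν (show 0 ≤ s * (σ * W ^ 2) by positivity)
      have h2 := mul_le_mul_of_nonneg_left hν' (show 0 ≤ s * (σ ^ 3 * w ^ 2) by positivity)
      rw [hDdef]
      linarith
    -- Budget: 2J contains 2sνD. The errors independent of s cost at most sνD, those carrying ε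
    -- together with R² at most sνD/2, which leaves sνD/2.
    have h1 := mul_le_mul_of_nonneg_right hs₀ hD0
    have h2 := mul_le_mul_of_nonneg_right hε₀ hD0
    have h3 : s * ν / 2 / (2 * N + 2) * density τ s v y + 2 * (S * T - J) ≤ (S + T + R) ^ 2 := by
      -- These squares are exactly the difference between (S+T+R)² and 2ST - R², so the remainder
      -- costs only R² and no cross term with S or T has to be estimated.
      have h4 : 0 ≤ (S - T) ^ 2 / 2 + (S + T + 2 * R) ^ 2 / 2 := by positivity
      have h5 : (S + T + R) ^ 2 = 2 * (S * T) - R ^ 2 +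
        ((S - T) ^ 2 / 2 + (S + T + 2 * R) ^ 2 / 2) := by ring
      linarith
    exact h3
  · intro k
    have hBL : ∀ l, |drift τ s a b l y| ≤ σ * (2 * L + 1) := fun l => by
      have h1 := abs_mul_le_mul_of_abs_le (abs_of_nonneg (show 0 ≤ 2 * σ by positivity)).le (hqL l)
      refine (abs_add_le _ _).trans ?_
      have h2 : ε * σ ≤ 1 * σ := by gcongr
      linarith [hb1 l]
    have h1 := abs_flux_le (w := w) hN hL0 hs hσ1 hε1 huW (hpL k) hBL (hBL k) hV hQL heL
    have h2 : |flux τ s a b c v k y| ≤ fluxConst N L s * D := h1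
    refine h2.trans ?_
    rw [mul_assoc]
    refine mul_le_mul_of_nonneg_left hx1 ?_
    unfold fluxConst
    positivity

end Pointwise

end PointwiseEstimate

/-! ### Smooth approximation of W^{1,∞} coefficients. -/

section Mollification

open Filter Topology
open scoped Convolution

variable {d : ℕ}

theorem ae_abs_le_of_eLpNorm_top_le {α : Type*} [MeasurableSpace α] {μ : Measure α} {f : α → ℝ}
    {K : ℝ} (hK : 0 ≤ K) (hf : eLpNorm f ∞ μ ≤ ENNReal.ofReal K) : ∀ᵐ y ∂μ, |f y| ≤ K := by
  rw [eLpNorm_exponent_top] at hf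
  filter_upwards [ae_le_eLpNormEssSup (f := f) (μ := μ)] with y hy
  have := hy.trans hf
  rwa [← ofReal_norm, ENNReal.ofReal_le_ofReal_iff hK] at this

/-- The average of a bounded function against a probability density is bounded. -/
theorem abs_integral_mul_le {α : Type*} [MeasurableSpace α] {μ : Measure α} {ζ g : α → ℝ} {K : ℝ}
    (hζ : Integrable ζ μ) (hζ0 : ∀ t, 0 ≤ ζ t) (hg : ∀ᵐ t ∂μ, |g t| ≤ K) :
    |∫ t, ζ t * g t ∂μ| ≤ K * ∫ t, ζ t ∂μ := by
  rw [← integral_const_mul, ← Real.norm_eq_abs]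
  refine norm_integral_le_of_norm_le (hζ.const_mul K) ?_
  filter_upwards [hg] with t ht
  rw [Real.norm_eq_abs, abs_mul, abs_of_nonneg (hζ0 t), mul_comm]
  exact mul_le_mul_of_nonneg_right ht (hζ0 t)

/-- Functions in `W^{1,∞}` are almost everywhere limits of smooth functions with the same bound
away from the boundary. -/
theorem W1InftyNormLE.exists_smooth_approx {U : Set (E d)} (hU : IsOpen U) {f : E d → ℝ} {K : ℝ}
    (hK : 0 ≤ K) (hf : W1InftyNormLE U f K) :
    ∃ F : ℕ → E d → ℝ, (∀ m, ContDiff ℝ ∞ (F m)) ∧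
      (∀ᵐ y ∂volume.restrict U, Tendsto (fun m => F m y) atTop (𝓝 (f y))) ∧
      ∀ (m : ℕ) (y : E d), Metric.closedBall y (1 / ((m : ℝ) + 1)) ⊆ U →
        |F m y| ≤ K ∧ ∀ k, |pd k (F m) y| ≤ K := by
  obtain ⟨hmeas, hbd, hder⟩ := hf
  have hbd' : ∀ᵐ y ∂volume.restrict U, |f y| ≤ K := ae_abs_le_of_eLpNorm_top_le hK hbd
  set f' : E d → ℝ := U.indicator f with hf'
  have hf'bd : ∀ᵐ y, |f' y| ≤ K := by
    rw [ae_restrict_iff' hU.measurableSet] at hbd'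
    filter_upwards [hbd'] with y hy
    by_cases hyU : y ∈ U
    · rw [hf', Set.indicator_of_mem hyU]; exact hy hyU
    · rw [hf', Set.indicator_of_notMem hyU]; simpa using hK
  have hf'meas : AEStronglyMeasurable f' volume :=
    (aestronglyMeasurable_indicator_iff hU.measurableSet).2 hmeas
  have hf'loc : LocallyIntegrable f' volume := by
    have : MemLp f' ∞ volume := memLp_top_of_bound hf'meas K hf'bd
    exact this.locallyIntegrable le_top
  -- The ratio of the outer to the inner radius is fixed at 2, as the almost everywhere convergence
  -- of the convolutions requires.
  let φ : ℕ → ContDiffBump (0 : E d) := fun m =>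
    { rIn := 1 / ((m : ℝ) + 1) / 2
      rOut := 1 / ((m : ℝ) + 1)
      rIn_pos := by positivity
      rIn_lt_rOut := half_lt_self (by positivity) }
  have hφout : ∀ m, (φ m).rOut = 1 / ((m : ℝ) + 1) := fun m => rfl
  have hφsm : ∀ m, ContDiff ℝ ∞ ((φ m).normed volume) := fun m => (φ m).contDiff_normed
  have hφcs : ∀ m, HasCompactSupport ((φ m).normed volume) := fun m =>
    (φ m).hasCompactSupport_normed
  refine ⟨fun m => (φ m).normed volume ⋆[ContinuousLinearMap.lsmul ℝ ℝ, volume] f', fun m => ?_,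
    ?_, fun m y hy => ?_⟩
  · exact (hφcs m).contDiff_convolution_left _ (hφsm m) hf'loc
  · have := ContDiffBump.ae_convolution_tendsto_right_of_locallyIntegrable (φ := φ) (l := atTop)
      (K := 2) (μ := volume) (g := f') tendsto_one_div_add_atTop_nhds_zero_nat
      (Eventually.of_forall fun m => le_of_eq (by
        change 1 / ((m : ℝ) + 1) = 2 * (1 / ((m : ℝ) + 1) / 2); ring)) hf'loc
    rw [ae_restrict_iff' hU.measurableSet]
    filter_upwards [this] with y hy hyU
    rwa [hf', Set.indicator_of_mem hyU] at hy
  · set ζ : E d → ℝ := fun t => (φ m).normed volume (y - t) with hζ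
    have hζ0 : ∀ t, 0 ≤ ζ t := fun t => (φ m).nonneg_normed _
    have hζsm : ContDiff ℝ ∞ ζ := (hφsm m).comp (contDiff_const.sub contDiff_id)
    have hζsupp : tsupport ζ ⊆ Metric.closedBall y (1 / ((m : ℝ) + 1)) := by
      refine closure_minimal ?_ Metric.isClosed_closedBall
      intro t ht
      have : y - t ∈ Function.support ((φ m).normed volume) := ht
      rw [(φ m).support_normed_eq, hφout, mem_ball_zero_iff] at this
      rw [Metric.mem_closedBall, dist_eq_norm']
      exact this.le
    have hζcs : HasCompactSupport ζ :=
      (isCompact_closedBall y _).of_isClosed_subset (isClosed_tsupport ζ) hζsupp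
    have hζint : Integrable ζ volume := hζsm.continuous.integrable_of_hasCompactSupport hζcs
    have hζ1 : ∫ t, ζ t = 1 := by
      rw [hζ, integral_sub_left_eq_self (fun t => (φ m).normed volume t) volume y]
      exact (φ m).integral_normed
    beta_reduce
    constructor
    · rw [convolution_eq_swap]
      have := abs_integral_mul_le hζint hζ0 hf'bd
      rw [hζ1, mul_one] at this
      exact this
    · intro k
      obtain ⟨g, hgm, hgb, hg⟩ := hder k
      have hgb' : ∀ᵐ y ∂volume.restrict U, |g y| ≤ K := ae_abs_le_of_eLpNorm_top_le hK hgb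
      have hD := (hφcs m).hasFDerivAt_convolution_left (ContinuousLinearMap.lsmul ℝ ℝ)
        (μ := volume) ((hφsm m).of_le (by exact_mod_cast le_top)) hf'loc y
      have hex : ConvolutionExistsAt (fderiv ℝ ((φ m).normed volume)) f' y
          ((ContinuousLinearMap.lsmul ℝ ℝ).precompL (E d)) volume :=
        ((hφcs m).fderiv ℝ).convolutionExists_left _
          ((hφsm m).continuous_fderiv (by simp)) hf'loc y
      have h1 : pd k ((φ m).normed volume ⋆[ContinuousLinearMap.lsmul ℝ ℝ, volume] f') y =
          ∫ t, fderiv ℝ ((φ m).normed volume) (y - t) (EuclideanSpace.single k 1) * f' t := by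
        rw [pd, hD.fderiv, convolution_eq_swap, ContinuousLinearMap.integral_apply]
        · rfl
        · exact hex.integrable_swap
      have h2 : ∀ t, fderiv ℝ ζ t (EuclideanSpace.single k 1) =
          -fderiv ℝ ((φ m).normed volume) (y - t) (EuclideanSpace.single k 1) := by
        intro t
        have h3 : HasFDerivAt ζ _ t :=
          (((hφsm m).differentiable (by simp)) (y - t)).hasFDerivAt.comp t
            ((hasFDerivAt_const y t).sub (hasFDerivAt_id t))
        rw [h3.fderiv]
        simp
      -- The translated kernel is a test function in U because its closed supporting ball lies in U.
      -- Hence differentiating the mollification averages the weak derivative, and the zero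
      -- extension of f creates no jump term.
      have h4 : pd k ((φ m).normed volume ⋆[ContinuousLinearMap.lsmul ℝ ℝ, volume] f') y =
          ∫ t in U, ζ t * g t := by
        have h5 := hg ζ hζsm hζcs (hζsupp.trans hy)
        rw [h1]
        have h6 : ∫ t in U, ζ t * g t = -∫ t in U, f t * fderiv ℝ ζ t (EuclideanSpace.single k 1) := by
          rw [h5, neg_neg]
          exact integral_congr_ae (Eventually.of_forall fun t => mul_comm _ _)
        rw [h6, ← integral_indicator hU.measurableSet, ← integral_neg]
        refine integral_congr_ae (Eventually.of_forall fun t => ?_)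
        by_cases ht : t ∈ U
        · simp only [hf', Set.indicator_of_mem ht, h2]; ring
        · simp only [hf', Set.indicator_of_notMem ht]; ring
      rw [h4]
      refine (abs_integral_mul_le hζint.restrict hζ0 hgb').trans ?_
      have h7 : ∫ t in U, ζ t ≤ 1 := by
        rw [← hζ1]
        exact setIntegral_le_integral hζint (Eventually.of_forall hζ0)
      calc K * ∫ t in U, ζ t ≤ K * 1 := mul_le_mul_of_nonneg_left h7 hK
        _ = K := mul_one K

end Mollification

/-! ### Integrals over thin boundary layers bounded by boundary integrals. -/

section BoundaryLayers

open Filter Topology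

variable {d : ℕ}

theorem isOpen_halfBall : IsOpen (halfBall d) :=
  (isOpen_lt continuous_norm continuous_const).inter
    (isOpen_lt continuous_const (EuclideanSpace.proj (𝕜 := ℝ) (Fin.last d)).continuous)

theorem isClosed_closedHalfBall : IsClosed (closedHalfBall d) :=
  (isClosed_le continuous_norm continuous_const).inter
    (isClosed_le continuous_const (EuclideanSpace.proj (𝕜 := ℝ) (Fin.last d)).continuous)

theorem isCompact_closedHalfBall : IsCompact (closedHalfBall d) :=
  (isCompact_closedBall (0 : E d) (1 / 2)).of_isClosed_subset isClosed_closedHalfBall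
    fun y hy => by simpa using hy.1

theorem halfBall_subset_closedHalfBall : halfBall d ⊆ closedHalfBall d :=
  fun _ hy => ⟨hy.1.le, hy.2.le⟩

/-- The splitting of `y` into its last coordinate and `y'`. -/
def splitLast (d : ℕ) (y : E d) : ℝ × EuclideanSpace ℝ (Fin d) :=
  (y (Fin.last d), WithLp.toLp 2 fun j => y (Fin.castSucc j))

/-- This allows Fubini in (yₙ, y') for the layer at the flat part. -/
theorem measurePreserving_splitLast : MeasurePreserving (splitLast d) := by
  have h1 : MeasurePreserving (fun y : E d => WithLp.ofLp y) :=
    PiLp.volume_preserving_ofLp (Fin (d + 1))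
  have h2 := volume_preserving_piFinSuccAbove (fun _ : Fin (d + 1) => ℝ) (Fin.last d)
  have h3 : MeasurePreserving (fun p : ℝ × (Fin d → ℝ) =>
      (p.1, (WithLp.toLp 2 p.2 : EuclideanSpace ℝ (Fin d)))) :=
    (MeasurePreserving.id volume).prod (PiLp.volume_preserving_toLp (Fin d))
  have h4 := h3.comp (h2.comp h1)
  have h5 : splitLast d = (fun p : ℝ × (Fin d → ℝ) =>
      (p.1, (WithLp.toLp 2 p.2 : EuclideanSpace ℝ (Fin d)))) ∘
      (MeasurableEquiv.piFinSuccAbove (fun _ : Fin (d + 1) => ℝ) (Fin.last d)) ∘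
        (fun y : E d => WithLp.ofLp y) := by
    funext y
    simp only [splitLast, Function.comp, MeasurableEquiv.piFinSuccAbove_apply,
      Fin.insertNthEquiv_last]
    rfl
  rw [h5]
  exact h4

theorem norm_sq_eq_splitLast (y : E d) :
    ‖y‖ ^ 2 = ‖(splitLast d y).2‖ ^ 2 + y (Fin.last d) ^ 2 := by
  rw [EuclideanSpace.real_norm_sq_eq, EuclideanSpace.real_norm_sq_eq, Fin.sum_univ_castSucc]
  rfl

theorem flatEmbed_castSucc (z : EuclideanSpace ℝ (Fin d)) (j : Fin d) :
    flatEmbed d z (Fin.castSucc j) = z j := by simp [flatEmbed]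

theorem flatEmbed_last (z : EuclideanSpace ℝ (Fin d)) : flatEmbed d z (Fin.last d) = 0 := by
  simp [flatEmbed]

theorem norm_flatEmbed (z : EuclideanSpace ℝ (Fin d)) : ‖flatEmbed d z‖ = ‖z‖ := by
  have : ‖flatEmbed d z‖ ^ 2 = ‖z‖ ^ 2 := by
    rw [EuclideanSpace.real_norm_sq_eq, EuclideanSpace.real_norm_sq_eq, Fin.sum_univ_castSucc,
      flatEmbed_last]
    simp [flatEmbed_castSucc]
  exact (sq_eq_sq₀ (norm_nonneg _) (norm_nonneg _)).1 this

theorem continuous_flatEmbed : Continuous (flatEmbed d) := by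
  refine (PiLp.continuous_toLp 2 _).comp (continuous_pi fun i => ?_)
  refine Fin.lastCases ?_ (fun j => ?_) i
  · simpa using continuous_const
  · simpa using (EuclideanSpace.proj (𝕜 := ℝ) j).continuous

theorem dist_flatEmbed_splitLast (y : E d) :
    dist y (flatEmbed d (splitLast d y).2) = |y (Fin.last d)| := by
  rw [dist_eq_norm]
  have : ‖y - flatEmbed d (splitLast d y).2‖ ^ 2 = |y (Fin.last d)| ^ 2 := by
    rw [EuclideanSpace.real_norm_sq_eq, Fin.sum_univ_castSucc]
    simp [flatEmbed_castSucc, flatEmbed_last, splitLast]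
  exact (sq_eq_sq₀ (norm_nonneg _) (abs_nonneg _)).1 this

theorem flatEmbed_splitLast_mem {y : E d} (hy : y ∈ halfBall d) :
    ‖(splitLast d y).2‖ < 1 / 2 ∧ flatEmbed d (splitLast d y).2 ∈ closedHalfBall d := by
  have h1 : ‖(splitLast d y).2‖ < 1 / 2 := by
    have h2 := norm_sq_eq_splitLast y
    have h3 := hy.1
    by_contra hcon
    nlinarith [norm_nonneg y, sq_nonneg (y (Fin.last d))]
  exact ⟨h1, by rw [norm_flatEmbed]; exact h1.le, (flatEmbed_last _).ge⟩

/-- Uniform continuity on the closed half ball, in the form used for the boundary layers. -/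
theorem exists_modulus {G : E d → ℝ} (hG : Continuous G) {η : ℝ} (hη : 0 < η) :
    ∃ δ > 0, ∀ x ∈ closedHalfBall d, ∀ y ∈ closedHalfBall d, dist x y < δ → G x ≤ G y + η := by
  have := isCompact_closedHalfBall.uniformContinuousOn_of_continuous (hG.continuousOn)
  rw [Metric.uniformContinuousOn_iff] at this
  obtain ⟨δ, hδ, h⟩ := this η hη
  refine ⟨δ, hδ, fun x hx y hy hxy => ?_⟩
  have h1 := h x hx y hy hxy
  rw [Real.dist_eq] at h1
  linarith [(abs_lt.1 h1).2]

/-- The layer of the half ball near its flat boundary. -/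
theorem flat_layer_le {G : E d → ℝ} (hG : Continuous G) {η : ℝ} (hη : 0 < η) :
    ∀ᶠ ε in 𝓝[>] (0 : ℝ),
      ∫⁻ y in halfBall d ∩ {y | y (Fin.last d) ≤ 2 * ε}, ENNReal.ofReal (G y) ≤
        ENNReal.ofReal (2 * ε) *
          (∫⁻ y, ENNReal.ofReal (G y) ∂Measure.map (flatEmbed d)
              (volume.restrict (Metric.ball 0 (1 / 2))) +
            ENNReal.ofReal η * volume (Metric.ball (0 : EuclideanSpace ℝ (Fin d)) (1 / 2))) := by
  obtain ⟨δ, hδ, hGδ⟩ := exists_modulus hG hη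
  have hlt : ∀ᶠ ε in 𝓝[>] (0 : ℝ), ε < δ / 2 :=
    mem_nhdsWithin_of_mem_nhds (Iio_mem_nhds (by positivity))
  filter_upwards [hlt, self_mem_nhdsWithin] with ε hε hε0
  have hGm : Measurable fun y : E d => ENNReal.ofReal (G y) := hG.measurable.ennreal_ofReal
  set F : EuclideanSpace ℝ (Fin d) → ℝ≥0∞ :=
    (Metric.ball 0 (1 / 2)).indicator fun z => ENNReal.ofReal (G (flatEmbed d z)) +
      ENNReal.ofReal η with hF
  have hFm : Measurable F := ((hGm.comp continuous_flatEmbed.measurable).add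
    measurable_const).indicator measurableSet_ball
  set X : ℝ → ℝ≥0∞ := (Set.Ioc 0 (2 * ε)).indicator 1 with hX
  have hXm : Measurable X := measurable_one.indicator measurableSet_Ioc
  have hS : MeasurableSet (halfBall d ∩ {y | y (Fin.last d) ≤ 2 * ε}) :=
    isOpen_halfBall.measurableSet.inter
      (isClosed_le (EuclideanSpace.proj (𝕜 := ℝ) (Fin.last d)).continuous
        continuous_const).measurableSet
  calc ∫⁻ y in halfBall d ∩ {y | y (Fin.last d) ≤ 2 * ε}, ENNReal.ofReal (G y)
      = ∫⁻ y, (halfBall d ∩ {y | y (Fin.last d) ≤ 2 * ε}).indicator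
          (fun y => ENNReal.ofReal (G y)) y := (lintegral_indicator hS _).symm
    -- Uniform continuity replaces G by its value at the projection to the flat part, up to η; the
    -- majorant then factors, and the width 2ε splits off.
    _ ≤ ∫⁻ y, (fun p : ℝ × EuclideanSpace ℝ (Fin d) => X p.1 * F p.2) (splitLast d y) := by
        refine lintegral_mono fun y => ?_
        by_cases hy : y ∈ halfBall d ∩ {y | y (Fin.last d) ≤ 2 * ε}
        · obtain ⟨hz, hzm⟩ := flatEmbed_splitLast_mem hy.1
          have h1 : X (splitLast d y).1 = 1 := Set.indicator_of_mem
            (show (splitLast d y).1 ∈ Set.Ioc 0 (2 * ε) from ⟨hy.1.2, hy.2⟩) _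
          have h2 : F (splitLast d y).2 = _ := Set.indicator_of_mem (mem_ball_zero_iff.2 hz) _
          rw [Set.indicator_of_mem hy]
          simp only [h1, h2, one_mul]
          refine (ENNReal.ofReal_le_ofReal (hGδ y (halfBall_subset_closedHalfBall hy.1) _ hzm
            ?_)).trans ENNReal.ofReal_add_le
          rw [dist_flatEmbed_splitLast, abs_of_pos hy.1.2]
          have := hy.2
          simp only [Set.mem_ofPred_eq] at this
          linarith
        · rw [Set.indicator_of_notMem hy]
          exact zero_le
    _ = ∫⁻ p, (fun p : ℝ × EuclideanSpace ℝ (Fin d) => X p.1 * F p.2) p :=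
        measurePreserving_splitLast.lintegral_comp
          ((hXm.comp measurable_fst).mul (hFm.comp measurable_snd))
    _ = (∫⁻ t, X t) * ∫⁻ z, F z := lintegral_prod_mul hXm.aemeasurable hFm.aemeasurable
    _ = _ := by
        rw [hX, lintegral_indicator_one measurableSet_Ioc, Real.volume_Ioc, sub_zero, hF,
          lintegral_indicator measurableSet_ball, lintegral_add_right _ measurable_const,
          setLIntegral_const, lintegral_map hGm continuous_flatEmbed.measurable]

/-- The radial density tⁿ is at most rⁿ on the interval. At r = 1/2 this is the scaling factor of
the sphere in `boundaryMeasure`. -/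
theorem volumeIoiPow_Ico_le (n : ℕ) (r ρ : ℝ) :
    Measure.volumeIoiPow n {t | (t : ℝ) ∈ Set.Ico ρ r} ≤
      ENNReal.ofReal (r ^ n) * ENNReal.ofReal (r - ρ) := by
  have hm : MeasurableSet {t : Set.Ioi (0 : ℝ) | (t : ℝ) ∈ Set.Ico ρ r} :=
    measurable_subtype_coe measurableSet_Ico
  rw [Measure.volumeIoiPow, withDensity_apply _ hm]
  calc _ ≤ ∫⁻ _t in {t : Set.Ioi (0 : ℝ) | (t : ℝ) ∈ Set.Ico ρ r}, ENNReal.ofReal (r ^ n)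
        ∂Measure.comap Subtype.val volume := by
        refine setLIntegral_mono measurable_const fun t ht => ENNReal.ofReal_le_ofReal ?_
        exact pow_le_pow_left₀ (le_of_lt t.2) ht.2.le n
    _ = ENNReal.ofReal (r ^ n) *
        Measure.comap Subtype.val volume {t : Set.Ioi (0 : ℝ) | (t : ℝ) ∈ Set.Ico ρ r} :=
        setLIntegral_const _ _
    _ ≤ _ := by
        gcongr
        rw [comap_subtype_coe_apply measurableSet_Ioi, ← Real.volume_Ico]
        refine measure_mono ?_
        rintro _ ⟨t, ht, rfl⟩
        exact ht

/-- The layer of the half ball near its spherical boundary. -/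
theorem cap_layer_le {G : E d → ℝ} (hG : Continuous G) {η : ℝ} (hη : 0 < η) :
    ∀ᶠ ε in 𝓝[>] (0 : ℝ),
      ∫⁻ y in halfBall d ∩ {y | 1 / 4 - ‖y‖ ^ 2 ≤ 2 * ε}, ENNReal.ofReal (G y) ≤
        ENNReal.ofReal (4 * ε) *
          (∫⁻ y, ENNReal.ofReal (G y) ∂(ENNReal.ofReal ((1 / 2 : ℝ) ^ d) •
              Measure.map (fun (p : Metric.sphere (0 : E d) 1) => (1 / 2 : ℝ) • (p : E d))
                ((volume : Measure (E d)).toSphere.restrict {p | 0 < (p : E d) (Fin.last d)})) +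
            ENNReal.ofReal η * (ENNReal.ofReal ((1 / 2 : ℝ) ^ d) *
              (volume : Measure (E d)).toSphere {p | 0 < (p : E d) (Fin.last d)})) := by
  obtain ⟨δ, hδ, hGδ⟩ := exists_modulus hG hη
  have hlt : ∀ᶠ ε in 𝓝[>] (0 : ℝ), ε < δ / 4 :=
    mem_nhdsWithin_of_mem_nhds (Iio_mem_nhds (by positivity))
  filter_upwards [hlt, self_mem_nhdsWithin] with ε hε hε0
  have hGm : Measurable fun y : E d => ENNReal.ofReal (G y) := hG.measurable.ennreal_ofReal
  have hcont : Continuous fun (p : Metric.sphere (0 : E d) 1) => (1 / 2 : ℝ) • (p : E d) :=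
    by fun_prop
  have hcap : MeasurableSet {p : Metric.sphere (0 : E d) 1 | 0 < (p : E d) (Fin.last d)} :=
    (isOpen_lt continuous_const ((EuclideanSpace.proj (𝕜 := ℝ) (Fin.last d)).continuous.comp
      continuous_subtype_val)).measurableSet
  set F : Metric.sphere (0 : E d) 1 → ℝ≥0∞ :=
    {p : Metric.sphere (0 : E d) 1 | 0 < (p : E d) (Fin.last d)}.indicator
      fun p => ENNReal.ofReal (G ((1 / 2 : ℝ) • (p : E d))) + ENNReal.ofReal η with hF
  have hFm : Measurable F :=
    ((hGm.comp hcont.measurable).add measurable_const).indicator hcap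
  have hI : MeasurableSet {t : Set.Ioi (0 : ℝ) | (t : ℝ) ∈ Set.Ico (1 / 2 - 4 * ε) (1 / 2)} :=
    measurable_subtype_coe measurableSet_Ico
  set X : Set.Ioi (0 : ℝ) → ℝ≥0∞ :=
    {t : Set.Ioi (0 : ℝ) | (t : ℝ) ∈ Set.Ico (1 / 2 - 4 * ε) (1 / 2)}.indicator 1 with hX
  have hXm : Measurable X := measurable_one.indicator hI
  have hS : MeasurableSet (halfBall d ∩ {y | 1 / 4 - ‖y‖ ^ 2 ≤ 2 * ε}) :=
    isOpen_halfBall.measurableSet.inter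
      (isClosed_le (by fun_prop) continuous_const).measurableSet
  have hfin : Module.finrank ℝ (E d) - 1 = d := by simp
  calc ∫⁻ y in halfBall d ∩ {y | 1 / 4 - ‖y‖ ^ 2 ≤ 2 * ε}, ENNReal.ofReal (G y)
      = ∫⁻ y in ({0}ᶜ : Set (E d)), (halfBall d ∩ {y | 1 / 4 - ‖y‖ ^ 2 ≤ 2 * ε}).indicator
          (fun y => ENNReal.ofReal (G y)) y := by
        rw [restrict_compl_singleton, lintegral_indicator hS]
    _ = ∫⁻ y : ({0}ᶜ : Set (E d)), (halfBall d ∩ {y | 1 / 4 - ‖y‖ ^ 2 ≤ 2 * ε}).indicator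
          (fun y => ENNReal.ofReal (G y)) y ∂(volume.comap Subtype.val) :=
        (lintegral_subtype_comap (measurableSet_singleton _).compl _).symm
    _ ≤ ∫⁻ y : ({0}ᶜ : Set (E d)), (fun p : Metric.sphere (0 : E d) 1 × Set.Ioi (0 : ℝ) =>
          F p.1 * X p.2) (homeomorphUnitSphereProd (E d) y) ∂(volume.comap Subtype.val) := by
        refine lintegral_mono fun y => ?_
        by_cases hy : (y : E d) ∈ halfBall d ∩ {y | 1 / 4 - ‖y‖ ^ 2 ≤ 2 * ε}
        · have hn : 0 < ‖(y : E d)‖ := norm_pos_iff.2 y.2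
          set p := (homeomorphUnitSphereProd (E d) y).1 with hp
          have hpe : (p : E d) = ‖(y : E d)‖⁻¹ • (y : E d) := by
            simp [hp]
          have hp0 : 0 < (p : E d) (Fin.last d) := by
            rw [hpe]
            simpa using mul_pos (inv_pos.2 hn) hy.1.2
          have hre : ((homeomorphUnitSphereProd (E d) y).2 : ℝ) = ‖(y : E d)‖ := by simp
          -- In 1/4 - ‖y‖² = (1/2 - ‖y‖)(1/2 + ‖y‖) the second factor is at least 1/2, so the radial
          -- width is at most 4ε.
          have hlow : 1 / 2 - 4 * ε ≤ ‖(y : E d)‖ := by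
            have h1 := hy.2
            have h2 := hy.1.1
            simp only [Set.mem_ofPred_eq] at h1
            nlinarith
          have h1 : X (homeomorphUnitSphereProd (E d) y).2 = 1 := Set.indicator_of_mem
            (show (homeomorphUnitSphereProd (E d) y).2 ∈
              {t : Set.Ioi (0 : ℝ) | (t : ℝ) ∈ Set.Ico (1 / 2 - 4 * ε) (1 / 2)} by
              rw [Set.mem_ofPred_eq, hre]; exact ⟨hlow, hy.1.1⟩) _
          have h2 : F p = _ := Set.indicator_of_mem
            (show p ∈ {p : Metric.sphere (0 : E d) 1 | 0 < (p : E d) (Fin.last d)} from hp0) _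
          rw [Set.indicator_of_mem hy]
          simp only [← hp, h1, h2, mul_one]
          have hpn : ‖(p : E d)‖ = 1 := by simp
          refine (ENNReal.ofReal_le_ofReal (hGδ y (halfBall_subset_closedHalfBall hy.1)
            ((1 / 2 : ℝ) • (p : E d)) ⟨?_, ?_⟩ ?_)).trans ENNReal.ofReal_add_le
          · rw [norm_smul, hpn]; norm_num
          · simpa using hp0.le
          · have hyp : (y : E d) = ‖(y : E d)‖ • (p : E d) := by
              rw [hpe, smul_smul, mul_inv_cancel₀ hn.ne', one_smul]
            have h3 : (y : E d) - (1 / 2 : ℝ) • (p : E d) =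
                (‖(y : E d)‖ - 1 / 2) • (p : E d) := by
              rw [sub_smul, ← hyp]
            rw [dist_eq_norm, h3, norm_smul, hpn, mul_one, Real.norm_eq_abs, abs_lt]
            have := hy.1.1
            constructor <;> linarith
        · rw [Set.indicator_of_notMem hy]
          exact zero_le
    _ = ∫⁻ p, (fun p : Metric.sphere (0 : E d) 1 × Set.Ioi (0 : ℝ) => F p.1 * X p.2) p
          ∂((volume : Measure (E d)).toSphere.prod
            (Measure.volumeIoiPow (Module.finrank ℝ (E d) - 1))) :=
        ((volume : Measure (E d)).measurePreserving_homeomorphUnitSphereProd).lintegral_comp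
          ((hFm.comp measurable_fst).mul (hXm.comp measurable_snd))
    _ = (∫⁻ p, F p ∂(volume : Measure (E d)).toSphere) * ∫⁻ t, X t ∂Measure.volumeIoiPow d := by
        rw [hfin]
        exact lintegral_prod_mul hFm.aemeasurable hXm.aemeasurable
    _ ≤ (∫⁻ p, F p ∂(volume : Measure (E d)).toSphere) *
          (ENNReal.ofReal ((1 / 2) ^ d) * ENNReal.ofReal (4 * ε)) := by
        gcongr
        rw [hX, lintegral_indicator_one hI]
        refine (volumeIoiPow_Ico_le d _ _).trans_eq ?_
        congr 2; ring
    _ = _ := by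
        rw [hF, lintegral_indicator hcap, lintegral_add_right _ measurable_const,
          setLIntegral_const, lintegral_smul_measure, lintegral_map hGm hcont.measurable,
          smul_eq_mul]
        ring

end BoundaryLayers

/-! ### Cutoff functions and integration by parts against them. -/

section Cutoffs

open Filter Topology

variable {d : ℕ}

theorem deriv_smoothTransition_eq_zero {t : ℝ} (ht : 1 < t) :
    deriv Real.smoothTransition t = 0 := by
  have : Real.smoothTransition =ᶠ[𝓝 t] fun _ => 1 := by
    filter_upwards [Ioi_mem_nhds ht] with x hx using Real.smoothTransition.one_of_one_le hx.le
  rw [this.deriv_eq, deriv_const]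

/-- The derivative is continuous and vanishes outside [0,1], so compactness gives a universal bound.
-/
theorem exists_deriv_smoothTransition_le :
    ∃ C : ℝ, 0 ≤ C ∧ ∀ t, |deriv Real.smoothTransition t| ≤ C := by
  have hc : Continuous (deriv Real.smoothTransition) :=
    (Real.smoothTransition.contDiff (n := 1)).continuous_deriv le_rfl
  obtain ⟨C, hC⟩ := (isCompact_Icc (a := (0 : ℝ)) (b := 1)).exists_bound_of_continuousOn
    hc.continuousOn
  refine ⟨max C 0, le_max_right _ _, fun t => ?_⟩
  by_cases ht : t ∈ Set.Icc (0 : ℝ) 1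
  · exact (hC t ht).trans (le_max_left _ _)
  · rw [Set.mem_Icc, not_and_or, not_le, not_le] at ht
    rcases ht with ht | ht
    · have : Real.smoothTransition =ᶠ[𝓝 t] fun _ => 0 := by
        filter_upwards [Iio_mem_nhds ht] with x hx using
          Real.smoothTransition.zero_of_nonpos hx.le
      rw [this.deriv_eq, deriv_const, abs_zero]
      exact le_max_right _ _
    · rw [deriv_smoothTransition_eq_zero ht, abs_zero]
      exact le_max_right _ _

/-- A smooth cutoff function, supported in the half ball and equal to one away from a layer of
width comparable to `ε` around its boundary. -/
def cutoff (ε : ℝ) (y : E d) : ℝ :=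
  Real.smoothTransition (y (Fin.last d) / ε - 1) *
    Real.smoothTransition ((1 / 4 - ‖y‖ ^ 2) / ε - 1)

theorem contDiff_cutoff (ε : ℝ) : ContDiff ℝ ∞ (cutoff ε : E d → ℝ) := by
  have h1 : ContDiff ℝ ∞ fun y : E d => y (Fin.last d) / ε - 1 := by fun_prop
  have h2 : ContDiff ℝ ∞ fun y : E d => (1 / 4 - ‖y‖ ^ 2) / ε - 1 :=
    ((contDiff_const.sub (contDiff_norm_sq ℝ)).div_const _).sub contDiff_const
  exact (Real.smoothTransition.contDiff.comp h1).mul (Real.smoothTransition.contDiff.comp h2)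

theorem cutoff_nonneg (ε : ℝ) (y : E d) : 0 ≤ cutoff ε y :=
  mul_nonneg (Real.smoothTransition.nonneg _) (Real.smoothTransition.nonneg _)

theorem cutoff_le_one (ε : ℝ) (y : E d) : cutoff ε y ≤ 1 :=
  mul_le_one₀ (Real.smoothTransition.le_one _) (Real.smoothTransition.nonneg _)
    (Real.smoothTransition.le_one _)

theorem tsupport_cutoff_subset {ε : ℝ} (hε : 0 < ε) :
    tsupport (cutoff ε : E d → ℝ) ⊆ {y | ε ≤ y (Fin.last d)} ∩ {y | ‖y‖ ^ 2 ≤ 1 / 4 - ε} := by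
  refine closure_minimal (fun y hy => ?_) ((isClosed_le continuous_const
    (EuclideanSpace.proj (𝕜 := ℝ) (Fin.last d)).continuous).inter
      (isClosed_le (by fun_prop) continuous_const))
  have hy' : cutoff ε y ≠ 0 := hy
  unfold cutoff at hy'
  obtain ⟨h1, h2⟩ := mul_ne_zero_iff.1 hy'
  rw [Ne, Real.smoothTransition.zero_iff_nonpos, not_le, sub_pos, lt_div_iff₀ hε, one_mul] at h1 h2
  exact ⟨h1.le, show ‖y‖ ^ 2 ≤ 1 / 4 - ε by linarith⟩

theorem tsupport_cutoff_subset_halfBall {ε : ℝ} (hε : 0 < ε) :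
    tsupport (cutoff ε : E d → ℝ) ⊆ halfBall d := by
  intro y hy
  obtain ⟨h1, h2⟩ := tsupport_cutoff_subset hε hy
  simp only [Set.mem_ofPred_eq] at h1 h2
  refine ⟨?_, hε.trans_le h1⟩
  nlinarith [norm_nonneg y]

theorem hasCompactSupport_cutoff {ε : ℝ} (hε : 0 < ε) :
    HasCompactSupport (cutoff ε : E d → ℝ) :=
  isCompact_closedHalfBall.of_isClosed_subset (isClosed_tsupport _)
    ((tsupport_cutoff_subset_halfBall hε).trans halfBall_subset_closedHalfBall)

theorem eventually_cutoff_eq_one {y : E d} (hy : y ∈ halfBall d) :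
    ∀ᶠ ε in 𝓝[>] (0 : ℝ), cutoff ε y = 1 := by
  have hr : 0 < 1 / 4 - ‖y‖ ^ 2 := by nlinarith [hy.1, norm_nonneg y]
  have h1 : ∀ᶠ ε in 𝓝[>] (0 : ℝ), ε < y (Fin.last d) / 2 :=
    mem_nhdsWithin_of_mem_nhds (Iio_mem_nhds (half_pos hy.2))
  have h2 : ∀ᶠ ε in 𝓝[>] (0 : ℝ), ε < (1 / 4 - ‖y‖ ^ 2) / 2 :=
    mem_nhdsWithin_of_mem_nhds (Iio_mem_nhds (half_pos hr))
  filter_upwards [h1, h2, self_mem_nhdsWithin] with ε he1 he2 hε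
  have hε' : 0 < ε := hε
  unfold cutoff
  rw [Real.smoothTransition.one_of_one_le, Real.smoothTransition.one_of_one_le, one_mul]
  · rw [le_sub_iff_add_le, le_div_iff₀ hε']; linarith
  · rw [le_sub_iff_add_le, le_div_iff₀ hε']; linarith

theorem hasPD_smoothTransition_comp {f : E d → ℝ} {f' : ℝ} {k : Fin (d + 1)} {y : E d}
    (hf : HasPD k f f' y) : HasPD k (fun z => Real.smoothTransition (f z))
      (deriv Real.smoothTransition (f y) * f') y := by
  have h1 : HasDerivAt Real.smoothTransition (deriv Real.smoothTransition (f y)) (f y) :=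
    ((Real.smoothTransition.contDiff (n := 1)).differentiable (by norm_num) _).hasDerivAt
  have h2 : HasDerivAt (fun t : ℝ => f (y + t • EuclideanSpace.single k 1)) f' 0 := hf
  have h3 := HasDerivAt.comp_of_eq (0 : ℝ) h1 h2 (by simp)
  exact h3

theorem hasPD_norm_sq (k : Fin (d + 1)) (y : E d) : HasPD k (fun z => ‖z‖ ^ 2) (2 * y k) y := by
  have h1 : (fun z : E d => ‖z‖ ^ 2) = fun z => ∑ i, z i * z i := by
    funext z
    rw [EuclideanSpace.real_norm_sq_eq]
    exact Finset.sum_congr rfl fun i _ => by ring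
  rw [h1]
  refine (HasPD.sum fun i => (hasPD_coord i k y).mul (hasPD_coord i k y)).congr_deriv ?_
  rw [Finset.sum_eq_single k]
  · simp; ring
  · intro i _ hi; simp [hi]
  · simp

/-- The gradient of the cutoff function is concentrated in the boundary layers. -/
theorem abs_pd_cutoff_le {C : ℝ} (hC : ∀ t, |deriv Real.smoothTransition t| ≤ C) {ε : ℝ}
    (hε : 0 < ε) {y : E d} (hy : y ∈ halfBall d) (k : Fin (d + 1)) :
    |pd k (cutoff ε) y| ≤ C / ε * (Set.indicator {y : E d | y (Fin.last d) ≤ 2 * ε} 1 y +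
      Set.indicator {y : E d | 1 / 4 - ‖y‖ ^ 2 ≤ 2 * ε} 1 y) := by
  have hC0 : 0 ≤ C := (abs_nonneg _).trans (hC 0)
  have e1 : HasPD k (fun z : E d => ε⁻¹ * z (Fin.last d) - 1) _ y :=
    ((hasPD_coord (Fin.last d) k y).const_mul ε⁻¹).sub (hasPD_const 1 k y)
  have e2 : HasPD k (fun z : E d => ε⁻¹ * (1 / 4 - ‖z‖ ^ 2) - 1) _ y :=
    (((hasPD_const (1 / 4) k y).sub (hasPD_norm_sq k y)).const_mul ε⁻¹).sub (hasPD_const 1 k y)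
  have e3 := (hasPD_smoothTransition_comp e1).mul (hasPD_smoothTransition_comp e2)
  have e4 : (fun z : E d => Real.smoothTransition (ε⁻¹ * z (Fin.last d) - 1) *
      Real.smoothTransition (ε⁻¹ * (1 / 4 - ‖z‖ ^ 2) - 1)) = cutoff ε := by
    funext z; unfold cutoff; simp only [div_eq_inv_mul]
  rw [e4] at e3
  rw [e3.pd_eq ((contDiff_cutoff ε).differentiable (by simp) y)]
  -- One bound serves both factors of the cutoff: outside its layer the argument of the transition
  -- exceeds 1 and its derivative is zero. The inner derivatives are at most 1/ε because |2y_k| ≤ 1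
  -- on the half ball.
  have key : ∀ (S : Set (E d)) (x c r : ℝ), (y ∉ S → 1 < x) → |c| ≤ 1 → |r| ≤ 1 →
      |deriv Real.smoothTransition x * (ε⁻¹ * c) * r| ≤ C / ε * S.indicator 1 y := by
    intro S x c r hx hc hr
    by_cases hyS : y ∈ S
    · rw [Set.indicator_of_mem hyS]
      have := abs_mul_le_mul_of_abs_le (abs_mul_le_mul_of_abs_le (hC x)
        (abs_mul_le_mul_of_abs_le (abs_of_pos (inv_pos.2 hε)).le hc)) hr
      simpa [div_eq_mul_inv] using this
    · rw [Set.indicator_of_notMem hyS, deriv_smoothTransition_eq_zero (hx hyS)]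
      simp
  have habs1 : ∀ t, |Real.smoothTransition t| ≤ 1 := fun t => by
    rw [abs_of_nonneg (Real.smoothTransition.nonneg _)]; exact Real.smoothTransition.le_one _
  have hyk := abs_le.1 ((abs_coord_le_norm y k).trans hy.1.le)
  have k1 := key {y : E d | y (Fin.last d) ≤ 2 * ε} (ε⁻¹ * y (Fin.last d) - 1)
    (if Fin.last d = k then 1 else 0) (Real.smoothTransition (ε⁻¹ * (1 / 4 - ‖y‖ ^ 2) - 1))
    (fun hn => by
      have : 2 * ε < y (Fin.last d) := not_le.1 hn
      rw [lt_sub_iff_add_lt, ← div_eq_inv_mul, lt_div_iff₀ hε]; linarith)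
    (by split_ifs <;> simp) (habs1 _)
  have k2 := key {y : E d | 1 / 4 - ‖y‖ ^ 2 ≤ 2 * ε} (ε⁻¹ * (1 / 4 - ‖y‖ ^ 2) - 1)
    (0 - 2 * y k) (Real.smoothTransition (ε⁻¹ * y (Fin.last d) - 1))
    (fun hn => by
      have : 2 * ε < 1 / 4 - ‖y‖ ^ 2 := not_le.1 hn
      rw [lt_sub_iff_add_lt, ← div_eq_inv_mul, lt_div_iff₀ hε]; linarith)
    (by rw [abs_le]; constructor <;> linarith) (habs1 _)
  rw [mul_add]
  refine (abs_add_le _ _).trans (add_le_add ?_ ?_)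
  · rwa [sub_zero]
  · rw [sub_zero, mul_comm]; exact k2

/-- Products of a compactly supported function with a function that is continuous near the
support are integrable. -/
theorem integrable_mul_of_tsupport_subset {U : Set (E d)} (hU : IsOpen U) {χ g : E d → ℝ}
    (hχ : Continuous χ) (hcs : HasCompactSupport χ) (hsub : tsupport χ ⊆ U)
    (hg : ContinuousOn g U) : Integrable fun y => χ y * g y := by
  have hcont : Continuous fun y => χ y * g y := by
    refine continuous_iff_continuousAt.2 fun y => ?_
    by_cases hy : y ∈ tsupport χ
    · exact hχ.continuousAt.mul (hg.continuousAt (hU.mem_nhds (hsub hy)))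
    · have : (fun y => χ y * g y) =ᶠ[𝓝 y] fun _ => 0 := by
        filter_upwards [(isClosed_tsupport χ).isOpen_compl.mem_nhds hy] with z hz
        rw [image_eq_zero_of_notMem_tsupport hz, zero_mul]
      exact continuousAt_const.congr this.symm
  exact hcont.integrable_of_hasCompactSupport hcs.mul_right

theorem tsupport_pd_subset (k : Fin (d + 1)) (χ : E d → ℝ) : tsupport (pd k χ) ⊆ tsupport χ := by
  refine closure_minimal (fun y hy => ?_) (isClosed_tsupport _)
  by_contra hcon
  refine hy ?_
  have : χ =ᶠ[𝓝 y] fun _ => 0 := by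
    filter_upwards [(isClosed_tsupport χ).isOpen_compl.mem_nhds hcon] with z hz
    exact image_eq_zero_of_notMem_tsupport hz
  rw [pd, this.fderiv_eq]; simp

/-- Compact support of the cutoff inside U removes any boundary term, so F needs to be C¹ only on U,
with no control at its boundary. -/
theorem integral_cutoff_mul_pd {U : Set (E d)} (hU : IsOpen U) {χ F : E d → ℝ}
    (hχ : ContDiff ℝ ∞ χ) (hcs : HasCompactSupport χ) (hsub : tsupport χ ⊆ U)
    (hF : ContDiffOn ℝ 1 F U) (k : Fin (d + 1)) :
    ∫ y, χ y * pd k F y = -∫ y, pd k χ y * F y := by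
  have hFd : ∀ x ∈ U, DifferentiableAt ℝ F x := fun x hx =>
    (hF.differentiableOn (by norm_num)).differentiableAt (hU.mem_nhds hx)
  have hpdχ : Continuous (pd k χ) :=
    (hχ.continuous_fderiv (by simp)).clm_apply continuous_const
  have hpdsub := tsupport_pd_subset k χ
  have hpdcs : HasCompactSupport (pd k χ) := hcs.of_isClosed_subset (isClosed_tsupport _) hpdsub
  have hpdF : ContinuousOn (pd k F) U :=
    ((contDiffOn_pd (n := 1) (m := 0) hU hF (by norm_num) k)).continuousOn
  exact integral_bilinear_hasLineDerivAt_right_eq_neg_left_of_integrable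
    (B := ContinuousLinearMap.mul ℝ ℝ)
    (integrable_mul_of_tsupport_subset hU hpdχ hpdcs (hpdsub.trans hsub) hF.continuousOn)
    (integrable_mul_of_tsupport_subset hU hχ.continuous hcs hsub hpdF)
    (integrable_mul_of_tsupport_subset hU hχ.continuous hcs hsub hF.continuousOn)
    (fun x _ => HasPD.of_differentiableAt (hχ.differentiable (by simp) x) k)
    (fun x hx => HasPD.of_differentiableAt (hFd x (hsub hx)) k)

end Cutoffs

/-! ### The integrated estimate for one cutoff function. -/

section CutoffEstimate

open Filter Topology

variable {d : ℕ}

/-- The weighted operator `e^{τψ} (-a_{ij} D_{ij} v + b_i D_i v + c v)`. -/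
def weightedOp (τ s : ℝ) (a : Fin (d + 1) → Fin (d + 1) → E d → ℝ) (b : Fin (d + 1) → E d → ℝ)
    (c v : E d → ℝ) (y : E d) : ℝ :=
  wt τ s y * (-(∑ i, ∑ j, a i j y * pd i (pd j v) y) + ∑ i, b i y * pd i v y + c y * v y)

theorem pd_comm_of_contDiffOn {U : Set (E d)} (hU : IsOpen U) {v : E d → ℝ}
    (hv : ContDiffOn ℝ 2 v U) {y : E d} (hy : y ∈ U) (i k : Fin (d + 1)) :
    pd k (pd i v) y = pd i (pd k v) y := by
  have hat : ContDiffAt ℝ 2 v y := hv.contDiffAt (hU.mem_nhds hy)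
  have hs := hat.isSymmSndFDerivAt (by simp)
  have hd : DifferentiableAt ℝ (fderiv ℝ v) y :=
    (hat.fderiv_right (m := 1) (by norm_num)).differentiableAt (by norm_num)
  have key : ∀ i k : Fin (d + 1), pd k (pd i v) y =
      fderiv ℝ (fderiv ℝ v) y (EuclideanSpace.single k 1) (EuclideanSpace.single i 1) := by
    intro i k
    have h1 : HasFDerivAt (pd i v) _ y :=
      hd.hasFDerivAt.clm_apply (hasFDerivAt_const (EuclideanSpace.single i (1 : ℝ)) y)
    rw [pd, h1.fderiv]
    simp
  rw [key, key]
  exact hs.eq _ _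

theorem continuousOn_density {U : Set (E d)} (hU : IsOpen U) {v : E d → ℝ}
    (hv : ContDiffOn ℝ 2 v U) (τ s : ℝ) : ContinuousOn (density τ s v) U := by
  have hdv : ∀ i, ContinuousOn (pd i v) U := fun i =>
    (contDiffOn_pd (n := 2) (m := 1) hU hv (by norm_num) i).continuousOn
  have hσ : ContinuousOn (sig τ s : E d → ℝ) U := (contDiff_sig τ s).continuous.continuousOn
  have hw : ContinuousOn (wt τ s : E d → ℝ) U := (contDiff_wt τ s).continuous.continuousOn
  exact (hσ.mul (continuousOn_finsetSum _ fun i _ => (hw.mul (hdv i)).pow 2)).add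
    ((hσ.pow 3).mul ((hw.mul hv.continuousOn).pow 2))

theorem continuousOn_pd_pd {U : Set (E d)} (hU : IsOpen U) {v : E d → ℝ}
    (hv : ContDiffOn ℝ 2 v U) (i j : Fin (d + 1)) : ContinuousOn (pd i (pd j v)) U :=
  (contDiffOn_pd (n := 1) (m := 0) hU (contDiffOn_pd (n := 2) (m := 1) hU hv (by norm_num) j)
    (by norm_num) i).continuousOn

/-- The hypotheses on the parameters in the Carleman estimate. -/
structure Admissible (d : ℕ) (θ M ν ε s τ Kb Kc : ℝ) : Prop where
  θ_nonneg : 0 ≤ θ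
  M_nonneg : 0 ≤ M
  s_nonneg : 0 ≤ s
  Kb_nonneg : 0 ≤ Kb
  Kc_nonneg : 0 ≤ Kc
  ε_le : ε ≤ 1
  sig_nonneg : ∀ y ∈ halfBall d, 0 ≤ sig τ s y
  one_le : ∀ y ∈ halfBall d, 1 ≤ sig τ s y * ε
  ν_le : ν ≤ θ / 4 * θ
  ν_le' : ν ≤ θ / 4 * (θ / 4)
  coeff_le : 2 * coeffError ((d + 1 : ℕ) : ℝ) (coeffBound d M) ≤ s * ν
  small_le : (2 * smallError ((d + 1 : ℕ) : ℝ) (coeffBound d M) s +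
      2 * remainderConst ((d + 1 : ℕ) : ℝ) (coeffBound d M) s ^ 2) * ε ≤ s * ν / 2
  Kb_le : ∀ y ∈ halfBall d, (1 + (s + 2) * ((d + 1 : ℕ) : ℝ)) * Kb ≤ ε * sig τ s y
  Kc_le : ∀ y ∈ halfBall d, (1 + (s + 2) * ((d + 1 : ℕ) : ℝ)) * Kc ≤ ε * sig τ s y ^ 2

/-- The constant in front of the boundary terms. -/
def layerConst (d : ℕ) (M s : ℝ) : ℝ :=
  fluxConst ((d + 1 : ℕ) : ℝ) (coeffBound d M) s * (2 * ((d + 1 : ℕ) : ℝ) + 2)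

/-- The constant in the lower bound. -/
def lowerConst (d : ℕ) (s ν : ℝ) : ℝ := s * ν / 2 / (2 * ((d + 1 : ℕ) : ℝ) + 2)

section Cutoff

variable {θ M ν ε s τ Kb Kc : ℝ} {a : Fin (d + 1) → Fin (d + 1) → E d → ℝ}
  {b : Fin (d + 1) → E d → ℝ} {c v χ : E d → ℝ}

/-- Multiply the pointwise inequality by χ, integrate, move the derivative from the flux to χ, and
bound the flux by the density. The bounds on b and c are asked only on the support of χ, because
mollifications have them only away from the boundary. -/
theorem cutoff_estimate_of_smooth (hadm : Admissible d θ M ν ε s τ Kb Kc)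
    (hsym : ∀ i j, a i j = a j i) (ha : C1NormLE (halfBall d) a M)
    (hell : UniformlyElliptic (halfBall d) a θ)
    (hb : ∀ i, ContDiff ℝ ∞ (b i)) (hc : ContDiff ℝ ∞ c)
    (hv : ContDiffOn ℝ 2 v (halfBall d)) (hχ : ContDiff ℝ ∞ χ) (hχ0 : ∀ y, 0 ≤ χ y)
    (hcs : HasCompactSupport χ) (hsub : tsupport χ ⊆ halfBall d)
    (hbK : ∀ y ∈ tsupport χ, ∀ i, |b i y| ≤ Kb ∧ ∀ k, |pd k (b i) y| ≤ Kb)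
    (hcK : ∀ y ∈ tsupport χ, |c y| ≤ Kc ∧ ∀ k, |pd k c y| ≤ Kc) :
    lowerConst d s ν * (∫ y, χ y * density τ s v y) ≤
      (∫ y, χ y * weightedOp τ s a b c v y ^ 2) +
        2 * layerConst d M s * ∫ y, (∑ k, |pd k χ y|) * density τ s v y := by
  have hU := isOpen_halfBall (d := d)
  have haC : ∀ i j, ContDiffOn ℝ 1 (a i j) (halfBall d) := fun i j => (ha i j).1
  have hbC : ∀ i, ContDiffOn ℝ 1 (b i) (halfBall d) := fun i =>
    ((hb i).of_le (by exact_mod_cast le_top)).contDiffOn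
  have hcC : ContDiffOn ℝ 1 c (halfBall d) := (hc.of_le (by exact_mod_cast le_top)).contDiffOn
  have hflux : ∀ k, ContDiffOn ℝ 1 (flux τ s a b c v k) (halfBall d) :=
    fun k => contDiffOn_flux hU haC hbC hcC hv k
  have hdiff : ∀ {f : E d → ℝ}, ContDiffOn ℝ 1 f (halfBall d) → ∀ y ∈ halfBall d,
      DifferentiableAt ℝ f y := fun hf y hy =>
    (hf.differentiableOn (by norm_num)).differentiableAt (hU.mem_nhds hy)
  have hpt : ∀ y ∈ tsupport χ,
      lowerConst d s ν * density τ s v y + 2 * ∑ k, pd k (flux τ s a b c v k) y ≤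
        weightedOp τ s a b c v y ^ 2 ∧
      ∀ k, |flux τ s a b c v k y| ≤ layerConst d M s * density τ s v y := by
    intro y hy
    have hyU := hsub hy
    have hD : 0 ≤ 1 + (s + 2) * ((d + 1 : ℕ) : ℝ) := by
      have := hadm.s_nonneg
      positivity
    have hmul : ∀ {x K t : ℝ}, |x| ≤ K → (1 + (s + 2) * ((d + 1 : ℕ) : ℝ)) * K ≤ t →
        (1 + (s + 2) * ((d + 1 : ℕ) : ℝ)) * |x| ≤ t := fun hx ht =>
      (mul_le_mul_of_nonneg_left hx hD).trans ht
    refine carleman_pointwise hadm.θ_nonneg hadm.M_nonneg hadm.s_nonneg hadm.ε_le hyU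
      (hadm.one_le y hyU) (hadm.sig_nonneg y hyU) hadm.ν_le hadm.ν_le' hadm.coeff_le
      hadm.small_le (fun i j => by rw [hsym i j]) (fun i j => hdiff (haC i j) y hyU)
      (fun i => hdiff (hbC i) y hyU) (hdiff hcC y hyU)
      (hdiff (hv.of_le (by norm_num)) y hyU)
      (fun i => hdiff (contDiffOn_pd (n := 2) (m := 1) hU hv (by norm_num) i) y hyU)
      (fun i k => pd_comm_of_contDiffOn hU hv hyU i k)
      (fun i j => ((ha i j).2 y hyU).1) (fun k i j => ?_) (hell y hyU)
      (fun i => hmul (hbK y hy i).1 (hadm.Kb_le y hyU))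
      (fun k i => hmul ((hbK y hy i).2 k) (hadm.Kb_le y hyU))
      (hmul (hcK y hy).1 (hadm.Kc_le y hyU)) (fun k => hmul ((hcK y hy).2 k) (hadm.Kc_le y hyU))
      (fun k => hdiff (hflux k) y hyU)
    have h1 := ((ha i j).2 y hyU).2 k
    rwa [partialWithin, fderivWithin_of_isOpen hU hyU] at h1
  have hdens := continuousOn_density hU hv τ s
  have hop : ContinuousOn (weightedOp τ s a b c v) (halfBall d) := by
    have hw : ContinuousOn (wt τ s : E d → ℝ) (halfBall d) :=
      (contDiff_wt τ s).continuous.continuousOn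
    exact hw.mul (((continuousOn_finsetSum _ fun i _ => continuousOn_finsetSum _ fun j _ =>
      (haC i j).continuousOn.mul (continuousOn_pd_pd hU hv i j)).neg.add
      (continuousOn_finsetSum _ fun i _ => (hbC i).continuousOn.mul
        (contDiffOn_pd (n := 2) (m := 1) hU hv (by norm_num) i).continuousOn)).add
      (hcC.continuousOn.mul hv.continuousOn))
  have hInteg : ∀ {g : E d → ℝ}, ContinuousOn g (halfBall d) → Integrable fun y => χ y * g y :=
    fun hg => integrable_mul_of_tsupport_subset hU hχ.continuous hcs hsub hg
  have hpdsub : ∀ k, tsupport (pd k χ) ⊆ tsupport χ := fun k => tsupport_pd_subset k χ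
  have hpdint : ∀ (k : Fin (d + 1)) {g : E d → ℝ}, ContinuousOn g (halfBall d) →
      Integrable fun y => pd k χ y * g y := fun k g hg =>
    integrable_mul_of_tsupport_subset hU
      ((hχ.continuous_fderiv (by simp)).clm_apply continuous_const)
      (hcs.of_isClosed_subset (isClosed_tsupport _) (hpdsub k)) ((hpdsub k).trans hsub) hg
  have hpdF : ∀ k, ContinuousOn (pd k (flux τ s a b c v k)) (halfBall d) := fun k =>
    (contDiffOn_pd (n := 1) (m := 0) hU (hflux k) (by norm_num) k).continuousOn
  have habsint : ∀ k, Integrable fun y => |pd k χ y| * density τ s v y := fun k => by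
    refine (hpdint k hdens).abs.congr (Eventually.of_forall fun y => ?_)
    by_cases hy : y ∈ tsupport χ
    · have hd0 : 0 ≤ density τ s v y := by
        have := hadm.sig_nonneg y (hsub hy)
        unfold density
        exact add_nonneg (mul_nonneg this (Finset.sum_nonneg fun i _ => sq_nonneg _))
          (mul_nonneg (pow_nonneg this 3) (sq_nonneg _))
      simp only [abs_mul, abs_of_nonneg hd0]
    · have : pd k χ y = 0 := image_eq_zero_of_notMem_tsupport fun hcon => hy (hpdsub k hcon)
      simp [this]
  have h1 : lowerConst d s ν * (∫ y, χ y * density τ s v y) +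
      2 * ∑ k, ∫ y, χ y * pd k (flux τ s a b c v k) y ≤
      ∫ y, χ y * weightedOp τ s a b c v y ^ 2 := by
    rw [← integral_const_mul, ← integral_finsetSum _ fun k _ => hInteg (hpdF k),
      ← integral_const_mul, ← integral_add ((hInteg hdens).const_mul _)
      ((integrable_finsetSum _ fun k _ => hInteg (hpdF k)).const_mul _)]
    refine integral_mono (((hInteg hdens).const_mul _).add
      ((integrable_finsetSum _ fun k _ => hInteg (hpdF k)).const_mul _)) (hInteg (hop.pow 2)) ?_
    intro y
    by_cases hy : y ∈ tsupport χ
    · have := mul_le_mul_of_nonneg_left (hpt y hy).1 (hχ0 y)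
      simp only [← Finset.mul_sum]
      linarith
    · simp [image_eq_zero_of_notMem_tsupport hy]
  have h2 : ∀ k, -(layerConst d M s * ∫ y, |pd k χ y| * density τ s v y) ≤
      ∫ y, χ y * pd k (flux τ s a b c v k) y := fun k => by
    rw [integral_cutoff_mul_pd hU hχ hcs hsub (hflux k) k, neg_le_neg_iff, ← integral_const_mul]
    refine integral_mono (hpdint k (hflux k).continuousOn) ((habsint k).const_mul _) fun y => ?_
    by_cases hy : y ∈ tsupport χ
    · refine (le_abs_self _).trans ?_
      have h3 := mul_le_mul_of_nonneg_left ((hpt y hy).2 k) (abs_nonneg (pd k χ y))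
      simp only [abs_mul]
      linarith
    · have : pd k χ y = 0 := image_eq_zero_of_notMem_tsupport fun hcon => hy (hpdsub k hcon)
      simp [this]
  have h3 : ∫ y, (∑ k, |pd k χ y|) * density τ s v y =
      ∑ k, ∫ y, |pd k χ y| * density τ s v y := by
    rw [← integral_finsetSum _ fun k _ => habsint k]
    simp only [Finset.sum_mul]
  have h4 := Finset.sum_le_sum fun (k : Fin (d + 1)) (_ : k ∈ Finset.univ) => h2 k
  rw [Finset.sum_neg_distrib, ← Finset.mul_sum] at h4
  rw [h3]
  linarith

/-- The inequality for the mollified coefficients contains their values but not their derivatives,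
and its constants depend only on the common bounds. Dominated convergence on the compact support of
χ therefore passes to the limit. -/
theorem cutoff_estimate (hadm : Admissible d θ M ν ε s τ Kb Kc)
    (hsym : ∀ i j, a i j = a j i) (ha : C1NormLE (halfBall d) a M)
    (hell : UniformlyElliptic (halfBall d) a θ)
    (hb : ∀ i, W1InftyNormLE (halfBall d) (b i) Kb) (hc : W1InftyNormLE (halfBall d) c Kc)
    (hv : ContDiffOn ℝ 2 v (halfBall d)) (hχ : ContDiff ℝ ∞ χ) (hχ0 : ∀ y, 0 ≤ χ y)
    (hcs : HasCompactSupport χ) (hsub : tsupport χ ⊆ halfBall d) :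
    lowerConst d s ν * (∫ y, χ y * density τ s v y) ≤
      (∫ y, χ y * weightedOp τ s a b c v y ^ 2) +
        2 * layerConst d M s * ∫ y, (∑ k, |pd k χ y|) * density τ s v y := by
  have hU := isOpen_halfBall (d := d)
  have haC : ∀ i j, ContDiffOn ℝ 1 (a i j) (halfBall d) := fun i j => (ha i j).1
  choose bm hbm hbt hbK using fun i => (hb i).exists_smooth_approx hU hadm.Kb_nonneg
  obtain ⟨cm, hcm, hct, hcK⟩ := hc.exists_smooth_approx hU hadm.Kc_nonneg
  obtain ⟨δ, hδ, hthick⟩ := hcs.isCompact.exists_cthickening_subset_open hU hsub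
  have hball : ∀ᶠ m : ℕ in atTop, ∀ y ∈ tsupport χ,
      Metric.closedBall y (1 / ((m : ℝ) + 1)) ⊆ halfBall d := by
    filter_upwards [(tendsto_one_div_add_atTop_nhds_zero_nat (𝕜 := ℝ)).eventually
      (Iio_mem_nhds hδ)] with m hm y hy
    exact (Metric.closedBall_subset_closedBall (le_of_lt hm)).trans
      ((Metric.closedBall_subset_cthickening hy δ).trans hthick)
  have hev : ∀ᶠ m in atTop, lowerConst d s ν * (∫ y, χ y * density τ s v y) ≤
      (∫ y, χ y * weightedOp τ s a (fun i => bm i m) (cm m) v y ^ 2) +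
        2 * layerConst d M s * ∫ y, (∑ k, |pd k χ y|) * density τ s v y := by
    filter_upwards [hball] with m hm
    exact cutoff_estimate_of_smooth hadm hsym ha hell (fun i => hbm i m) (hcm m) hv hχ hχ0 hcs hsub
      (fun y hy i => hbK i m y (hm y hy)) (fun y hy => hcK m y (hm y hy))
  have hpdv : ∀ i, ContinuousOn (pd i v) (halfBall d) := fun i =>
    (contDiffOn_pd (n := 2) (m := 1) hU hv (by norm_num) i).continuousOn
  have hw : ContinuousOn (wt τ s : E d → ℝ) (halfBall d) :=
    (contDiff_wt τ s).continuous.continuousOn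
  have hmain : ContinuousOn (fun y => ∑ i, ∑ j, a i j y * pd i (pd j v) y) (halfBall d) :=
    continuousOn_finsetSum _ fun i _ => continuousOn_finsetSum _ fun j _ =>
      (haC i j).continuousOn.mul (continuousOn_pd_pd hU hv i j)
  have hlim : Tendsto (fun m => ∫ y, χ y * weightedOp τ s a (fun i => bm i m) (cm m) v y ^ 2)
      atTop (𝓝 (∫ y, χ y * weightedOp τ s a b c v y ^ 2)) := by
    refine tendsto_integral_filter_of_dominated_convergence
      (fun y => χ y * (wt τ s y * (|∑ i, ∑ j, a i j y * pd i (pd j v) y| +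
        ∑ i, Kb * |pd i v y| + Kc * |v y|)) ^ 2) ?_ ?_ ?_ ?_
    · refine Eventually.of_forall fun m => Integrable.aestronglyMeasurable ?_
      refine integrable_mul_of_tsupport_subset hU hχ.continuous hcs hsub ?_
      exact (hw.mul ((hmain.neg.add (continuousOn_finsetSum _ fun i _ =>
        (hbm i m).continuous.continuousOn.mul (hpdv i))).add
          ((hcm m).continuous.continuousOn.mul hv.continuousOn))).pow 2
    · filter_upwards [hball] with m hm
      refine Eventually.of_forall fun y => ?_
      by_cases hy : y ∈ tsupport χ
      · rw [Real.norm_eq_abs, abs_mul, abs_of_nonneg (hχ0 y), abs_pow, weightedOp, abs_mul,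
          abs_of_pos (wt_pos τ s y)]
        refine mul_le_mul_of_nonneg_left (pow_le_pow_left₀
          (mul_nonneg (wt_pos τ s y).le (abs_nonneg _))
          (mul_le_mul_of_nonneg_left ?_ (wt_pos τ s y).le) 2) (hχ0 y)
        refine (abs_add_le _ _).trans (add_le_add ((abs_add_le _ _).trans (add_le_add ?_ ?_)) ?_)
        · rw [abs_neg]
        · refine (Finset.abs_sum_le_sum_abs _ _).trans (Finset.sum_le_sum fun i _ => ?_)
          exact abs_mul_le_mul_of_abs_le (hbK i m y (hm y hy)).1 le_rfl
        · exact abs_mul_le_mul_of_abs_le (hcK m y (hm y hy)).1 le_rfl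
      · simp [image_eq_zero_of_notMem_tsupport hy]
    · refine integrable_mul_of_tsupport_subset hU hχ.continuous hcs hsub ?_
      exact (hw.mul ((hmain.abs.add (continuousOn_finsetSum _ fun i _ =>
        continuousOn_const.mul (hpdv i).abs)).add
          (continuousOn_const.mul hv.continuousOn.abs))).pow 2
    · have hae : ∀ᵐ y ∂(volume : Measure (E d)), y ∈ halfBall d →
          (∀ i, Tendsto (fun m => bm i m y) atTop (𝓝 (b i y))) ∧
            Tendsto (fun m => cm m y) atTop (𝓝 (c y)) := by
        rw [← ae_restrict_iff' hU.measurableSet]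
        filter_upwards [ae_all_iff.2 hbt, hct] with y h1 h2 using ⟨h1, h2⟩
      filter_upwards [hae] with y hy
      by_cases hyU : y ∈ tsupport χ
      · obtain ⟨h1, h2⟩ := hy (hsub hyU)
        refine tendsto_const_nhds.mul (Tendsto.pow (tendsto_const_nhds.mul
          ((tendsto_const_nhds.add (tendsto_finsetSum _ fun i _ =>
            (h1 i).mul tendsto_const_nhds)).add (h2.mul tendsto_const_nhds))) 2)
      · simp [image_eq_zero_of_notMem_tsupport hyU]
  exact ge_of_tendsto (hlim.add_const _) hev

end Cutoff

end CutoffEstimate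

/-! ### Shrinking the boundary layers. -/

section LayerLimit

open Filter Topology

variable {d : ℕ}

/-- Without integrability the Bochner integral is zero, so this direction is free; it lets the
right-hand sides be bounded with no integrability proof. -/
theorem ofReal_integral_le_lintegral {α : Type*} [MeasurableSpace α] {μ : Measure α} {f : α → ℝ}
    (hf : ∀ x, 0 ≤ f x) : ENNReal.ofReal (∫ x, f x ∂μ) ≤ ∫⁻ x, ENNReal.ofReal (f x) ∂μ := by
  by_cases hi : Integrable f μ
  · exact (ofReal_integral_eq_lintegral_ofReal hi (Eventually.of_forall hf)).le
  · rw [integral_undef hi, ENNReal.ofReal_zero]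
    exact zero_le

theorem density_nonneg {τ s : ℝ} {v : E d → ℝ} {y : E d} (h : 0 ≤ sig τ s y) :
    0 ≤ density τ s v y :=
  add_nonneg (mul_nonneg h (Finset.sum_nonneg fun _ _ => sq_nonneg _))
    (mul_nonneg (pow_nonneg h 3) (sq_nonneg _))

theorem layerConst_nonneg {M s : ℝ} (hM : 0 ≤ M) (hs : 0 ≤ s) : 0 ≤ layerConst d M s := by
  unfold layerConst fluxConst coeffBound
  positivity

section Limit

variable {θ M ν ε s τ Kb Kc : ℝ} {a : Fin (d + 1) → Fin (d + 1) → E d → ℝ}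
  {b : Fin (d + 1) → E d → ℝ} {c v G : E d → ℝ}

/-- The estimate for one cutoff function, in terms of lower integrals. -/
theorem cutoff_lintegral_estimate {C r : ℝ} (hadm : Admissible d θ M ν ε s τ Kb Kc)
    (hν : 0 ≤ ν)
    (hsym : ∀ i j, a i j = a j i) (ha : C1NormLE (halfBall d) a M)
    (hell : UniformlyElliptic (halfBall d) a θ)
    (hb : ∀ i, W1InftyNormLE (halfBall d) (b i) Kb) (hc : W1InftyNormLE (halfBall d) c Kc)
    (hv : ContDiffOn ℝ 2 v (halfBall d)) (hG : ∀ y ∈ halfBall d, G y = density τ s v y)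
    (hGc : Continuous G)
    (hC : ∀ t, |deriv Real.smoothTransition t| ≤ C) (hr : 0 < r) :
    ENNReal.ofReal (lowerConst d s ν) *
        ∫⁻ y in halfBall d, ENNReal.ofReal (cutoff r y * density τ s v y) ≤
      (∫⁻ y in halfBall d, ENNReal.ofReal (weightedOp τ s a b c v y ^ 2)) +
        ENNReal.ofReal (2 * layerConst d M s) * (ENNReal.ofReal (((d + 1 : ℕ) : ℝ) * (C / r)) *
          ((∫⁻ y in halfBall d ∩ {y | y (Fin.last d) ≤ 2 * r}, ENNReal.ofReal (G y)) +
            ∫⁻ y in halfBall d ∩ {y | 1 / 4 - ‖y‖ ^ 2 ≤ 2 * r}, ENNReal.ofReal (G y))) := by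
  have hU := isOpen_halfBall (d := d)
  have hsub := tsupport_cutoff_subset_halfBall (d := d) hr
  have hC0 : 0 ≤ C := (abs_nonneg _).trans (hC 0)
  have hlow : 0 ≤ lowerConst d s ν := by
    have := hadm.s_nonneg
    unfold lowerConst
    positivity
  have hlay : 0 ≤ 2 * layerConst d M s :=
    mul_nonneg two_pos.le (layerConst_nonneg hadm.M_nonneg hadm.s_nonneg)
  have hoff : ∀ y ∉ halfBall d, cutoff r y = 0 := fun y hy =>
    image_eq_zero_of_notMem_tsupport fun hcon => hy (hsub hcon)
  have hoff' : ∀ y ∉ halfBall d, ∀ k, pd k (cutoff r) y = 0 := fun y hy k =>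
    image_eq_zero_of_notMem_tsupport fun hcon => hy (hsub (tsupport_pd_subset k _ hcon))
  have hdens : ∀ y ∈ halfBall d, 0 ≤ density τ s v y := fun y hy =>
    density_nonneg (hadm.sig_nonneg y hy)
  have h0 : ∀ y, 0 ≤ cutoff r y * density τ s v y := fun y => by
    by_cases hy : y ∈ halfBall d
    · exact mul_nonneg (cutoff_nonneg r y) (hdens y hy)
    · rw [hoff y hy, zero_mul]
  have h0' : ∀ y, 0 ≤ (∑ k, |pd k (cutoff r) y|) * density τ s v y := fun y => by
    by_cases hy : y ∈ halfBall d
    · exact mul_nonneg (Finset.sum_nonneg fun k _ => abs_nonneg _) (hdens y hy)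
    · simp [hoff' y hy]
  have hest := cutoff_estimate hadm hsym ha hell hb hc hv (contDiff_cutoff r) (cutoff_nonneg r)
    (hasCompactSupport_cutoff hr) hsub
  have hInteg : Integrable fun y => cutoff r y * density τ s v y :=
    integrable_mul_of_tsupport_subset hU (contDiff_cutoff r).continuous
      (hasCompactSupport_cutoff hr) hsub (continuousOn_density hU hv τ s)
  have e1 : ∫⁻ y in halfBall d, ENNReal.ofReal (cutoff r y * density τ s v y) ≤
      ENNReal.ofReal (∫ y, cutoff r y * density τ s v y) := by
    rw [ofReal_integral_eq_lintegral_ofReal hInteg (Eventually.of_forall h0)]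
    exact setLIntegral_le_lintegral _ _
  have e2 : ENNReal.ofReal (∫ y, cutoff r y * weightedOp τ s a b c v y ^ 2) ≤
      ∫⁻ y in halfBall d, ENNReal.ofReal (weightedOp τ s a b c v y ^ 2) := by
    refine (ofReal_integral_le_lintegral fun y =>
      mul_nonneg (cutoff_nonneg r y) (sq_nonneg _)).trans ?_
    rw [← lintegral_indicator hU.measurableSet]
    refine lintegral_mono fun y => ?_
    by_cases hy : y ∈ halfBall d
    · rw [Set.indicator_of_mem hy]
      exact ENNReal.ofReal_le_ofReal (mul_le_of_le_one_left (sq_nonneg _) (cutoff_le_one r y))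
    · simp [hoff y hy]
  have hS1 : MeasurableSet (halfBall d ∩ {y | y (Fin.last d) ≤ 2 * r}) :=
    hU.measurableSet.inter (isClosed_le
      (EuclideanSpace.proj (𝕜 := ℝ) (Fin.last d)).continuous continuous_const).measurableSet
  have hS2 : MeasurableSet (halfBall d ∩ {y | 1 / 4 - ‖y‖ ^ 2 ≤ 2 * r}) :=
    hU.measurableSet.inter (isClosed_le (by fun_prop) continuous_const).measurableSet
  have hGm : Measurable fun y : E d => ENNReal.ofReal (G y) := hGc.measurable.ennreal_ofReal
  have e3 : ENNReal.ofReal (∫ y, (∑ k, |pd k (cutoff r) y|) * density τ s v y) ≤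
      ENNReal.ofReal (((d + 1 : ℕ) : ℝ) * (C / r)) *
          ((∫⁻ y in halfBall d ∩ {y | y (Fin.last d) ≤ 2 * r}, ENNReal.ofReal (G y)) +
            ∫⁻ y in halfBall d ∩ {y | 1 / 4 - ‖y‖ ^ 2 ≤ 2 * r}, ENNReal.ofReal (G y)) := by
    refine (ofReal_integral_le_lintegral h0').trans ?_
    rw [← lintegral_indicator hS1, ← lintegral_indicator hS2,
      ← lintegral_add_left (hGm.indicator hS1),
      ← lintegral_const_mul' _ _ ENNReal.ofReal_ne_top]
    refine lintegral_mono fun y => ?_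
    by_cases hy : y ∈ halfBall d
    · have hk : ∑ k, |pd k (cutoff r) y| ≤ ((d + 1 : ℕ) : ℝ) * (C / r *
          (Set.indicator {y : E d | y (Fin.last d) ≤ 2 * r} 1 y +
          Set.indicator {y : E d | 1 / 4 - ‖y‖ ^ 2 ≤ 2 * r} 1 y)) := by
        refine (Finset.sum_le_sum fun k _ => abs_pd_cutoff_le hC hr hy k).trans_eq ?_
        simp
      have hk' := mul_le_mul_of_nonneg_right hk (hdens y hy)
      refine (ENNReal.ofReal_le_ofReal hk').trans ?_
      rw [← hG y hy, ← mul_assoc, mul_assoc _ _ (G y), ENNReal.ofReal_mul (by positivity)]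
      gcongr
      rw [add_mul]
      refine ENNReal.ofReal_add_le.trans (add_le_add (le_of_eq ?_) (le_of_eq ?_))
      · by_cases hy1 : y (Fin.last d) ≤ 2 * r
        · rw [Set.indicator_of_mem (show y ∈ {y : E d | y (Fin.last d) ≤ 2 * r} from hy1),
            Set.indicator_of_mem (show y ∈ halfBall d ∩ {y : E d | y (Fin.last d) ≤ 2 * r} from
              ⟨hy, hy1⟩)]
          simp
        · rw [Set.indicator_of_notMem (show y ∉ {y : E d | y (Fin.last d) ≤ 2 * r} from hy1),
            Set.indicator_of_notMem (show y ∉ halfBall d ∩ {y : E d | y (Fin.last d) ≤ 2 * r} from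
              fun h => hy1 h.2)]
          simp
      · by_cases hy1 : 1 / 4 - ‖y‖ ^ 2 ≤ 2 * r
        · rw [Set.indicator_of_mem (show y ∈ {y : E d | 1 / 4 - ‖y‖ ^ 2 ≤ 2 * r} from hy1),
            Set.indicator_of_mem (show y ∈ halfBall d ∩ {y : E d | 1 / 4 - ‖y‖ ^ 2 ≤ 2 * r} from
              ⟨hy, hy1⟩)]
          simp
        · rw [Set.indicator_of_notMem (show y ∉ {y : E d | 1 / 4 - ‖y‖ ^ 2 ≤ 2 * r} from hy1),
            Set.indicator_of_notMem
              (show y ∉ halfBall d ∩ {y : E d | 1 / 4 - ‖y‖ ^ 2 ≤ 2 * r} from fun h => hy1 h.2)]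
          simp
    · simp [hoff' y hy]
  calc _ ≤ ENNReal.ofReal (lowerConst d s ν) *
        ENNReal.ofReal (∫ y, cutoff r y * density τ s v y) := by gcongr
    _ = ENNReal.ofReal (lowerConst d s ν * ∫ y, cutoff r y * density τ s v y) :=
        (ENNReal.ofReal_mul hlow).symm
    _ ≤ _ := ENNReal.ofReal_le_ofReal hest
    _ ≤ _ := ENNReal.ofReal_add_le
    _ ≤ _ := by
        rw [ENNReal.ofReal_mul hlay]
        gcongr

/-- The estimate up to the boundary, in terms of lower integrals. -/
theorem carleman_lintegral_estimate {C : ℝ} (hadm : Admissible d θ M ν ε s τ Kb Kc)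
    (hν : 0 ≤ ν)
    (hsym : ∀ i j, a i j = a j i) (ha : C1NormLE (halfBall d) a M)
    (hell : UniformlyElliptic (halfBall d) a θ)
    (hb : ∀ i, W1InftyNormLE (halfBall d) (b i) Kb) (hc : W1InftyNormLE (halfBall d) c Kc)
    (hv : ContDiffOn ℝ 2 v (halfBall d)) (hG : ∀ y ∈ halfBall d, G y = density τ s v y)
    (hGc : Continuous G) (hC : ∀ t, |deriv Real.smoothTransition t| ≤ C) :
    ENNReal.ofReal (lowerConst d s ν) * ∫⁻ y in halfBall d, ENNReal.ofReal (density τ s v y) ≤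
      (∫⁻ y in halfBall d, ENNReal.ofReal (weightedOp τ s a b c v y ^ 2)) +
        ENNReal.ofReal (8 * layerConst d M s * ((d + 1 : ℕ) : ℝ) * C) *
          ∫⁻ y, ENNReal.ofReal (G y) ∂boundaryMeasure d := by
  have hU := isOpen_halfBall (d := d)
  have hC0 : 0 ≤ C := (abs_nonneg _).trans (hC 0)
  have hlay : 0 ≤ layerConst d M s := layerConst_nonneg hadm.M_nonneg hadm.s_nonneg
  set I := ∫⁻ y in halfBall d, ENNReal.ofReal (weightedOp τ s a b c v y ^ 2) with hI
  set A := ∫⁻ y, ENNReal.ofReal (G y) ∂boundaryMeasure d with hA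
  set V : ℝ≥0∞ := volume (Metric.ball (0 : EuclideanSpace ℝ (Fin d)) (1 / 2)) +
    ENNReal.ofReal ((1 / 2 : ℝ) ^ d) *
      (volume : Measure (E d)).toSphere {p | 0 < (p : E d) (Fin.last d)} with hV
  have hVtop : V ≠ ⊤ := ENNReal.add_ne_top.2 ⟨measure_ball_lt_top.ne,
    ENNReal.mul_ne_top ENNReal.ofReal_ne_top (measure_ne_top _ _)⟩
  set B := ENNReal.ofReal (8 * layerConst d M s * ((d + 1 : ℕ) : ℝ) * C) with hB
  have hlayer : ∀ η : ℝ, 0 < η → ∀ᶠ r in 𝓝[>] (0 : ℝ),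
      ENNReal.ofReal (lowerConst d s ν) *
        ∫⁻ y in halfBall d, ENNReal.ofReal (cutoff r y * density τ s v y) ≤
      I + B * (A + ENNReal.ofReal η * V) := by
    intro η hη
    filter_upwards [flat_layer_le hGc hη, cap_layer_le hGc hη, self_mem_nhdsWithin] with r h1 h2 hr
    have hr' : 0 < r := hr
    refine (cutoff_lintegral_estimate hadm hν hsym ha hell hb hc hv hG hGc hC hr').trans ?_
    refine add_le_add le_rfl ?_
    have hAeq : A = (∫⁻ y, ENNReal.ofReal (G y) ∂Measure.map (flatEmbed d)
              (volume.restrict (Metric.ball 0 (1 / 2)))) +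
        ∫⁻ y, ENNReal.ofReal (G y) ∂(ENNReal.ofReal ((1 / 2 : ℝ) ^ d) •
              Measure.map (fun (p : Metric.sphere (0 : E d) 1) => (1 / 2 : ℝ) • (p : E d))
                ((volume : Measure (E d)).toSphere.restrict {p | 0 < (p : E d) (Fin.last d)})) := by
      rw [hA, boundaryMeasure, lintegral_add_measure]
    -- The flat layer has width only 2r, weakened to 4r to share the factor of the cap layer; 4r
    -- against C/r, with the 2 in front of the flux, makes the 8 in B.
    have h3 : (∫⁻ y in halfBall d ∩ {y | y (Fin.last d) ≤ 2 * r}, ENNReal.ofReal (G y)) +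
            ∫⁻ y in halfBall d ∩ {y | 1 / 4 - ‖y‖ ^ 2 ≤ 2 * r}, ENNReal.ofReal (G y) ≤
        ENNReal.ofReal (4 * r) * (A + ENNReal.ofReal η * V) := by
      refine (add_le_add (h1.trans (mul_le_mul_left (ENNReal.ofReal_le_ofReal
        (show 2 * r ≤ 4 * r by linarith)) _)) h2).trans_eq ?_
      rw [hAeq, hV]
      ring
    calc _ ≤ ENNReal.ofReal (2 * layerConst d M s) *
          (ENNReal.ofReal (((d + 1 : ℕ) : ℝ) * (C / r)) *
            (ENNReal.ofReal (4 * r) * (A + ENNReal.ofReal η * V))) := by gcongr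
      _ = B * (A + ENNReal.ofReal η * V) := by
        rw [← mul_assoc, ← mul_assoc, ← ENNReal.ofReal_mul (by positivity),
          ← ENNReal.ofReal_mul (by positivity), hB]
        congr 2
        field_simp
        ring
  have hfatou : ∀ η : ℝ, 0 < η → ENNReal.ofReal (lowerConst d s ν) *
      ∫⁻ y in halfBall d, ENNReal.ofReal (density τ s v y) ≤ I + B * (A + ENNReal.ofReal η * V) := by
    intro η hη
    -- Fatou's lemma is applied along a sequence of widths; at each interior point the cutoffs are
    -- eventually one.
    have hseq : Tendsto (fun j : ℕ => 1 / ((j : ℝ) + 1)) atTop (𝓝[>] 0) :=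
      tendsto_nhdsWithin_iff.2 ⟨tendsto_one_div_add_atTop_nhds_zero_nat,
        Eventually.of_forall fun j => show 0 < 1 / ((j : ℝ) + 1) by positivity⟩
    have hmeas : ∀ j : ℕ, AEMeasurable (fun y => ENNReal.ofReal
        (cutoff (1 / ((j : ℝ) + 1)) y * density τ s v y)) (volume.restrict (halfBall d)) := fun j =>
      (((contDiff_cutoff _).continuous.continuousOn.mul
        (continuousOn_density hU hv τ s)).aemeasurable hU.measurableSet).ennreal_ofReal
    rw [← lintegral_const_mul' _ _ ENNReal.ofReal_ne_top]
    calc _ = ∫⁻ y in halfBall d, liminf (fun j : ℕ => ENNReal.ofReal (lowerConst d s ν) *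
          ENNReal.ofReal (cutoff (1 / ((j : ℝ) + 1)) y * density τ s v y)) atTop := by
          refine setLIntegral_congr_fun hU.measurableSet fun y hy => ?_
          refine (Tendsto.liminf_eq ?_).symm
          refine tendsto_const_nhds.congr' ?_
          filter_upwards [hseq.eventually (eventually_cutoff_eq_one hy)] with j hj
          rw [hj, one_mul]
      _ ≤ liminf (fun j : ℕ => ∫⁻ y in halfBall d, ENNReal.ofReal (lowerConst d s ν) *
          ENNReal.ofReal (cutoff (1 / ((j : ℝ) + 1)) y * density τ s v y)) atTop :=
          lintegral_liminf_le' fun j => (hmeas j).const_mul _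
      _ ≤ _ := by
          refine liminf_le_of_frequently_le' (Eventually.frequently ?_)
          filter_upwards [hseq.eventually (hlayer η hη)] with j hj
          rwa [lintegral_const_mul' _ _ ENNReal.ofReal_ne_top]
  -- Finiteness of the boundary area V makes the modulus of continuity error disappear, whether or
  -- not A is finite.
  have hlim : Tendsto (fun η : ℝ => I + B * (A + ENNReal.ofReal η * V)) (𝓝[>] 0)
      (𝓝 (I + B * (A + ENNReal.ofReal 0 * V))) := by
    refine tendsto_const_nhds.add (ENNReal.Tendsto.const_mul (tendsto_const_nhds.add
      (ENNReal.Tendsto.mul_const (ENNReal.tendsto_ofReal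
        (tendsto_id.mono_left nhdsWithin_le_nhds)) (Or.inr hVtop))) (Or.inr ENNReal.ofReal_ne_top))
  rw [ENNReal.ofReal_zero, zero_mul, add_zero] at hlim
  exact ge_of_tendsto hlim (by filter_upwards [self_mem_nhdsWithin] with η hη using hfatou η hη)

end Limit

end LayerLimit

/-! ### From the density to the norms of the statement; symmetrisation of the coefficients. -/

section Norms

open Filter Topology

variable {d : ℕ}

theorem convex_closedHalfBall : Convex ℝ (closedHalfBall d) := by
  have h1 : Convex ℝ {y : E d | ‖y‖ ≤ 1 / 2} := by
    simpa [Metric.closedBall, dist_zero_right] using convex_closedBall (0 : E d) (1 / 2)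
  have h2 : Convex ℝ {y : E d | 0 ≤ y (Fin.last d)} :=
    convex_halfSpace_ge (EuclideanSpace.proj (𝕜 := ℝ) (Fin.last d) : E d →L[ℝ] ℝ).isLinear 0
  exact h1.inter h2

theorem halfBall_nonempty : (halfBall d).Nonempty :=
  ⟨EuclideanSpace.single (Fin.last d) (1 / 4), by simp; norm_num, by simp⟩

theorem uniqueDiffOn_closedHalfBall : UniqueDiffOn ℝ (closedHalfBall d) :=
  uniqueDiffOn_convex convex_closedHalfBall (halfBall_nonempty.mono
    (interior_maximal halfBall_subset_closedHalfBall isOpen_halfBall))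

theorem closedHalfBall_mem_nhds {y : E d} (hy : y ∈ halfBall d) : closedHalfBall d ∈ 𝓝 y :=
  mem_of_superset (isOpen_halfBall.mem_nhds hy) halfBall_subset_closedHalfBall

theorem partialWithin_eq_pd {y : E d} (hy : y ∈ halfBall d) (i : Fin (d + 1)) (f : E d → ℝ) :
    partialWithin (closedHalfBall d) i f y = pd i f y := by
  rw [partialWithin, fderivWithin_of_mem_nhds (closedHalfBall_mem_nhds hy), pd]

theorem partialWithin_partialWithin_eq_pd {y : E d} (hy : y ∈ halfBall d) (i j : Fin (d + 1))
    (f : E d → ℝ) :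
    partialWithin (closedHalfBall d) i (partialWithin (closedHalfBall d) j f) y =
      pd i (pd j f) y := by
  rw [partialWithin_eq_pd hy, pd, pd]
  have : partialWithin (closedHalfBall d) j f =ᶠ[𝓝 y] pd j f := by
    filter_upwards [isOpen_halfBall.mem_nhds hy] with z hz using partialWithin_eq_pd hz j f
  rw [this.fderiv_eq]

theorem norm_gradientWithin_sq {y : E d} (hy : y ∈ halfBall d) (v : E d → ℝ) :
    ‖gradientWithin v (closedHalfBall d) y‖ ^ 2 = ∑ i, pd i v y ^ 2 := by
  rw [EuclideanSpace.real_norm_sq_eq]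
  refine Finset.sum_congr rfl fun i _ => ?_
  have h1 : ∀ g : E d, g i = inner ℝ g (EuclideanSpace.single i (1 : ℝ)) := fun g => by
    simp [EuclideanSpace.inner_single_right]
  rw [h1 (gradientWithin v (closedHalfBall d) y), gradientWithin, InnerProductSpace.toDual_symm_apply,
    fderivWithin_of_mem_nhds (closedHalfBall_mem_nhds hy), pd]

/-- The weighted density with one-sided derivatives, on the closed half ball. -/
def closedDensity (τ s : ℝ) (v : E d → ℝ) (y : E d) : ℝ :=
  sig τ s y * (wt τ s y * ‖gradientWithin v (closedHalfBall d) y‖) ^ 2 +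
    sig τ s y ^ 3 * (wt τ s y * v y) ^ 2

theorem closedDensity_eq_density {y : E d} (hy : y ∈ halfBall d) (τ s : ℝ) (v : E d → ℝ) :
    closedDensity τ s v y = density τ s v y := by
  unfold closedDensity density
  rw [mul_pow, norm_gradientWithin_sq hy, Finset.mul_sum]
  simp only [mul_pow]

theorem continuousOn_gradientWithin {v : E d → ℝ} (hv : ContDiffOn ℝ ∞ v (closedHalfBall d)) :
    ContinuousOn (gradientWithin v (closedHalfBall d)) (closedHalfBall d) :=
  (InnerProductSpace.toDual ℝ (E d)).symm.continuous.comp_continuousOn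
    (hv.continuousOn_fderivWithin uniqueDiffOn_closedHalfBall (by exact_mod_cast le_top))

theorem continuousOn_closedDensity {v : E d → ℝ} (hv : ContDiffOn ℝ ∞ v (closedHalfBall d))
    (τ s : ℝ) : ContinuousOn (closedDensity τ s v) (closedHalfBall d) := by
  have hσ : ContinuousOn (sig τ s : E d → ℝ) (closedHalfBall d) :=
    (contDiff_sig τ s).continuous.continuousOn
  have hw : ContinuousOn (wt τ s : E d → ℝ) (closedHalfBall d) :=
    (contDiff_wt τ s).continuous.continuousOn
  exact (hσ.mul ((hw.mul (continuousOn_gradientWithin hv).norm).pow 2)).add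
    ((hσ.pow 3).mul ((hw.mul hv.continuousOn).pow 2))

/-- The function v is controlled only on the closed half ball, so measurability and the values of
extensions under the boundary measure rest on this. -/
theorem ae_boundaryMeasure_mem : ∀ᵐ y ∂boundaryMeasure d, y ∈ closedHalfBall d := by
  rw [boundaryMeasure, ae_add_measure_iff]
  constructor
  · refine (ae_map_iff (p := fun y => y ∈ closedHalfBall d) continuous_flatEmbed.aemeasurable
      isClosed_closedHalfBall.measurableSet).2 ?_
    filter_upwards [ae_restrict_mem measurableSet_ball] with z hz
    refine ⟨?_, (flatEmbed_last z).ge⟩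
    rw [norm_flatEmbed]
    exact (mem_ball_zero_iff.1 hz).le
  · refine Measure.ae_smul_measure ?_ _
    have hcont : Continuous fun (p : Metric.sphere (0 : E d) 1) => (1 / 2 : ℝ) • (p : E d) := by
      fun_prop
    have hcap : MeasurableSet {p : Metric.sphere (0 : E d) 1 | 0 < (p : E d) (Fin.last d)} :=
      (isOpen_lt continuous_const ((EuclideanSpace.proj (𝕜 := ℝ) (Fin.last d)).continuous.comp
        continuous_subtype_val)).measurableSet
    refine (ae_map_iff (p := fun y => y ∈ closedHalfBall d) hcont.aemeasurable
      isClosed_closedHalfBall.measurableSet).2 ?_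
    filter_upwards [ae_restrict_mem hcap] with p hp
    have hp' : 0 < (p : E d) (Fin.last d) := hp
    refine ⟨?_, ?_⟩
    · rw [norm_smul, norm_eq_of_mem_sphere]; norm_num
    · exact (by simpa using hp'.le)

/-- The square of a multiple of an `L²` norm as a lower integral. -/
theorem sq_ofReal_mul_eLpNorm_two {α F : Type*} [MeasurableSpace α] {μ : Measure α}
    [NormedAddCommGroup F] {k : ℝ} (hk : 0 ≤ k) (f : α → F) :
    (ENNReal.ofReal k * eLpNorm f 2 μ) ^ 2 = ∫⁻ y, ENNReal.ofReal (k ^ 2 * ‖f y‖ ^ 2) ∂μ := by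
  have h1 : eLpNorm f 2 μ ^ 2 = ∫⁻ y, ‖f y‖ₑ ^ 2 ∂μ := by
    have := eLpNorm_nnreal_pow_eq_lintegral (f := f) (μ := μ) (p := 2) two_ne_zero
    simpa only [NNReal.coe_ofNat, ENNReal.coe_ofNat, ENNReal.rpow_ofNat] using this
  rw [mul_pow, h1, ← lintegral_const_mul' _ _ (ENNReal.pow_ne_top ENNReal.ofReal_ne_top)]
  refine lintegral_congr fun y => ?_
  rw [ENNReal.ofReal_mul (sq_nonneg k), ENNReal.ofReal_pow hk,
    ENNReal.ofReal_pow (norm_nonneg _), ofReal_norm]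

theorem psi_pos (s : ℝ) (y : E d) : 0 < psi s y := Real.exp_pos _

/-- The squared weight is τ³s⁴ψ³ = s·σ³. The surplus s also appears for the gradient, and it is the
factor in front of the operator term in `carleman_squares`. -/
theorem sq_weight_value {τ s : ℝ} (hτ : 0 ≤ τ) (v : E d → ℝ) (y : E d) :
    (τ ^ (3 / 2 : ℝ) * s ^ 2) ^ 2 *
        ‖psi s y ^ (3 / 2 : ℝ) * Real.exp (τ * psi s y) * v y‖ ^ 2 =
      s * (sig τ s y ^ 3 * (wt τ s y * v y) ^ 2) := by
  have h1 : ∀ x : ℝ, 0 ≤ x → (x ^ (3 / 2 : ℝ)) ^ 2 = x ^ 3 := fun x hx => by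
    rw [← Real.rpow_natCast, ← Real.rpow_mul hx, ← Real.rpow_natCast]; norm_num
  rw [Real.norm_eq_abs, sq_abs, mul_pow, mul_pow, mul_pow, h1 τ hτ, h1 _ (psi_pos s y).le]
  unfold sig wt
  ring

theorem sq_weight_gradient {τ s : ℝ} (hτ : 0 ≤ τ) (v : E d → ℝ) (y : E d) :
    (τ ^ (1 / 2 : ℝ) * s) ^ 2 *
        ‖(psi s y ^ (1 / 2 : ℝ) * Real.exp (τ * psi s y)) •
          gradientWithin v (closedHalfBall d) y‖ ^ 2 =
      s * (sig τ s y * (wt τ s y * ‖gradientWithin v (closedHalfBall d) y‖) ^ 2) := by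
  have h1 : ∀ x : ℝ, 0 ≤ x → (x ^ (1 / 2 : ℝ)) ^ 2 = x := fun x hx => by
    rw [← Real.rpow_natCast, ← Real.rpow_mul hx]; norm_num
  rw [norm_smul, mul_pow, mul_pow, Real.norm_eq_abs, sq_abs, mul_pow, h1 τ hτ,
    h1 _ (psi_pos s y).le]
  unfold sig wt
  ring

theorem neg_one_le_h {y : E d} (hy : y ∈ halfBall d) : -1 ≤ h y := by
  have h1 := norm_sq_eq_splitLast y
  have h2 : ‖(splitLast d y).2‖ ^ 2 = ∑ i : Fin d, y (Fin.castSucc i) ^ 2 := by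
    rw [EuclideanSpace.real_norm_sq_eq]; rfl
  have h3 := abs_le.1 ((abs_coord_le_norm y (Fin.last d)).trans hy.1.le)
  have h4 : ‖y‖ ^ 2 ≤ 1 / 4 := by nlinarith [hy.1, norm_nonneg y]
  unfold h
  rw [← h2]
  nlinarith [sq_nonneg (y (Fin.last d))]

/-- The symmetric part of the coefficient matrix. -/
def symmCoeff (a : Fin (d + 1) → Fin (d + 1) → E d → ℝ) (i j : Fin (d + 1)) (y : E d) : ℝ :=
  1 / 2 * (a i j y + a j i y)

theorem C1NormLE.symmCoeff {a : Fin (d + 1) → Fin (d + 1) → E d → ℝ} {M : ℝ}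
    (ha : C1NormLE (halfBall d) a M) : C1NormLE (halfBall d) (symmCoeff a) M := by
  intro i j
  refine ⟨contDiffOn_const.mul ((ha i j).1.add (ha j i).1), fun y hy => ⟨?_, fun k => ?_⟩⟩
  · have h1 := abs_le.1 ((ha i j).2 y hy).1
    have h2 := abs_le.1 ((ha j i).2 y hy).1
    unfold HalfBallCarleman.symmCoeff
    rw [abs_le]
    constructor <;> linarith
  · have h1 := abs_le.1 (((ha i j).2 y hy).2 k)
    have h2 := abs_le.1 (((ha j i).2 y hy).2 k)
    have hd : ∀ i j, DifferentiableAt ℝ (a i j) y := fun i j =>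
      ((ha i j).1.differentiableOn (by norm_num)).differentiableAt (isOpen_halfBall.mem_nhds hy)
    have e : ∀ f, partialWithin (halfBall d) k f y = pd k f y := fun f => by
      rw [partialWithin, fderivWithin_of_isOpen isOpen_halfBall hy, pd]
    rw [e] at h1 h2 ⊢
    have h3 : HasPD k (HalfBallCarleman.symmCoeff a i j) _ y :=
      ((HasPD.of_differentiableAt (hd i j) k).add
        (HasPD.of_differentiableAt (hd j i) k)).const_mul (1 / 2)
    rw [h3.pd_eq (((hd i j).add (hd j i)).const_mul (1 / 2)), abs_le]
    constructor <;> linarith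

/-- The antisymmetric part of a pairs to zero with a symmetric matrix. Used with ξ⊗ξ for ellipticity
and with the Hessian of v for the operator. -/
theorem sum_symmCoeff_mul (a : Fin (d + 1) → Fin (d + 1) → E d → ℝ) (y : E d)
    {X : Fin (d + 1) → Fin (d + 1) → ℝ} (hX : ∀ i j, X i j = X j i) :
    ∑ i, ∑ j, symmCoeff a i j y * X i j = ∑ i, ∑ j, a i j y * X i j := by
  have h1 : ∑ i, ∑ j, a j i y * X i j = ∑ i, ∑ j, a i j y * X i j := by
    rw [Finset.sum_comm]
    exact Finset.sum_congr rfl fun i _ => Finset.sum_congr rfl fun j _ => by rw [hX]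
  have h2 : ∑ i, ∑ j, symmCoeff a i j y * X i j =
      1 / 2 * ∑ i, ∑ j, a i j y * X i j + 1 / 2 * ∑ i, ∑ j, a j i y * X i j := by
    simp only [Finset.mul_sum, ← Finset.sum_add_distrib]
    refine Finset.sum_congr rfl fun i _ => Finset.sum_congr rfl fun j _ => ?_
    unfold symmCoeff
    ring
  rw [h2, h1]
  ring

theorem UniformlyElliptic.symmCoeff {a : Fin (d + 1) → Fin (d + 1) → E d → ℝ} {θ : ℝ}
    (ha : UniformlyElliptic (halfBall d) a θ) :
    UniformlyElliptic (halfBall d) (symmCoeff a) θ := by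
  intro y hy ξ
  have h1 := ha y hy ξ
  have h2 := sum_symmCoeff_mul a y (X := fun i j => ξ i * ξ j) fun i j => mul_comm _ _
  simp only [← mul_assoc] at h2
  rwa [h2]

theorem weightedOp_symmCoeff {a : Fin (d + 1) → Fin (d + 1) → E d → ℝ}
    {b : Fin (d + 1) → E d → ℝ} {c v : E d → ℝ} (hv : ContDiffOn ℝ 2 v (halfBall d)) {y : E d}
    (hy : y ∈ halfBall d) (τ s : ℝ) :
    weightedOp τ s (symmCoeff a) b c v y = Real.exp (τ * psi s y) * ellipticOp a b c v y := by
  unfold weightedOp ellipticOp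
  rw [sum_symmCoeff_mul a y fun i j => pd_comm_of_contDiffOn isOpen_halfBall hv hy j i]
  simp only [partialWithin_partialWithin_eq_pd hy, partialWithin_eq_pd hy]
  rfl

/-- The Carleman estimate for admissible parameters, with squared norms. -/
theorem carleman_squares {θ M ν ε s τ Kb Kc C : ℝ} {a : Fin (d + 1) → Fin (d + 1) → E d → ℝ}
    {b : Fin (d + 1) → E d → ℝ} {c v : E d → ℝ} (hadm : Admissible d θ M ν ε s τ Kb Kc)
    (hν : 0 ≤ ν) (hτ : 0 ≤ τ) (ha : C1NormLE (halfBall d) a M)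
    (hell : UniformlyElliptic (halfBall d) a θ)
    (hb : ∀ i, W1InftyNormLE (halfBall d) (b i) Kb) (hc : W1InftyNormLE (halfBall d) c Kc)
    (hv : ContDiffOn ℝ ∞ v (closedHalfBall d))
    (hC : ∀ t, |deriv Real.smoothTransition t| ≤ C) :
    ENNReal.ofReal (lowerConst d s ν) *
        ((ENNReal.ofReal (τ ^ (3 / 2 : ℝ) * s ^ 2) *
            eLpNorm (fun y => psi s y ^ (3 / 2 : ℝ) * Real.exp (τ * psi s y) * v y) 2
              (volume.restrict (halfBall d))) ^ 2 +
          (ENNReal.ofReal (τ ^ (1 / 2 : ℝ) * s) *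
            eLpNorm (fun y => (psi s y ^ (1 / 2 : ℝ) * Real.exp (τ * psi s y)) •
              gradientWithin v (closedHalfBall d) y) 2 (volume.restrict (halfBall d))) ^ 2) ≤
      ENNReal.ofReal s * eLpNorm (fun y => Real.exp (τ * psi s y) * ellipticOp a b c v y) 2
          (volume.restrict (halfBall d)) ^ 2 +
        ENNReal.ofReal (8 * layerConst d M s * ((d + 1 : ℕ) : ℝ) * C) *
          ((ENNReal.ofReal (τ ^ (3 / 2 : ℝ) * s ^ 2) *
              eLpNorm (fun y => psi s y ^ (3 / 2 : ℝ) * Real.exp (τ * psi s y) * v y) 2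
                (boundaryMeasure d)) ^ 2 +
            (ENNReal.ofReal (τ ^ (1 / 2 : ℝ) * s) *
              eLpNorm (fun y => (psi s y ^ (1 / 2 : ℝ) * Real.exp (τ * psi s y)) •
                gradientWithin v (closedHalfBall d) y) 2 (boundaryMeasure d)) ^ 2) := by
  have hs := hadm.s_nonneg
  have hU := isOpen_halfBall (d := d)
  have hv2 : ContDiffOn ℝ 2 v (halfBall d) :=
    (hv.mono halfBall_subset_closedHalfBall).of_le (WithTop.coe_le_coe.2 le_top)
  have hk1 : 0 ≤ τ ^ (3 / 2 : ℝ) * s ^ 2 := by positivity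
  have hk2 : 0 ≤ τ ^ (1 / 2 : ℝ) * s := by positivity
  have hσ : ∀ y : E d, 0 ≤ sig τ s y := fun y =>
    mul_nonneg (mul_nonneg hτ hs) (psi_pos s y).le
  -- Tietze extension: the layer estimates take a globally continuous function, while the density
  -- with one-sided derivatives is continuous only on the closed half ball.
  obtain ⟨G, hG⟩ := ContinuousMap.exists_restrict_eq isClosed_closedHalfBall
    (⟨_, (continuousOn_closedDensity hv τ s).domRestrict⟩ : C(closedHalfBall d, ℝ))
  have hG' : ∀ y ∈ closedHalfBall d, G y = closedDensity τ s v y := fun y hy =>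
    DFunLike.congr_fun hG (⟨y, hy⟩ : closedHalfBall d)
  have hest := carleman_lintegral_estimate hadm hν (a := symmCoeff a) (G := G)
    (fun i j => funext fun y => by unfold symmCoeff; ring) ha.symmCoeff hell.symmCoeff hb hc hv2
    (fun y hy => (hG' y (halfBall_subset_closedHalfBall hy)).trans
      (closedDensity_eq_density hy τ s v)) G.continuous hC
  have key : ∀ μ : Measure (E d),
      (ENNReal.ofReal (τ ^ (3 / 2 : ℝ) * s ^ 2) *
        eLpNorm (fun y => psi s y ^ (3 / 2 : ℝ) * Real.exp (τ * psi s y) * v y) 2 μ) ^ 2 +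
      (ENNReal.ofReal (τ ^ (1 / 2 : ℝ) * s) *
        eLpNorm (fun y => (psi s y ^ (1 / 2 : ℝ) * Real.exp (τ * psi s y)) •
          gradientWithin v (closedHalfBall d) y) 2 μ) ^ 2 =
      ENNReal.ofReal s * ((∫⁻ y, ENNReal.ofReal (sig τ s y ^ 3 * (wt τ s y * v y) ^ 2) ∂μ) +
        ∫⁻ y, ENNReal.ofReal (sig τ s y *
          (wt τ s y * ‖gradientWithin v (closedHalfBall d) y‖) ^ 2) ∂μ) := by
    intro μ
    rw [sq_ofReal_mul_eLpNorm_two hk1, sq_ofReal_mul_eLpNorm_two hk2, mul_add,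
      ← lintegral_const_mul' _ _ ENNReal.ofReal_ne_top,
      ← lintegral_const_mul' _ _ ENNReal.ofReal_ne_top]
    simp only [sq_weight_value hτ, sq_weight_gradient hτ, ENNReal.ofReal_mul hs]
  have hsum : ∀ y : E d, ENNReal.ofReal (sig τ s y ^ 3 * (wt τ s y * v y) ^ 2) +
      ENNReal.ofReal (sig τ s y * (wt τ s y * ‖gradientWithin v (closedHalfBall d) y‖) ^ 2) =
      ENNReal.ofReal (closedDensity τ s v y) := fun y => by
    rw [← ENNReal.ofReal_add (mul_nonneg (pow_nonneg (hσ y) 3) (sq_nonneg _))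
      (mul_nonneg (hσ y) (sq_nonneg _)), add_comm]
    rfl
  have hin : (∫⁻ y in halfBall d, ENNReal.ofReal (sig τ s y ^ 3 * (wt τ s y * v y) ^ 2)) +
        ∫⁻ y in halfBall d, ENNReal.ofReal (sig τ s y *
          (wt τ s y * ‖gradientWithin v (closedHalfBall d) y‖) ^ 2) ≤
      ∫⁻ y in halfBall d, ENNReal.ofReal (density τ s v y) := by
    -- Superadditivity of the lower integral is the direction needed inside and requires no
    -- measurability; the boundary integral needs the other direction, hence the measurability
    -- argument there.
    refine (le_lintegral_add _ _).trans_eq (setLIntegral_congr_fun hU.measurableSet fun y hy => ?_)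
    simp only [hsum, closedDensity_eq_density hy]
  have hbd : ∫⁻ y, ENNReal.ofReal (G y) ∂boundaryMeasure d =
      (∫⁻ y, ENNReal.ofReal (sig τ s y ^ 3 * (wt τ s y * v y) ^ 2) ∂boundaryMeasure d) +
        ∫⁻ y, ENNReal.ofReal (sig τ s y *
          (wt τ s y * ‖gradientWithin v (closedHalfBall d) y‖) ^ 2) ∂boundaryMeasure d := by
    have hm : AEMeasurable (fun y => ENNReal.ofReal (sig τ s y ^ 3 * (wt τ s y * v y) ^ 2))
        (boundaryMeasure d) := by
      rw [← Measure.restrict_eq_self_of_ae_mem (ae_boundaryMeasure_mem (d := d))]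
      exact ((((contDiff_sig τ s).continuous.continuousOn.pow 3).mul
        (((contDiff_wt τ s).continuous.continuousOn.mul hv.continuousOn).pow 2)).aemeasurable
          isClosed_closedHalfBall.measurableSet).ennreal_ofReal
    rw [← lintegral_add_left' hm]
    refine lintegral_congr_ae ?_
    filter_upwards [ae_boundaryMeasure_mem] with y hy
    rw [hsum, hG' y hy]
  have hop : ∫⁻ y in halfBall d, ENNReal.ofReal (weightedOp τ s (symmCoeff a) b c v y ^ 2) =
      eLpNorm (fun y => Real.exp (τ * psi s y) * ellipticOp a b c v y) 2
          (volume.restrict (halfBall d)) ^ 2 := by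
    have h1 := sq_ofReal_mul_eLpNorm_two (μ := volume.restrict (halfBall d)) zero_le_one
      (fun y => Real.exp (τ * psi s y) * ellipticOp a b c v y)
    rw [ENNReal.ofReal_one, one_mul] at h1
    rw [h1]
    refine setLIntegral_congr_fun hU.measurableSet fun y hy => ?_
    simp only [weightedOp_symmCoeff hv2 hy, one_pow, one_mul, Real.norm_eq_abs, sq_abs]
  rw [key, key, ← hbd, ← hop]
  calc _ ≤ ENNReal.ofReal (lowerConst d s ν) *
        (ENNReal.ofReal s * ∫⁻ y in halfBall d, ENNReal.ofReal (density τ s v y)) := by gcongr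
    _ = ENNReal.ofReal s * (ENNReal.ofReal (lowerConst d s ν) *
        ∫⁻ y in halfBall d, ENNReal.ofReal (density τ s v y)) := by ring
    _ ≤ _ := mul_le_mul_right hest _
    _ = _ := by ring

/-- Passage from squares to the quantities themselves. -/
theorem add_le_of_squares {Z₁ Z₂ X Y₁ Y₂ : ℝ≥0∞} {l p q R : ℝ} (hl : 0 < l)
    (hpR : p ≤ R) (hqR : q ≤ R) (hR : 0 < R)
    (hle : ENNReal.ofReal l * (Z₁ ^ 2 + Z₂ ^ 2) ≤
      ENNReal.ofReal p * X ^ 2 + ENNReal.ofReal q * (Y₁ ^ 2 + Y₂ ^ 2)) :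
    ENNReal.ofReal (√(l / R) / 2) * Z₁ + ENNReal.ofReal (√(l / R) / 2) * Z₂ ≤ X + Y₁ + Y₂ := by
  have hlR : 0 < l / R := div_pos hl hR
  have h1 : ENNReal.ofReal l * (Z₁ ^ 2 + Z₂ ^ 2) ≤ ENNReal.ofReal R * (X + Y₁ + Y₂) ^ 2 := by
    calc _ ≤ _ := hle
      _ ≤ ENNReal.ofReal R * X ^ 2 + ENNReal.ofReal R * (Y₁ ^ 2 + Y₂ ^ 2) := by gcongr
      _ = ENNReal.ofReal R * (X ^ 2 + Y₁ ^ 2 + Y₂ ^ 2) := by ring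
      _ ≤ ENNReal.ofReal R * (X + Y₁ + Y₂) ^ 2 := by
        gcongr
        calc X ^ 2 + Y₁ ^ 2 + Y₂ ^ 2 ≤ X ^ 2 + Y₁ ^ 2 + Y₂ ^ 2 +
              (2 * X * Y₁ + 2 * X * Y₂ + 2 * Y₁ * Y₂) := le_self_add
          _ = _ := by ring
  have hR0 : ENNReal.ofReal R ≠ 0 := (ENNReal.ofReal_pos.2 hR).ne'
  have key : ∀ Z : ℝ≥0∞, Z ^ 2 ≤ Z₁ ^ 2 + Z₂ ^ 2 →
      ENNReal.ofReal (√(l / R)) * Z ≤ X + Y₁ + Y₂ := by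
    intro Z hZ
    refine (ENNReal.pow_le_pow_left_iff two_ne_zero).1 ?_
    rw [mul_pow, ← ENNReal.ofReal_pow (Real.sqrt_nonneg _), Real.sq_sqrt hlR.le]
    refine (ENNReal.mul_le_mul_iff_right hR0 ENNReal.ofReal_ne_top).1 ?_
    rw [← mul_assoc, ← ENNReal.ofReal_mul hR.le, mul_div_cancel₀ _ hR.ne']
    exact (mul_le_mul_right hZ _).trans h1
  have h2 := key Z₁ le_self_add
  have h3 := key Z₂ le_add_self
  have h4 : ∀ Z : ℝ≥0∞, ENNReal.ofReal (√(l / R) / 2) * Z =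
      ENNReal.ofReal (1 / 2) * (ENNReal.ofReal (√(l / R)) * Z) := fun Z => by
    rw [← mul_assoc, ← ENNReal.ofReal_mul (by norm_num)]
    congr 2
    ring
  rw [h4, h4, ← mul_add]
  calc _ ≤ ENNReal.ofReal (1 / 2) * ((X + Y₁ + Y₂) + (X + Y₁ + Y₂)) := by gcongr
    _ = ENNReal.ofReal (1 / 2) * 2 * (X + Y₁ + Y₂) := by ring
    _ = X + Y₁ + Y₂ := by
      have : (2 : ℝ≥0∞) = ENNReal.ofReal 2 := by simp
      rw [this, ← ENNReal.ofReal_mul (by norm_num)]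
      norm_num

end Norms

/-! ### Choice of s₀, ε and the threshold for τ. -/

section Parameters

variable {d : ℕ}

/-- Since h ≥ -1 on the half ball, σ is bounded below uniformly by a multiple of τ depending only on
s. -/
theorem mul_exp_neg_le_sig {τ s : ℝ} (hτ : 0 ≤ τ) (hs : 0 ≤ s) {y : E d} (hy : y ∈ halfBall d) :
    τ * (s * Real.exp (-s)) ≤ sig τ s y := by
  rw [sig, psi, ← mul_assoc]
  refine mul_le_mul_of_nonneg_left (Real.exp_le_exp.2 ?_) (mul_nonneg hτ hs)
  nlinarith [neg_one_le_h hy]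

/-- The lower bound on the large parameter that absorbs the lower order coefficients. -/
theorem exists_threshold {κ ε D K δ : ℝ} (hκ : 0 < κ) (hε : 0 < ε) (hD : 0 < D) (hK : 0 < K)
    (hδ : 0 < δ) :
    ∃ Cs : ℝ, 0 < Cs ∧ ∀ α lam τ : ℝ, (δ ≤ |α| ∨ δ ≤ |lam|) → Cs * (|α| + √|lam|) < τ →
      0 < τ ∧ 1 ≤ τ * κ * ε ∧ D * (K * (|α| + 1)) ≤ ε * (τ * κ) ∧
        D * (K * (α ^ 2 + |lam|)) ≤ ε * (τ * κ) ^ 2 := by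
  -- A lower bound for |α| + √|λ|. It forces τ to be large and lets the constant 1 in |α| + 1 be
  -- absorbed.
  obtain ⟨m, hm⟩ : ∃ m, m = min δ √δ := ⟨_, rfl⟩
  have hm0 : 0 < m := by rw [hm]; positivity
  obtain ⟨P₁, h1, hP₁⟩ : ∃ P, 0 < P ∧ P * (m * κ * ε) = 1 :=
    ⟨1 / (m * κ * ε), by positivity, div_mul_cancel₀ _ (by positivity)⟩
  obtain ⟨P₂, h2, hP₂⟩ : ∃ P, 0 < P ∧ P * (ε * κ) = D * K * (1 + 1 / m) :=
    ⟨D * K * (1 + 1 / m) / (ε * κ), by positivity, div_mul_cancel₀ _ (by positivity)⟩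
  obtain ⟨P₃, h3, hP₃⟩ : ∃ P, 0 < P ∧ P * (ε * κ ^ 2) = D * K :=
    ⟨D * K / (ε * κ ^ 2), by positivity, div_mul_cancel₀ _ (by positivity)⟩
  -- P₁ gives 1 ≤ τκε, P₂ handles the bound of b, and P₃ that of c. The summand 1 gives x ≤ τ, used
  -- for τ > 0 and as the second factor in the quadratic bound.
  refine ⟨1 + P₁ + P₂ + P₃, by positivity, fun α lam τ hαl hτ => ?_⟩
  obtain ⟨x, hx⟩ : ∃ x, x = |α| + √|lam| := ⟨_, rfl⟩
  rw [← hx] at hτ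
  have hmx : m ≤ x := by
    rw [hm, hx]
    rcases hαl with h | h
    · exact (min_le_left _ _).trans (h.trans (le_add_of_nonneg_right (Real.sqrt_nonneg _)))
    · exact (min_le_right _ _).trans ((Real.sqrt_le_sqrt h).trans
        (le_add_of_nonneg_left (abs_nonneg _)))
  have hx0 : 0 < x := hm0.trans_le hmx
  have hle : ∀ P, P ≤ 1 + P₁ + P₂ + P₃ → P * x ≤ τ := fun P hP =>
    (mul_le_mul_of_nonneg_right hP hx0.le).trans hτ.le
  have hx1 : x ≤ τ := by simpa only [one_mul] using hle 1 (by linarith)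
  have hτ1 : P₁ * x ≤ τ := hle P₁ (by linarith)
  have hτ2 : P₂ * x ≤ τ := hle P₂ (by linarith)
  have hτ3 : P₃ * x ≤ τ := hle P₃ (by linarith)
  have hτ0 : 0 < τ := hx0.trans_le hx1
  refine ⟨hτ0, ?_, ?_, ?_⟩
  · calc (1 : ℝ) = P₁ * (m * κ * ε) := hP₁.symm
      _ = P₁ * m * (κ * ε) := by ring
      _ ≤ P₁ * x * (κ * ε) := by gcongr
      _ ≤ τ * (κ * ε) := by gcongr
      _ = τ * κ * ε := by ring
  · have h4 : |α| + 1 ≤ (1 + 1 / m) * x := by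
      have h5 : 1 ≤ 1 / m * x := by rw [one_div_mul_eq_div, one_le_div hm0]; exact hmx
      have h6 : |α| ≤ x := hx ▸ le_add_of_nonneg_right (Real.sqrt_nonneg |lam|)
      rw [add_mul, one_mul]
      exact add_le_add h6 h5
    calc D * (K * (|α| + 1)) = D * K * (|α| + 1) := by ring
      _ ≤ D * K * ((1 + 1 / m) * x) := mul_le_mul_of_nonneg_left h4 (mul_pos hD hK).le
      _ = P₂ * (ε * κ) * x := by rw [hP₂]; ring
      _ = P₂ * x * (ε * κ) := by ring
      _ ≤ τ * (ε * κ) := mul_le_mul_of_nonneg_right hτ2 (mul_pos hε hκ).le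
      _ = ε * (τ * κ) := by ring
  · have h4 : α ^ 2 + |lam| ≤ x * x := by
      have h5 := Real.mul_self_sqrt (abs_nonneg lam)
      have h6 := sq_abs α
      have h7 := mul_nonneg (abs_nonneg α) (Real.sqrt_nonneg |lam|)
      rw [hx]
      linarith [show (|α| + √|lam|) * (|α| + √|lam|) =
        |α| ^ 2 + 2 * (|α| * √|lam|) + √|lam| * √|lam| by ring]
    calc D * (K * (α ^ 2 + |lam|)) = D * K * (α ^ 2 + |lam|) := by ring
      _ ≤ D * K * (x * x) := mul_le_mul_of_nonneg_left h4 (mul_pos hD hK).le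
      _ = P₃ * x * x * (ε * κ ^ 2) := by rw [← hP₃]; ring
      _ ≤ τ * τ * (ε * κ ^ 2) := by gcongr
      _ = ε * (τ * κ) ^ 2 := by ring

theorem exists_pos_le_one_mul_le (A : ℝ) {B : ℝ} (hB : 0 < B) :
    ∃ ε : ℝ, 0 < ε ∧ ε ≤ 1 ∧ A * ε ≤ B := by
  have hA : 0 < |A| + 1 := by positivity
  have h0 : 0 < min 1 (B / (|A| + 1)) := lt_min one_pos (div_pos hB hA)
  refine ⟨_, h0, min_le_left _ _, ?_⟩
  calc A * min 1 (B / (|A| + 1)) ≤ (|A| + 1) * min 1 (B / (|A| + 1)) :=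
        mul_le_mul_of_nonneg_right (by linarith [le_abs_self A]) h0.le
    _ ≤ (|A| + 1) * (B / (|A| + 1)) := mul_le_mul_of_nonneg_left (min_le_right _ _) hA.le
    _ = B := by rw [mul_div_cancel₀ _ hA.ne']

/-- Large parameters are admissible. -/
theorem exists_admissible (d : ℕ) {θ : ℝ} (M : ℝ) (hθ : 0 < θ) (hM : 0 < M) :
    ∃ s₀ : ℝ, 0 < s₀ ∧ ∀ s : ℝ, s₀ ≤ s → ∀ K δ : ℝ, 0 < K → 0 < δ →
      ∃ Cs ε : ℝ, 0 < Cs ∧ ∀ α lam τ : ℝ, (δ ≤ |α| ∨ δ ≤ |lam|) → Cs * (|α| + √|lam|) < τ →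
        Admissible d θ M (θ ^ 2 / 16) ε s τ (K * (|α| + 1)) (K * (α ^ 2 + |lam|)) := by
  have hν : 0 < θ ^ 2 / 16 := by positivity
  -- Here ν = θ²/16 is the product of the lower bound θ/4 for `symb` with itself, the smaller of the
  -- two leading coefficients. The threshold for s absorbs only errors independent of s, so it does
  -- not see K or δ.
  refine ⟨max 1 (2 * coeffError ((d + 1 : ℕ) : ℝ) (coeffBound d M) / (θ ^ 2 / 16)),
    lt_max_of_lt_left one_pos, fun s hs K δ hK hδ => ?_⟩
  have hs1 : 0 < s := one_pos.trans_le ((le_max_left _ _).trans hs)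
  have hs2 := (div_le_iff₀ hν).1 ((le_max_right _ _).trans hs)
  obtain ⟨ε, hε, hε1, hεA⟩ := exists_pos_le_one_mul_le
    (2 * smallError ((d + 1 : ℕ) : ℝ) (coeffBound d M) s +
      2 * remainderConst ((d + 1 : ℕ) : ℝ) (coeffBound d M) s ^ 2) (half_pos (mul_pos hs1 hν))
  have hκ : 0 < s * Real.exp (-s) := by positivity
  have hD : 0 < 1 + (s + 2) * ((d + 1 : ℕ) : ℝ) := by positivity
  obtain ⟨Cs, hCs, hthr⟩ := exists_threshold hκ hε hD hK hδ
  refine ⟨Cs, ε, hCs, fun α lam τ hαl hτ => ?_⟩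
  obtain ⟨hτ0, hone, hKb, hKc⟩ := hthr α lam τ hαl hτ
  have hσ : ∀ y ∈ halfBall d, τ * (s * Real.exp (-s)) ≤ sig τ s y := fun y hy =>
    mul_exp_neg_le_sig hτ0.le hs1.le hy
  have hτκ := mul_pos hτ0 hκ
  exact
    { θ_nonneg := hθ.le
      M_nonneg := hM.le
      s_nonneg := hs1.le
      Kb_nonneg := mul_nonneg hK.le (add_nonneg (abs_nonneg _) zero_le_one)
      Kc_nonneg := mul_nonneg hK.le (add_nonneg (sq_nonneg _) (abs_nonneg _))
      ε_le := hε1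
      sig_nonneg := fun y hy => hτκ.le.trans (hσ y hy)
      one_le := fun y hy => hone.trans (mul_le_mul_of_nonneg_right (hσ y hy) hε.le)
      ν_le := by linarith [show θ / 4 * θ = 4 * (θ ^ 2 / 16) by ring]
      ν_le' := le_of_eq (by ring)
      coeff_le := hs2
      small_le := hεA
      Kb_le := fun y hy => hKb.trans (mul_le_mul_of_nonneg_left (hσ y hy) hε.le)
      Kc_le := fun y hy => hKc.trans
        (mul_le_mul_of_nonneg_left (pow_le_pow_left₀ hτκ.le (hσ y hy) 2) hε.le) }

end Parameters

end HalfBallCarleman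

end

/-! ### The theorem. -/

open HalfBallCarleman in
theorem proposition4 (d : ℕ) (θ M : ℝ) (hθ : 0 < θ) (hM : 0 < M) :
    ∃ s₀ : ℝ, 0 < s₀ ∧ ∀ s : ℝ, s₀ ≤ s → ∀ K δ : ℝ, 0 < K → 0 < δ →
      ∃ Cs C₀ : ℝ, 0 < Cs ∧ 0 < C₀ ∧
        ∀ (a : Fin (d + 1) → Fin (d + 1) → E d → ℝ) (b : Fin (d + 1) → E d → ℝ) (c : E d → ℝ)
          (α lam : ℝ),
          C1NormLE (halfBall d) a M → UniformlyElliptic (halfBall d) a θ →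
          (∀ i, W1InftyNormLE (halfBall d) (b i) (K * (|α| + 1))) →
          W1InftyNormLE (halfBall d) c (K * (α ^ 2 + |lam|)) →
          (δ ≤ |α| ∨ δ ≤ |lam|) →
          ∀ v : E d → ℝ, ContDiffOn ℝ ∞ v (closedHalfBall d) →
          ∀ τ : ℝ, Cs * (|α| + √|lam|) < τ →
            ENNReal.ofReal (C₀ * τ ^ (3 / 2 : ℝ) * s ^ 2) *
                eLpNorm (fun y => psi s y ^ (3 / 2 : ℝ) * Real.exp (τ * psi s y) * v y) 2
                  (volume.restrict (halfBall d)) +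
              ENNReal.ofReal (C₀ * τ ^ (1 / 2 : ℝ) * s) *
                eLpNorm (fun y => (psi s y ^ (1 / 2 : ℝ) * Real.exp (τ * psi s y)) •
                    gradientWithin v (closedHalfBall d) y) 2
                  (volume.restrict (halfBall d)) ≤
            eLpNorm (fun y => Real.exp (τ * psi s y) * ellipticOp a b c v y) 2
                (volume.restrict (halfBall d)) +
              ENNReal.ofReal (τ ^ (3 / 2 : ℝ) * s ^ 2) *
                eLpNorm (fun y => psi s y ^ (3 / 2 : ℝ) * Real.exp (τ * psi s y) * v y) 2
                  (boundaryMeasure d) +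
              ENNReal.ofReal (τ ^ (1 / 2 : ℝ) * s) *
                eLpNorm (fun y => (psi s y ^ (1 / 2 : ℝ) * Real.exp (τ * psi s y)) •
                    gradientWithin v (closedHalfBall d) y) 2
                  (boundaryMeasure d) := by
  obtain ⟨C, -, hC⟩ := exists_deriv_smoothTransition_le
  obtain ⟨s₀, hs₀, hadm⟩ := exists_admissible d M hθ hM
  refine ⟨s₀, hs₀, fun s hs K δ hK hδ => ?_⟩
  obtain ⟨Cs, ε, hCs, hadm⟩ := hadm s hs K δ hK hδ
  have hs' : 0 < s := hs₀.trans_le hs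
  have hl : 0 < lowerConst d s (θ ^ 2 / 16) := by unfold lowerConst; positivity
  -- The operator and boundary terms have coefficient 1 in the statement, so their constants are
  -- majorised by a single R and moved into C₀; the halving in C₀ pays for adding the two interior
  -- norms. The resulting C₀ depends on neither K nor δ.
  set R : ℝ := max s (8 * layerConst d M s * ((d + 1 : ℕ) : ℝ) * C) with hRdef
  have hR : 0 < R := lt_max_of_lt_left hs'
  have hC₀ : 0 < √(lowerConst d s (θ ^ 2 / 16) / R) / 2 :=
    half_pos (Real.sqrt_pos.2 (div_pos hl hR))
  refine ⟨Cs, √(lowerConst d s (θ ^ 2 / 16) / R) / 2, hCs, hC₀,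
    fun a b c α lam ha hell hb hc hαl v hv τ hτ => ?_⟩
  have hτ0 : 0 ≤ τ := le_trans (by positivity) hτ.le
  have hsq := carleman_squares (hadm α lam τ hαl hτ) (by positivity) hτ0 ha hell hb hc hv hC
  have hfinal := add_le_of_squares hl (le_max_left _ _) (le_max_right _ _) hR hsq
  rwa [← mul_assoc, ← mul_assoc, ← ENNReal.ofReal_mul hC₀.le, ← ENNReal.ofReal_mul hC₀.le,
    ← mul_assoc, ← mul_assoc] at hfinal
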